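/- Let $p\ge 0$ be an integer, let $P_k$ be the Legendre polynomials ($P_k(1)=1$), $R^-_{p+1}=P_{p+1}-P_p$ the right Radau polynomial, and define its repeated integrals by $R^{-,(0)}_{p+1}=R^-_{p+1}$, $R^{-,(-(k+1))}_{p+1}(\xi)=\int_{-1}^{\xi}R^{-,(-k)}_{p+1}(s)\,ds$. Let $a>0$, $L>0$, and let $u(x,t)$, $t\ge 0$, be a smooth solution of $u_t+a u_x=0$ that is $L$-periodic in $x$. For $N\ge 1$ divide a period $[x_0,x_0+L]$ into $N$ cells $I_j=[x_0+jh,x_0+(j+1)h]$, $j\in\mathbb Z/N$, of size $h=L/N$, and let $u_j(\xi,t)=u\bigl(x_0+jh+\tfrac h2(\xi+1),t\bigr)$, $\xi\in[-1,1]$. Let $U_j(\xi,t)=\sum_{k=0}^p c_{jk}(t)P_k(\xi)$ be the solution of the upwind discontinuous Galerkin scheme $$\frac{d}{dt}c_{jk}+\frac{(2k+1)a}{h}\int_{-1}^1\frac{\partial U_j}{\partial\xi}P_k\,d\xi=-\frac{(2k+1)a}{h}(-1)^k[[U_j]],\qquad k=0,\dots,p,$$ where $[[U_j]]=U_j(-1,t)-U_{j-1}(1,t)$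 and the indices $j$ are cyclic. Let the initial data be $U_j(\cdot,0)=\Pi_N\bigl(u_j(\cdot,0)\bigr)$, where $\Pi_N$ is a linear map from $C^\infty([-1,1])$ to the polynomials of degree at most $p$, the same on all cells of the mesh, and bounded uniformly in $N$ with respect to the norm of $C^r([-1,1])$ for some $r$. Let $\epsilon_j(\xi,t)=U_j(\xi,t)-u_j(\xi,t)$, and suppose that $$\int_{-1}^1\epsilon_j(\xi,0)P_k(\xi)\,d\xi=\mathcal O(h^{2p+1-k}),\qquad k=0,\dots,p,$$ uniformly in $j$, as $N\to\infty$. Then the error tends exponentially fast in time to a superconvergent form. Precisely, there are a constant $\sigma>0$ depending only on $p$, and functions $\alpha_{p+2}(t),\dots,\alpha_{2p+1}(t)$ depending on $N$ and $j$, such that, for every $T>0$, uniformly in $j$, $\xi\in[-1,1]$ and $t\in[0,T]$, as $N\to\infty$: $\alpha_k(t)=\mathcal O(h^k)$, $$\epsilon_j(\xi,t)=\epsilon_j(1,t)+\frac{(-1)^{p+1}}2[[U_j]]R^-_{p+1}(\xi)+\sum_{k=1}^{p}\alpha_{p+1+k}(t)R^{-,(-k)}_{p+1}(\xi)+\mathcal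 O(h^{2p+2})+\mathcal O\bigl(h^{p+1}e^{-\sigma a t/h}\bigr),$$ and the error at the downwind point satisfies $$\epsilon_j(1,t)=\mathcal O(h^{2p+1})+\mathcal O\bigl(h^{p+1}e^{-\sigma at/h}\bigr).$$ If $p\ge1$, then consequently at every right Radau point, that is, at every $\xi_0\in[-1,1]$ with $R^-_{p+1}(\xi_0)=0$, $$\epsilon_j(\xi_0,t)=\mathcal O(h^{p+2})+\mathcal O\bigl(h^{p+1}e^{-\sigma at/h}\bigr).$$ -/

import Mathlib

open Polynomial
open scoped ContDiff

namespace DGAdvection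

noncomputable section

/-- The Legendre polynomial `P_n` (Rodrigues' formula), normalized by `P_n(1) = 1`. -/
def legendre (n : ℕ) : ℝ[X] :=
  C (1 / (2 ^ n * (n.factorial : ℝ))) * (derivative^[n] ((X ^ 2 - 1) ^ n))

/-- The right Radau polynomial `R⁻_{p+1} = P_{p+1} - P_p`. -/
def radau (p : ℕ) : ℝ[X] := legendre (p + 1) - legendre p

/-- The repeated integrals `R^{-,(-k)}_{p+1}` of the right Radau polynomial, from `-1`. -/
def radauInt (p : ℕ) : ℕ → ℝ → ℝ
  | 0, ξ => (radau p).eval ξ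
  | k + 1, ξ => ∫ s in (-1 : ℝ)..ξ, radauInt p k s

/-- A smooth solution of `u_t + a u_x = 0` for `t ≥ 0`, `L`-periodic in `x`
(`u x t` is the value at the point `x` and the time `t`). -/
structure IsSmoothPeriodicSolution (a L : ℝ) (u : ℝ → ℝ → ℝ) : Prop where
  smooth : ContDiffOn ℝ ∞ (Function.uncurry u) (Set.univ ×ˢ Set.Ici 0)
  periodic : ∀ x t, 0 ≤ t → u (x + L) t = u x t
  pde : ∀ x t, 0 < t → deriv (fun s => u x s) t + a * deriv (fun y => u y t) x = 0

/-- The restriction of a function of `x` to the cell `[x₀ + j h, x₀ + (j + 1) h]`, `h = L / N`,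
of the uniform mesh with `N` cells, mapped to the canonical element `[-1, 1]`. -/
def toCell (x₀ L : ℝ) (N : ℕ) (j : ZMod N) (v : ℝ → ℝ) : ℝ → ℝ :=
  fun ξ => v (x₀ + (j.val : ℝ) * (L / N) + (L / N) / 2 * (ξ + 1))

/-- The polynomial `∑_{k ≤ p} c_k P_k` on the canonical element. -/
def cellPoly (p : ℕ) (c : ℕ → ℝ) : ℝ[X] :=
  ∑ k ∈ Finset.range (p + 1), C (c k) * legendre k

/-- The numerical solution `U_j(·, t)` with the Legendre coefficients `c j k t`. -/
def numSol (p : ℕ) {N : ℕ} (c : ZMod N → ℕ → ℝ → ℝ) (j : ZMod N) (t : ℝ) : ℝ[X] :=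
  cellPoly p (fun k => c j k t)

/-- The jump `[[U_j]] = U_j(-1) - U_{j-1}(1)`; cell indices are cyclic (periodic boundary). -/
def jump (p : ℕ) {N : ℕ} (c : ZMod N → ℕ → ℝ → ℝ) (j : ZMod N) (t : ℝ) : ℝ :=
  (numSol p c j t).eval (-1) - (numSol p c (j - 1) t).eval 1

/-- The upwind discontinuous Galerkin scheme of degree `p` for `u_t + a u_x = 0` on a uniform
periodic mesh of `N` cells of size `h`, as the system of ODEs for the Legendre coefficients. -/
def IsDGSolution (p : ℕ) (a h : ℝ) {N : ℕ} (c : ZMod N → ℕ → ℝ → ℝ) : Prop :=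
  ∀ (j : ZMod N) (k : ℕ), k ≤ p → ∀ t : ℝ, 0 ≤ t →
    HasDerivWithinAt (c j k)
      (-((2 * k + 1) * a / h) *
          (∫ ξ in (-1 : ℝ)..1, (derivative (numSol p c j t)).eval ξ * (legendre k).eval ξ)
        - (2 * k + 1) * a / h * (-1) ^ k * jump p c j t)
      (Set.Ici 0) t

/-- A family (indexed by the number `N` of cells) of linear projections of smooth functions on the
canonical element `[-1, 1]` into the polynomials of degree at most `p`, stable uniformly in `N`
with respect to some `C^r([-1, 1])` norm. (Stability makes `proj N v` depend on `v` restricted to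
`[-1, 1]` only.) One and the same `proj N` is used on all cells of the mesh with `N` cells. -/
structure IsStableProjection (p : ℕ) (proj : ℕ → (ℝ → ℝ) → ℝ[X]) : Prop where
  degree_le : ∀ N v, ContDiff ℝ ∞ v → (proj N v).natDegree ≤ p
  map_add : ∀ N v w, ContDiff ℝ ∞ v → ContDiff ℝ ∞ w → proj N (v + w) = proj N v + proj N w
  map_smul : ∀ N (b : ℝ) v, ContDiff ℝ ∞ v → proj N (b • v) = b • proj N v
  stable : ∃ (r : ℕ) (B : ℝ), ∀ N v, ContDiff ℝ ∞ v → ∀ M : ℝ,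
    (∀ i ≤ r, ∀ ξ ∈ Set.Icc (-1 : ℝ) 1, |iteratedDeriv i v ξ| ≤ M) →
      ∀ ξ ∈ Set.Icc (-1 : ℝ) 1, |(proj N v).eval ξ| ≤ B * M

/-- The error `ε_j(ξ, t) = U_j(ξ, t) - u_j(ξ, t)` on the canonical element. -/
def dgError (p : ℕ) (x₀ L : ℝ) (u : ℝ → ℝ → ℝ) {N : ℕ} (c : ZMod N → ℕ → ℝ → ℝ) (j : ZMod N)
    (ξ t : ℝ) : ℝ :=
  (numSol p c j t).eval ξ - toCell x₀ L N j (fun x => u x t) ξ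

end

end DGAdvection

open Polynomial
open scoped ContDiff

namespace DGAdvection

noncomputable section

/-! On a uniform periodic mesh the scheme is translation invariant, and its solution splits into a
slow part, a transient part and a small core.

The slow part is the sum of `h ^ m ∂ₓ^m u` times `profile p m`, `m ≤ 2p + 1`. A profile is half the
primitive of its predecessor, cut down to degree `p` by a multiple of the Radau polynomial; `upwind`
therefore sends each profile to minus its predecessor (`upwind_coefL_profile_succ`). The profiles
differ from the Taylor monomials by repeated integrals of the Radau polynomial. These vanish at `1`
and are still orthogonal to low degrees (`eval_one_radauPoly`, `integralPoly_radauPoly_mul`), so the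
slow part has the claimed form, follows the exact solution at the downwind point, and has residual
`O(h ^ (2p+2))`.

The transient part absorbs the initial deviation `∑ v_k P_k` from the slow part. It is expanded in
powers of `h ∂ₓ` in the fast time `a t / h`; at leading order the scheme is that of a single
periodic cell. There the energy is dissipated by the squared jump, and a mean-free polynomial whose
jump stays zero is zero, so mean-free data decay exponentially (`exists_periodicFlow_decay`). At
higher orders the means are fixed by the pairing with the adjoint mode `exp (-(ξ+1) h ∂ₓ / 2)`,
which is merely transported (`IsChain.hasDerivAt_chainPairing`). As `P_k` is orthogonal to this mode
below order `k`, it decays up to constants of order `h ^ k` (`exists_transient`). With `v_k = O(h ^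
(2p+1-k))` only cell averages `O(h ^ (2p+1))` are left over.

The core starts from these averages and is driven by the residuals. Energy stability of the solution
and of its cell differences gives stability in the maximum norm (`norm_le_of_smooth_source`).
Applied to the core and to its time derivative, it bounds the core by `O(h ^ (2p+1))` and the scheme
operator on it by `O(h ^ (2p+2))` (`exists_core_bound`). By the strong form
(`integral_toPoly_schemeOp`) the latter says that the core is its downwind value plus a jump times
the Radau polynomial, up to `O(h ^ (2p+2))`.

The moment hypothesis bounds `v_k` only at the nodes, whereas derivatives are needed. Because all
cells share one projection, `v_k` is, up to `O(h ^ (2p+3))`, a combination of a fixed finite set of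
derivatives of the initial data, and finite dimension yields the derivative bounds
(`exists_derivComb_bound`). -/

/-! ### Integrals of polynomials over the canonical element -/

/-- The integral of a polynomial over `[-1, 1]`. -/
def integralPoly : ℝ[X] →ₗ[ℝ] ℝ where
  toFun f := ∫ x in (-1 : ℝ)..1, f.eval x
  map_add' f g := by
    simp only [eval_add]
    exact intervalIntegral.integral_add (f.continuous.intervalIntegrable _ _)
      (g.continuous.intervalIntegrable _ _)
  map_smul' r f := by simp

theorem integralPoly_apply (f : ℝ[X]) : integralPoly f = ∫ x in (-1 : ℝ)..1, f.eval x := rfl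

theorem integral_derivative_eval (f : ℝ[X]) (a b : ℝ) :
    ∫ x in a..b, (derivative f).eval x = f.eval b - f.eval a :=
  intervalIntegral.integral_eq_sub_of_hasDerivAt (fun x _ => f.hasDerivAt x)
    ((derivative f).continuous.intervalIntegrable _ _)

theorem integralPoly_derivative (f : ℝ[X]) :
    integralPoly (derivative f) = f.eval 1 - f.eval (-1) :=
  integral_derivative_eval f _ _

theorem integralPoly_derivative_mul (f g : ℝ[X]) :
    integralPoly (derivative f * g) =
      f.eval 1 * g.eval 1 - f.eval (-1) * g.eval (-1) - integralPoly (f * derivative g) := by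
  have h := integralPoly_derivative (f * g)
  rw [derivative_mul, map_add] at h
  simp only [eval_mul] at h
  linarith

theorem integralPoly_C_mul (r : ℝ) (f : ℝ[X]) : integralPoly (C r * f) = r * integralPoly f := by
  rw [← smul_eq_C_mul, map_smul, smul_eq_mul]

theorem integralPoly_C (r : ℝ) : integralPoly (C r) = 2 * r := by
  simp [integralPoly_apply]; norm_num

theorem abs_integralPoly_le {f : ℝ[X]} {M : ℝ}
    (hf : ∀ x ∈ Set.Icc (-1 : ℝ) 1, |f.eval x| ≤ M) : |integralPoly f| ≤ 2 * M := by
  have := intervalIntegral.norm_integral_le_of_norm_le_const (a := -1) (b := 1)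
    (f := fun x => f.eval x) (C := M) (fun x hx => hf x ?_)
  · rw [integralPoly_apply, ← Real.norm_eq_abs]
    refine this.trans (le_of_eq ?_)
    norm_num; ring
  · rw [Set.uIoc_of_le (by norm_num)] at hx
    exact ⟨hx.1.le, hx.2⟩

theorem exists_abs_eval_le (f : ℝ[X]) :
    ∃ M : ℝ, 0 ≤ M ∧ ∀ x ∈ Set.Icc (-1 : ℝ) 1, |f.eval x| ≤ M := by
  obtain ⟨M, hM⟩ := isCompact_Icc.exists_bound_of_continuousOn
    (f := fun x => f.eval x) (s := Set.Icc (-1 : ℝ) 1) f.continuous.continuousOn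
  exact ⟨M, (norm_nonneg _).trans (hM 0 (by norm_num)), hM⟩

/-! ### Legendre polynomials -/

theorem X_sq_sub_one_pow (n : ℕ) :
    ((X : ℝ[X]) ^ 2 - 1) ^ n = (X - C 1) ^ n * (X + C 1) ^ n := by
  rw [← mul_pow]; congr 1; simp only [map_one]; ring

/-- A factor `(X² - 1) ^ (n - m)` survives `m` differentiations. This removes the boundary terms in
the repeated integration by parts. -/
theorem eval_iterate_derivative_rodrigues_eq_zero {n m : ℕ} (hm : m < n) {x : ℝ}
    (hx : x ^ 2 = 1) : (derivative^[m] (((X : ℝ[X]) ^ 2 - 1) ^ n)).eval x = 0 := by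
  have h := pow_sub_dvd_iterate_derivative_pow ((X : ℝ[X]) ^ 2 - 1) n m
  obtain ⟨q, hq⟩ := h
  rw [hq, eval_mul, eval_pow]
  simp [hx, Nat.sub_ne_zero_of_lt hm]

theorem integralPoly_iterate_derivative_rodrigues_mul (n : ℕ) (q : ℝ[X]) (m : ℕ) (hm : m ≤ n) :
    integralPoly (derivative^[n] (((X : ℝ[X]) ^ 2 - 1) ^ n) * q) =
      (-1) ^ m * integralPoly (derivative^[n - m] (((X : ℝ[X]) ^ 2 - 1) ^ n) *
        derivative^[m] q) := by
  induction m with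
  | zero => simp
  | succ m ih =>
    rw [ih (by omega)]
    have h : n - m = (n - (m + 1)) + 1 := by omega
    rw [h, Function.iterate_succ_apply', integralPoly_derivative_mul,
      eval_iterate_derivative_rodrigues_eq_zero (by omega) (by norm_num),
      eval_iterate_derivative_rodrigues_eq_zero (by omega) (by norm_num),
      ← Function.iterate_succ_apply' derivative m q]
    ring

theorem integralPoly_legendre_mul_eq_zero {n : ℕ} {q : ℝ[X]} (hq : q.degree < n) :
    integralPoly (legendre n * q) = 0 := by
  rw [legendre, mul_assoc, integralPoly_C_mul,
    integralPoly_iterate_derivative_rodrigues_mul n q n le_rfl,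
    iterate_derivative_eq_zero_of_degree_lt hq]
  simp

/-- Only the `n`-fold root at `1` matters: the `n`-th derivative of `(X - 1) ^ n q` there is `n!
q(1)`. -/
theorem eval_one_legendre (n : ℕ) : (legendre n).eval 1 = 1 := by
  have h := aeval_iterate_derivative_self (A := ℝ) (((X : ℝ[X]) ^ 2 - 1) ^ n) n 1
    (p' := (X + C 1) ^ n) (by rw [Algebra.algebraMap_self, map_id, X_sq_sub_one_pow])
  rw [coe_aeval_eq_eval] at h
  rw [legendre, eval_mul, h]
  simp only [eval_C, eval_pow, eval_add, eval_X, nsmul_eq_mul]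
  have := n.factorial_ne_zero
  norm_num
  field_simp

theorem eval_neg_one_legendre (n : ℕ) : (legendre n).eval (-1) = (-1) ^ n := by
  have h := aeval_iterate_derivative_self (A := ℝ) (((X : ℝ[X]) ^ 2 - 1) ^ n) n (-1)
    (p' := (X - C 1) ^ n) (by
      rw [Algebra.algebraMap_self, map_id, X_sq_sub_one_pow, mul_comm]; simp)
  rw [coe_aeval_eq_eval] at h
  rw [legendre, eval_mul, h]
  simp only [eval_C, eval_pow, eval_sub, eval_X, nsmul_eq_mul]
  have := n.factorial_ne_zero
  rw [show (-1 - 1 : ℝ) = -1 * 2 by norm_num, mul_pow]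
  field_simp

theorem natDegree_rodrigues (n : ℕ) : (((X : ℝ[X]) ^ 2 - 1) ^ n).natDegree = 2 * n := by
  have h : ((X : ℝ[X]) ^ 2 - 1).natDegree = 2 := by
    rw [← C_1, natDegree_X_pow_sub_C]
  rw [natDegree_pow, h, mul_comm]

theorem natDegree_legendre_le (n : ℕ) : (legendre n).natDegree ≤ n := by
  refine (natDegree_C_mul_le _ _).trans ((natDegree_iterate_derivative _ _).trans ?_)
  rw [natDegree_rodrigues]; omega

theorem coeff_legendre_ne_zero (n : ℕ) : (legendre n).coeff n ≠ 0 := by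
  have hm : (((X : ℝ[X]) ^ 2 - 1) ^ n).Monic := by
    rw [← C_1]; exact (monic_X_pow_sub_C 1 two_ne_zero).pow n
  have hc : (((X : ℝ[X]) ^ 2 - 1) ^ n).coeff (n + n) = 1 := by
    rw [← two_mul, ← natDegree_rodrigues n]; exact hm.coeff_natDegree
  rw [legendre, coeff_C_mul, coeff_iterate_derivative, hc]
  have h1 : ((n + n).descFactorial n) ≠ 0 := by
    rw [Ne, Nat.descFactorial_eq_zero_iff_lt]; omega
  have h2 := n.factorial_ne_zero
  simp [h1, h2]

theorem degree_legendre_lt {k n : ℕ} (h : k < n) : (legendre k).degree < n :=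
  degree_le_natDegree.trans_lt (by exact_mod_cast (natDegree_legendre_le k).trans_lt h)

theorem integralPoly_legendre_mul_legendre_of_ne {k n : ℕ} (h : k ≠ n) :
    integralPoly (legendre n * legendre k) = 0 := by
  rcases lt_or_gt_of_ne h with h | h
  · exact integralPoly_legendre_mul_eq_zero (degree_legendre_lt h)
  · rw [mul_comm]; exact integralPoly_legendre_mul_eq_zero (degree_legendre_lt h)

/-- The operator `X d/dX - n` kills the leading term of `P_n`, so `∫ P_n X P_n' = n ∫ P_n²`;
integrating `X (P_n²)'` by parts then determines the norm. -/
theorem integralPoly_legendre_mul_self (n : ℕ) :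
    integralPoly (legendre n * legendre n) = 2 / (2 * n + 1) := by
  have hdeg : (X * derivative (legendre n) - C (n : ℝ) * legendre n).degree < (n : WithBot ℕ) := by
    rw [degree_lt_iff_coeff_zero]
    intro m hm
    rw [coeff_sub, coeff_C_mul]
    have h1 : (X * derivative (legendre n)).coeff m = m * (legendre n).coeff m := by
      cases m with
      | zero => simp
      | succ m => rw [coeff_X_mul, coeff_derivative]; push_cast; ring
    rw [h1]
    rcases eq_or_lt_of_le hm with rfl | hm
    · ring
    · rw [coeff_eq_zero_of_natDegree_lt ((natDegree_legendre_le n).trans_lt hm)]; ring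
  have h0 := integralPoly_legendre_mul_eq_zero hdeg
  have h1 := integralPoly_derivative_mul X (legendre n * legendre n)
  have h2 : legendre n * (X * derivative (legendre n) - C (n : ℝ) * legendre n) =
      legendre n * X * derivative (legendre n) - C (n : ℝ) * (legendre n * legendre n) := by ring
  have h3 : X * derivative (legendre n * legendre n) =
      C 2 * (legendre n * X * derivative (legendre n)) := by
    rw [derivative_mul, show (C 2 : ℝ[X]) = 2 from rfl]; ring
  rw [h2, map_sub, integralPoly_C_mul] at h0
  rw [h3, integralPoly_C_mul, derivative_X, one_mul] at h1
  simp only [eval_X, eval_mul, eval_one_legendre, eval_neg_one_legendre, ← pow_add] at h1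
  rw [← two_mul, pow_mul] at h1
  norm_num at h1
  have : (2 * (n : ℝ) + 1) ≠ 0 := by positivity
  rw [eq_div_iff this]
  linarith

theorem legendre_zero : legendre 0 = 1 := by simp [legendre]

/-! ### Legendre coefficients -/

/-- The polynomial with given Legendre coefficients. -/
def toPoly (p : ℕ) : (Fin (p + 1) → ℝ) →ₗ[ℝ] ℝ[X] where
  toFun v := ∑ k, v k • legendre k
  map_add' v w := by simp [add_smul, Finset.sum_add_distrib]
  map_smul' r v := by simp [Finset.smul_sum, smul_smul]

/-- The Legendre coefficients of the `L²` projection of a polynomial. -/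
def coefL (p : ℕ) : ℝ[X] →ₗ[ℝ] (Fin (p + 1) → ℝ) where
  toFun f k := (2 * (k : ℕ) + 1) / 2 * integralPoly (f * legendre k)
  map_add' f g := by ext k; simp [add_mul, mul_add]
  map_smul' r f := by ext k; simp; ring

theorem toPoly_apply (p : ℕ) (v : Fin (p + 1) → ℝ) : toPoly p v = ∑ k, v k • legendre k := rfl

theorem coefL_apply (p : ℕ) (f : ℝ[X]) (k : Fin (p + 1)) :
    coefL p f k = (2 * (k : ℕ) + 1) / 2 * integralPoly (f * legendre k) := rfl

theorem cellPoly_eq_toPoly (p : ℕ) (c : ℕ → ℝ) :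
    cellPoly p c = toPoly p (fun k => c k) := by
  rw [cellPoly, toPoly_apply, Finset.sum_range]
  simp [smul_eq_C_mul]

theorem natDegree_toPoly_le (p : ℕ) (v : Fin (p + 1) → ℝ) : (toPoly p v).natDegree ≤ p := by
  rw [toPoly_apply]
  refine natDegree_sum_le_of_forall_le _ _ fun k _ =>
    (natDegree_smul_le (v k) (legendre k)).trans ?_
  exact (natDegree_legendre_le k).trans (Nat.lt_succ_iff.mp k.2)

theorem coefL_toPoly (p : ℕ) (v : Fin (p + 1) → ℝ) : coefL p (toPoly p v) = v := by
  ext k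
  rw [coefL_apply, toPoly_apply, Finset.sum_mul, map_sum, Finset.sum_eq_single k]
  · rw [smul_mul_assoc, map_smul, integralPoly_legendre_mul_self, smul_eq_mul]
    have : (2 * ((k : ℕ) : ℝ) + 1) ≠ 0 := by positivity
    field_simp
  · intro i _ hi
    rw [smul_mul_assoc, map_smul, integralPoly_legendre_mul_legendre_of_ne, smul_zero]
    exact fun h => hi (Fin.ext h.symm)
  · simp

theorem exists_toPoly_eq (p : ℕ) (f : ℝ[X]) (hf : f.natDegree ≤ p) : ∃ v, toPoly p v = f := by
  have key : ∀ n ≤ p + 1, ∀ f : ℝ[X], f.degree < n → ∃ v, toPoly p v = f := by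
    intro n
    induction n with
    | zero =>
      intro _ f hf
      exact ⟨0, by rw [map_zero, eq_comm, ← degree_eq_bot]; exact Nat.WithBot.lt_zero_iff.mp hf⟩
    | succ n ih =>
      intro hn f hf
      obtain ⟨w, hw⟩ := ih (by omega)
        (f - (f.coeff n / (legendre n).coeff n) • legendre n) (by
          rw [degree_lt_iff_coeff_zero]
          intro m hm
          rw [coeff_sub, coeff_smul, smul_eq_mul]
          rcases eq_or_lt_of_le hm with rfl | hm
          · rw [div_mul_cancel₀ _ (coeff_legendre_ne_zero n), sub_self]
          · rw [coeff_eq_zero_of_natDegree_lt ((natDegree_legendre_le n).trans_lt hm),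
              coeff_eq_zero_of_degree_lt (hf.trans_le (by exact_mod_cast hm))]
            ring)
      refine ⟨w + Pi.single ⟨n, by omega⟩ (f.coeff n / (legendre n).coeff n), ?_⟩
      rw [map_add, hw, toPoly_apply, Finset.sum_eq_single ⟨n, by omega⟩]
      · simp
      · intro b _ hb
        rw [Pi.single_eq_of_ne hb, zero_smul]
      · simp
  refine key (p + 1) le_rfl f (degree_le_natDegree.trans_lt ?_)
  exact_mod_cast Nat.lt_succ_of_le hf

theorem toPoly_coefL (p : ℕ) {f : ℝ[X]} (hf : f.natDegree ≤ p) : toPoly p (coefL p f) = f := by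
  obtain ⟨v, rfl⟩ := exists_toPoly_eq p f hf
  rw [coefL_toPoly]

theorem toPoly_injective (p : ℕ) : Function.Injective (toPoly p) := fun v w h => by
  rw [← coefL_toPoly p v, h, coefL_toPoly]

theorem exists_abs_eval_toPoly_le (p : ℕ) :
    ∃ M : ℝ, 0 ≤ M ∧ ∀ v : Fin (p + 1) → ℝ, ∀ x ∈ Set.Icc (-1 : ℝ) 1,
      |(toPoly p v).eval x| ≤ M * ‖v‖ := by
  choose M hM0 hM using fun k : Fin (p + 1) => exists_abs_eval_le (legendre k)
  refine ⟨∑ k, M k, Finset.sum_nonneg fun k _ => hM0 k, fun v x hx => ?_⟩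
  rw [toPoly_apply, eval_finsetSum, Finset.sum_mul]
  refine (Finset.abs_sum_le_sum_abs _ _).trans (Finset.sum_le_sum fun k _ => ?_)
  rw [eval_smul, smul_eq_mul, abs_mul, mul_comm]
  exact mul_le_mul (hM k x hx) (norm_le_pi_norm v k) (abs_nonneg _) (hM0 k)

theorem exists_norm_coefL_le (p : ℕ) :
    ∃ B : ℝ, 0 ≤ B ∧ ∀ (f : ℝ[X]) (M : ℝ), (∀ x ∈ Set.Icc (-1 : ℝ) 1, |f.eval x| ≤ M) →
      ‖coefL p f‖ ≤ B * M := by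
  choose B hB0 hB using fun k : Fin (p + 1) => exists_abs_eval_le (legendre k)
  refine ⟨∑ k : Fin (p + 1), (2 * (k : ℕ) + 1) * B k,
    Finset.sum_nonneg fun k _ => mul_nonneg (by positivity) (hB0 k), fun f M hf => ?_⟩
  have hM : 0 ≤ M := (abs_nonneg _).trans (hf 0 (by norm_num))
  rw [pi_norm_le_iff_of_nonneg (mul_nonneg
    (Finset.sum_nonneg fun k _ => mul_nonneg (by positivity) (hB0 k)) hM)]
  intro k
  have h1 : |integralPoly (f * legendre k)| ≤ 2 * (M * B k) := abs_integralPoly_le fun x hx => by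
    rw [eval_mul, abs_mul]
    exact mul_le_mul (hf x hx) (hB k x hx) (abs_nonneg _) hM
  have h2 : (2 * ((k : ℕ) : ℝ) + 1) * B k ≤ ∑ k : Fin (p + 1), (2 * ((k : ℕ) : ℝ) + 1) * B k :=
    Finset.single_le_sum (f := fun k : Fin (p + 1) => (2 * ((k : ℕ) : ℝ) + 1) * B k)
      (fun k _ => mul_nonneg (by positivity) (hB0 k)) (Finset.mem_univ k)
  rw [coefL_apply, Real.norm_eq_abs, abs_mul, abs_of_nonneg (by positivity)]
  calc (2 * ((k : ℕ) : ℝ) + 1) / 2 * |integralPoly (f * legendre k)|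
      ≤ (2 * ((k : ℕ) : ℝ) + 1) / 2 * (2 * (M * B k)) := by gcongr
    _ = (2 * ((k : ℕ) : ℝ) + 1) * B k * M := by ring
    _ ≤ _ := mul_le_mul_of_nonneg_right h2 hM

/-! ### The upwind operator on one cell -/

/-- The value of a cell polynomial at a point, as a function of the Legendre coefficients. -/
def evalAt (p : ℕ) (x : ℝ) : (Fin (p + 1) → ℝ) →ₗ[ℝ] ℝ := (leval x).comp (toPoly p)

theorem evalAt_apply (p : ℕ) (x : ℝ) (v : Fin (p + 1) → ℝ) :
    evalAt p x v = (toPoly p v).eval x := rfl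

/-- The coefficients of the lifting of the inflow value. -/
def inflow (p : ℕ) : Fin (p + 1) → ℝ := fun k => (2 * (k : ℕ) + 1) * (-1) ^ (k : ℕ)

/-- The upwind operator on a cell with zero inflow, scaled by `h / a`. -/
def upwind (p : ℕ) : (Fin (p + 1) → ℝ) →ₗ[ℝ] (Fin (p + 1) → ℝ) :=
  (-2 : ℝ) • (coefL p ∘ₗ derivative ∘ₗ toPoly p) - (evalAt p (-1)).smulRight (inflow p)

theorem upwind_apply (p : ℕ) (v : Fin (p + 1) → ℝ) :
    upwind p v = (-2 : ℝ) • coefL p (derivative (toPoly p v)) - evalAt p (-1) v • inflow p := rfl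

theorem natDegree_derivative_toPoly_le (p : ℕ) (v : Fin (p + 1) → ℝ) :
    (derivative (toPoly p v)).natDegree ≤ p :=
  (natDegree_derivative_le _).trans (by have := natDegree_toPoly_le p v; omega)

theorem toPoly_upwind (p : ℕ) (v : Fin (p + 1) → ℝ) :
    toPoly p (upwind p v) =
      (-2 : ℝ) • derivative (toPoly p v) - (toPoly p v).eval (-1) • toPoly p (inflow p) := by
  rw [upwind_apply, map_sub, map_smul, map_smul,
    toPoly_coefL p (natDegree_derivative_toPoly_le p v), evalAt_apply]

theorem natDegree_radau_le (p : ℕ) : (radau p).natDegree ≤ p + 1 :=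
  (natDegree_sub_le _ _).trans
    (max_le (natDegree_legendre_le _) ((natDegree_legendre_le p).trans p.le_succ))

theorem eval_one_radau (p : ℕ) : (radau p).eval 1 = 0 := by
  simp [radau, eval_one_legendre]

theorem eval_neg_one_radau (p : ℕ) : (radau p).eval (-1) = 2 * (-1) ^ (p + 1) := by
  simp [radau, eval_neg_one_legendre, pow_succ]; ring

theorem integralPoly_radau_mul {p : ℕ} {q : ℝ[X]} (hq : q.degree < p) :
    integralPoly (radau p * q) = 0 := by
  rw [radau, sub_mul, map_sub, integralPoly_legendre_mul_eq_zero hq,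
    integralPoly_legendre_mul_eq_zero (hq.trans (by exact_mod_cast p.lt_succ_self)), sub_zero]

/-- Both sides act on degree at most `p` as twice the evaluation at `-1`: integrating by parts,
`R(1) = 0` and the orthogonality of `R` to lower degrees leave only the boundary value at `-1`. This
puts the Radau polynomial into the strong form of the scheme. -/
theorem toPoly_inflow (p : ℕ) : toPoly p (inflow p) = (-1 : ℝ) ^ p • derivative (radau p) := by
  have h : coefL p ((-1 : ℝ) ^ p • derivative (radau p)) = inflow p := by
    ext k
    have hk : (k : ℕ) ≤ p := Nat.lt_succ_iff.mp k.2
    have h0 : integralPoly (radau p * derivative (legendre k)) = 0 := by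
      by_cases hk0 : (k : ℕ) = 0
      · rw [hk0, legendre_zero]; simp
      · refine integralPoly_radau_mul ?_
        refine (degree_derivative_lt fun h => ?_).trans_le
          (degree_le_natDegree.trans (by exact_mod_cast (natDegree_legendre_le k).trans hk))
        exact coeff_legendre_ne_zero k (by simp [h])
    rw [coefL_apply, smul_mul_assoc, map_smul, integralPoly_derivative_mul, h0, eval_one_radau,
      eval_neg_one_radau, eval_neg_one_legendre, inflow, smul_eq_mul]
    have : ((-1 : ℝ) ^ p) * (-1) ^ p = 1 := by rw [← mul_pow]; simp
    rw [pow_succ]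
    linear_combination (2 * ((k : ℕ) : ℝ) + 1) * (-1) ^ (k : ℕ) * this
  rw [← h, toPoly_coefL]
  refine (natDegree_smul_le _ _).trans ((natDegree_derivative_le _).trans ?_)
  have := natDegree_radau_le p
  omega

theorem integralPoly_toPoly_inflow_mul (p : ℕ) {q : ℝ[X]} (hq : q.natDegree ≤ p) :
    integralPoly (toPoly p (inflow p) * q) = 2 * q.eval (-1) := by
  obtain ⟨v, rfl⟩ := exists_toPoly_eq p q hq
  rw [toPoly_apply p v, Finset.mul_sum, map_sum, eval_finsetSum, Finset.mul_sum]
  refine Finset.sum_congr rfl fun k _ => ?_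
  have h := congrFun (coefL_toPoly p (inflow p)) k
  rw [coefL_apply] at h
  rw [mul_smul_comm, map_smul, eval_smul, eval_neg_one_legendre, smul_eq_mul, smul_eq_mul]
  have h2 : ((2 * ((k : ℕ) : ℝ) + 1) / 2) ≠ 0 := by positivity
  have h3 : integralPoly (toPoly p (inflow p) * legendre k) = 2 * (-1) ^ (k : ℕ) := by
    apply mul_left_cancel₀ h2
    rw [h, inflow]; ring
  rw [h3]; ring

/-- The boundary term at `-1` from the integration by parts cancels against the lifting, so only the
outflow trace remains. -/
theorem integralPoly_toPoly_upwind_mul (p : ℕ) (v : Fin (p + 1) → ℝ) {q : ℝ[X]}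
    (hq : q.natDegree ≤ p) :
    integralPoly (toPoly p (upwind p v) * q) =
      2 * integralPoly (toPoly p v * derivative q) - 2 * ((toPoly p v).eval 1 * q.eval 1) := by
  rw [toPoly_upwind, sub_mul, map_sub, smul_mul_assoc, smul_mul_assoc, map_smul, map_smul,
    integralPoly_toPoly_inflow_mul p hq, integralPoly_derivative_mul, smul_eq_mul, smul_eq_mul]
  ring

/-! ### Primitives of polynomials and the repeated integrals of the Radau polynomial -/

/-- A primitive of a polynomial. -/
def antiderivative (f : ℝ[X]) : ℝ[X] :=
  ∑ n ∈ Finset.range (f.natDegree + 1), C (f.coeff n / (n + 1)) * X ^ (n + 1)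

/-- The primitive of a polynomial that vanishes at `-1`. -/
def primitive (f : ℝ[X]) : ℝ[X] := antiderivative f - C ((antiderivative f).eval (-1))

theorem derivative_primitive (f : ℝ[X]) : derivative (primitive f) = f := by
  rw [primitive, derivative_sub, derivative_C, sub_zero, antiderivative, derivative_sum]
  conv_rhs => rw [f.as_sum_range_C_mul_X_pow]
  refine Finset.sum_congr rfl fun n _ => ?_
  have : (n : ℝ) + 1 ≠ 0 := by positivity
  rw [derivative_C_mul_X_pow]
  push_cast
  rw [div_mul_cancel₀ _ this]

theorem eval_neg_one_primitive (f : ℝ[X]) : (primitive f).eval (-1) = 0 := by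
  simp [primitive]

theorem eval_primitive (f : ℝ[X]) (x : ℝ) :
    (primitive f).eval x = ∫ s in (-1 : ℝ)..x, f.eval s := by
  have h := integral_derivative_eval (primitive f) (-1) x
  rw [derivative_primitive, eval_neg_one_primitive, sub_zero] at h
  exact h.symm

theorem eval_one_primitive (f : ℝ[X]) : (primitive f).eval 1 = integralPoly f :=
  eval_primitive f 1

theorem natDegree_primitive_le (f : ℝ[X]) : (primitive f).natDegree ≤ f.natDegree + 1 := by
  refine (natDegree_sub_le _ _).trans (max_le ?_ (by simp))
  rw [antiderivative]
  refine natDegree_sum_le_of_forall_le _ _ fun n hn => (natDegree_C_mul_X_pow_le _ _).trans ?_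
  rw [Finset.mem_range] at hn
  omega

theorem eq_primitive {f F : ℝ[X]} (h : derivative F = f) (h1 : F.eval (-1) = 0) :
    F = primitive f := by
  refine Polynomial.funext fun x => ?_
  rw [eval_primitive, ← h, integral_derivative_eval, h1, sub_zero]

/-- The repeated integrals of the Radau polynomial, as polynomials. -/
def radauPoly (p : ℕ) : ℕ → ℝ[X]
  | 0 => radau p
  | k + 1 => primitive (radauPoly p k)

theorem radauInt_eq_eval (p k : ℕ) (x : ℝ) : radauInt p k x = (radauPoly p k).eval x := by
  induction k generalizing x with
  | zero => rfl
  | succ k ih =>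
    rw [radauInt, radauPoly, eval_primitive]
    exact intervalIntegral.integral_congr fun s _ => ih s

theorem eval_neg_one_radauPoly_succ (p k : ℕ) : (radauPoly p (k + 1)).eval (-1) = 0 :=
  eval_neg_one_primitive _

/-- Each integration costs one degree of orthogonality: integration by parts moves it onto `q`. The
primitive of `q` is chosen to vanish at `1`, the integrated Radau polynomial vanishes at `-1`, and
no boundary term is left. -/
theorem integralPoly_radauPoly_mul {p l : ℕ} {q : ℝ[X]} (h : l + q.natDegree < p) :
    integralPoly (radauPoly p l * q) = 0 := by
  induction l generalizing q with
  | zero =>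
    exact integralPoly_radau_mul (degree_le_natDegree.trans_lt (by exact_mod_cast (by omega)))
  | succ l ih =>
    have hQ := natDegree_primitive_le q
    set Q := primitive q - C ((primitive q).eval 1) with hQdef
    have hdQ : derivative Q = q := by
      rw [hQdef, derivative_sub, derivative_C, sub_zero, derivative_primitive]
    have hQ1 : Q.eval 1 = 0 := by simp [hQdef]
    have hQd : Q.natDegree ≤ q.natDegree + 1 :=
      (natDegree_sub_le _ _).trans (max_le hQ (by simp))
    have h1 := integralPoly_derivative_mul (radauPoly p (l + 1)) Q
    rw [hQ1, eval_neg_one_radauPoly_succ, hdQ, radauPoly, derivative_primitive,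
      ih (by omega)] at h1
    rw [radauPoly]
    linarith

/-- The value at `1` of one integral is the mean of the preceding one, which is zero by
orthogonality to constants. -/
theorem eval_one_radauPoly {p l : ℕ} (h : l ≤ p) : (radauPoly p l).eval 1 = 0 := by
  cases l with
  | zero => exact eval_one_radau p
  | succ l =>
    have h1 := integralPoly_radauPoly_mul (p := p) (l := l) (q := 1) (by simp; omega)
    rw [mul_one] at h1
    rw [radauPoly, eval_one_primitive, h1]

theorem coeff_radau_ne_zero (p : ℕ) : (radau p).coeff (p + 1) ≠ 0 := by
  rw [radau, coeff_sub,
    coeff_eq_zero_of_natDegree_lt ((natDegree_legendre_le p).trans_lt p.lt_succ_self), sub_zero]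
  exact coeff_legendre_ne_zero (p + 1)

/-! ### The expansion of the discrete profile of a smooth solution -/

/-- The multiple of the Radau polynomial that reduces half a primitive to degree `p`. -/
def radauWeight (p : ℕ) (f : ℝ[X]) : ℝ :=
  -((C (1 / 2) * primitive f).coeff (p + 1) / (radau p).coeff (p + 1))

/-- The coefficients, in powers of `h ∂ₓ`, of the profile in a cell of the discrete solution that
belongs to a smooth exact solution. -/
def profile (p : ℕ) : ℕ → ℝ[X]
  | 0 => 1
  | m + 1 => C (1 / 2) * primitive (profile p m) + C (radauWeight p (profile p m)) * radau p

/-- The multiple of the Radau polynomial in `profile p m`. -/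
def profileWeight (p : ℕ) : ℕ → ℝ
  | 0 => 0
  | m + 1 => radauWeight p (profile p m)

/-- The Taylor coefficients of the exact solution in a cell. -/
def taylorMonomial (m : ℕ) : ℝ[X] := C (1 / (2 ^ m * (m.factorial : ℝ))) * (X + 1) ^ m

theorem natDegree_taylorMonomial_le (m : ℕ) : (taylorMonomial m).natDegree ≤ m := by
  refine (natDegree_C_mul_le _ _).trans (natDegree_pow_le.trans ?_)
  rw [← C_1, natDegree_X_add_C, mul_one]

theorem eval_taylorMonomial (m : ℕ) (x : ℝ) :
    (taylorMonomial m).eval x = ((x + 1) / 2) ^ m / m.factorial := by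
  simp only [taylorMonomial, eval_mul, eval_C, eval_pow, eval_add, eval_X, eval_one, div_pow]
  field_simp

theorem taylorMonomial_succ (m : ℕ) :
    taylorMonomial (m + 1) = C (1 / 2) * primitive (taylorMonomial m) := by
  have h : C 2 * taylorMonomial (m + 1) = primitive (taylorMonomial m) := by
    apply eq_primitive
    · rw [derivative_C_mul, taylorMonomial, taylorMonomial, derivative_C_mul, derivative_pow]
      simp only [derivative_add, derivative_X, derivative_one, add_zero, mul_one,
        Nat.add_sub_cancel]
      rw [← mul_assoc, ← mul_assoc, ← C_mul, ← C_mul, Nat.factorial_succ]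
      congr 2
      push_cast
      have : (m.factorial : ℝ) ≠ 0 := by exact_mod_cast m.factorial_ne_zero
      field_simp
      ring
    · rw [eval_mul, eval_taylorMonomial]; simp
  rw [← h, ← mul_assoc, ← C_mul]; simp

theorem natDegree_profile_le (p m : ℕ) : (profile p m).natDegree ≤ p := by
  induction m with
  | zero => simp [profile]
  | succ m ih =>
    rw [natDegree_le_iff_coeff_eq_zero]
    intro N hN
    rw [profile, coeff_add]
    rcases eq_or_lt_of_le (Nat.succ_le_of_lt hN) with rfl | hN
    · rw [coeff_C_mul (p := radau p), radauWeight, Nat.succ_eq_add_one, neg_mul,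
        div_mul_cancel₀ _ (coeff_radau_ne_zero p), add_neg_cancel]
    · have h1 := natDegree_primitive_le (profile p m)
      have h2 := natDegree_radau_le p
      rw [coeff_C_mul, coeff_C_mul, coeff_eq_zero_of_natDegree_lt (by omega),
        coeff_eq_zero_of_natDegree_lt (by omega)]
      ring

theorem primitive_add (f g : ℝ[X]) : primitive (f + g) = primitive f + primitive g :=
  (eq_primitive (by simp [derivative_primitive]) (by simp [eval_neg_one_primitive])).symm

theorem primitive_C_mul (r : ℝ) (f : ℝ[X]) : primitive (C r * f) = C r * primitive f :=
  (eq_primitive (by simp [derivative_primitive]) (by simp [eval_neg_one_primitive])).symm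

theorem primitive_sum {ι : Type*} (s : Finset ι) (f : ι → ℝ[X]) :
    primitive (∑ i ∈ s, f i) = ∑ i ∈ s, primitive (f i) :=
  (eq_primitive (by simp [derivative_primitive])
    (by simp [eval_neg_one_primitive, eval_finsetSum])).symm

theorem profile_succ (p m : ℕ) : profile p (m + 1) =
    C (1 / 2) * primitive (profile p m) + C (profileWeight p (m + 1)) * radau p := rfl

/-- Unrolling the recursion: a Radau multiple inserted at order `m - l` is afterwards integrated and
halved `l` times. -/
theorem profile_eq (p m : ℕ) :
    profile p m = taylorMonomial m +
      ∑ l ∈ Finset.range m, C (profileWeight p (m - l) / 2 ^ l) * radauPoly p l := by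
  induction m with
  | zero => simp [profile, taylorMonomial]
  | succ m ih =>
    have h : C (1 / 2) * primitive
        (∑ l ∈ Finset.range m, C (profileWeight p (m - l) / 2 ^ l) * radauPoly p l) =
        ∑ l ∈ Finset.range m,
          C (profileWeight p (m + 1 - (l + 1)) / 2 ^ (l + 1)) * radauPoly p (l + 1) := by
      rw [primitive_sum, Finset.mul_sum]
      refine Finset.sum_congr rfl fun l _ => ?_
      rw [primitive_C_mul, ← mul_assoc, ← C_mul, radauPoly, Nat.add_sub_add_right,
        show 1 / 2 * (profileWeight p (m - l) / 2 ^ l) =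
          profileWeight p (m - l) / 2 ^ (l + 1) by rw [pow_succ]; field_simp]
    have h0 : C (profileWeight p (m + 1 - 0) / 2 ^ 0) * radauPoly p 0 =
        C (profileWeight p (m + 1)) * radau p := by
      rw [pow_zero, div_one, Nat.sub_zero, radauPoly]
    rw [profile_succ, ih, primitive_add, mul_add, ← taylorMonomial_succ, h,
      Finset.sum_range_succ', h0, add_assoc]

/-- Up to order `p` the Taylor monomials have degree at most `p` and need no correction; the
discretization is visible only from order `p + 1` on. -/
theorem profileWeight_eq_zero {p m : ℕ} (h : m ≤ p) : profileWeight p m = 0 := by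
  induction m using Nat.strong_induction_on with
  | _ m ih =>
    cases m with
    | zero => rfl
    | succ m =>
      have h1 : profile p m = taylorMonomial m := by
        rw [profile_eq, Finset.sum_eq_zero, add_zero]
        intro l _
        rw [ih (m - l) (by omega) (by omega)]; simp
      have h2 := natDegree_primitive_le (taylorMonomial m)
      have h3 := natDegree_taylorMonomial_le m
      rw [profileWeight, radauWeight, h1, coeff_C_mul, coeff_eq_zero_of_natDegree_lt (by omega)]
      simp

/-- A nonzero weight needs `m - l ≥ p + 1`; the bound on `m` then forces `l ≤ p`, the range in which
the integrals vanish at `1`. -/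
theorem profile_sub_taylorMonomial (p m : ℕ) (hm : m ≤ 2 * p + 1) :
    profile p m - taylorMonomial m =
      ∑ l ∈ Finset.range (p + 1), C (profileWeight p (m - l) / 2 ^ l) * radauPoly p l := by
  rw [profile_eq, add_sub_cancel_left]
  rcases le_total m (p + 1) with h | h
  · refine Finset.sum_subset (by simpa using h) fun l _ hl => ?_
    rw [Finset.mem_range] at hl
    rw [profileWeight_eq_zero (by omega)]; simp
  · refine (Finset.sum_subset (by simpa using h) fun l _ hl => ?_).symm
    rw [Finset.mem_range] at hl
    rw [profileWeight_eq_zero (by omega)]; simp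

/-- Source of the order `2p + 1` at the downwind point: no correction is seen there, so the outflow
trace of the slow part is a Taylor polynomial. -/
theorem eval_one_profile {p m : ℕ} (hm : m ≤ 2 * p + 1) :
    (profile p m).eval 1 = 1 / m.factorial := by
  have h := congrArg (eval 1) (profile_sub_taylorMonomial p m hm)
  rw [eval_finsetSum, Finset.sum_eq_zero, eval_sub, eval_taylorMonomial] at h
  · norm_num at h ⊢; linarith
  · intro l hl
    rw [eval_mul, eval_one_radauPoly (by simpa [Nat.lt_succ_iff] using hl), mul_zero]

/-- Nonzero weights have `l ≤ m - p - 1`, hence `l + k < p` and the orthogonality applies. The range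
is exactly the one that matches the hypothesis on the initial moments. -/
theorem integralPoly_profile_sub_mul_legendre {p m k : ℕ} (h : m + k < 2 * p + 1) :
    integralPoly ((profile p m - taylorMonomial m) * legendre k) = 0 := by
  rw [profile_sub_taylorMonomial p m (by omega), Finset.sum_mul, map_sum]
  refine Finset.sum_eq_zero fun l _ => ?_
  rw [mul_assoc, integralPoly_C_mul]
  rcases le_or_gt (m - l) p with hl | hl
  · rw [profileWeight_eq_zero hl]; simp
  · rw [integralPoly_radauPoly_mul, mul_zero]
    have := natDegree_legendre_le k
    omega

theorem upwind_coefL_profile_zero (p : ℕ) : upwind p (coefL p 1) = -inflow p := by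
  apply toPoly_injective
  rw [toPoly_upwind, toPoly_coefL p (by simp), map_neg]
  simp

/-- Differentiation undoes the half primitive, which has zero trace at `-1`. The Radau term
contributes nothing: its derivative cancels the lifting of its value at `-1`. -/
theorem upwind_coefL_profile_succ (p m : ℕ) :
    upwind p (coefL p (profile p (m + 1))) = -coefL p (profile p m) := by
  apply toPoly_injective
  rw [toPoly_upwind, toPoly_coefL p (natDegree_profile_le _ _), map_neg,
    toPoly_coefL p (natDegree_profile_le _ _), toPoly_inflow, profile]
  simp only [derivative_add, derivative_C_mul, derivative_primitive, eval_add, eval_mul, eval_C,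
    eval_neg_one_primitive, eval_neg_one_radau, smul_add, smul_eq_C_mul]
  rw [← mul_assoc, ← mul_assoc, ← C_mul, ← C_mul, add_sub_assoc, ← mul_assoc (C _) (C ((-1) ^ p)),
    ← C_mul, ← sub_mul, ← C_sub]
  have h : (-1 : ℝ) ^ p * (-1) ^ p = 1 := by rw [← mul_pow]; simp
  have h2 : (-2 : ℝ) * radauWeight p (profile p m) - (1 / 2 * 0 +
      radauWeight p (profile p m) * (2 * (-1) ^ (p + 1))) * (-1) ^ p = 0 := by
    rw [pow_succ]; linear_combination (2 * radauWeight p (profile p m)) * h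
  rw [h2]
  norm_num

/-! ### Energy stability of the scheme -/

/-- The `L²` inner product of two cell polynomials in terms of the Legendre coefficients. -/
def ip (p : ℕ) (v w : Fin (p + 1) → ℝ) : ℝ :=
  ∑ k : Fin (p + 1), 2 / (2 * ((k : ℕ) : ℝ) + 1) * (v k * w k)

theorem ip_eq_integralPoly (p : ℕ) (v w : Fin (p + 1) → ℝ) :
    ip p v w = integralPoly (toPoly p v * toPoly p w) := by
  rw [ip, toPoly_apply p w, Finset.mul_sum, map_sum]
  refine Finset.sum_congr rfl fun k _ => ?_
  have h := congrFun (coefL_toPoly p v) k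
  rw [coefL_apply] at h
  rw [mul_smul_comm, map_smul, smul_eq_mul, ← h]
  have : (2 * ((k : ℕ) : ℝ) + 1) ≠ 0 := by positivity
  field_simp

theorem ip_self_nonneg (p : ℕ) (v : Fin (p + 1) → ℝ) : 0 ≤ ip p v v :=
  Finset.sum_nonneg fun k _ => mul_nonneg (by positivity) (mul_self_nonneg _)

theorem ip_self_le (p : ℕ) (v : Fin (p + 1) → ℝ) : ip p v v ≤ 2 * (p + 1) * ‖v‖ ^ 2 := by
  have h : ∀ k ∈ Finset.univ, 2 / (2 * ((k : Fin (p + 1)) : ℕ) + 1 : ℝ) * (v k * v k) ≤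
      2 * ‖v‖ ^ 2 := by
    intro k _
    have h1 : v k * v k ≤ ‖v‖ ^ 2 := by
      rw [← abs_mul_abs_self, ← sq]
      exact pow_le_pow_left₀ (abs_nonneg _) (norm_le_pi_norm v k) 2
    have h2 : 2 / (2 * ((k : ℕ) : ℝ) + 1) ≤ 2 :=
      div_le_self (by norm_num) (by have : (0 : ℝ) ≤ (k : ℕ) := by positivity
                                    linarith)
    exact mul_le_mul h2 h1 (mul_self_nonneg _) (by norm_num)
  refine (Finset.sum_le_sum h).trans (le_of_eq ?_)
  simp; ring

theorem norm_sq_le_ip (p : ℕ) (v : Fin (p + 1) → ℝ) : ‖v‖ ^ 2 ≤ (p + 1) * ip p v v := by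
  have h0 := ip_self_nonneg p v
  have h : ‖v‖ ≤ √((p + 1) * ip p v v) := by
    rw [pi_norm_le_iff_of_nonneg (Real.sqrt_nonneg _)]
    intro k
    apply Real.le_sqrt_of_sq_le
    rw [Real.norm_eq_abs, sq_abs]
    have h1 : 2 / (2 * ((k : ℕ) : ℝ) + 1) * (v k * v k) ≤ ip p v v :=
      Finset.single_le_sum (f := fun k : Fin (p + 1) => 2 / (2 * ((k : ℕ) : ℝ) + 1) * (v k * v k))
        (fun k _ => mul_nonneg (by positivity) (mul_self_nonneg _)) (Finset.mem_univ k)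
    have hk : ((k : ℕ) : ℝ) ≤ p := by exact_mod_cast Nat.lt_succ_iff.mp k.2
    have h2 : 1 ≤ (p + 1 : ℝ) * (2 / (2 * ((k : ℕ) : ℝ) + 1)) := by
      rw [mul_div_assoc', le_div_iff₀ (by positivity)]; linarith
    calc v k ^ 2 ≤ (p + 1 : ℝ) * (2 / (2 * ((k : ℕ) : ℝ) + 1)) * v k ^ 2 :=
          le_mul_of_one_le_left (sq_nonneg _) h2
      _ = (p + 1) * (2 / (2 * ((k : ℕ) : ℝ) + 1) * (v k * v k)) := by ring
      _ ≤ _ := by gcongr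
  calc ‖v‖ ^ 2 ≤ √((p + 1) * ip p v v) ^ 2 := pow_le_pow_left₀ (norm_nonneg _) h 2
    _ = _ := Real.sq_sqrt (by positivity)

/-- Integration by parts leaves boundary values only. Completing the square isolates the upwind
dissipation; the other bracket is a flux difference that telescopes over the cyclic mesh. -/
theorem ip_upwind (p : ℕ) (v : Fin (p + 1) → ℝ) (y : ℝ) :
    ip p v (upwind p v + y • inflow p) =
      -(evalAt p (-1) v - y) ^ 2 + (y ^ 2 - evalAt p 1 v ^ 2) := by
  have hd := natDegree_toPoly_le p v
  have h1 := integralPoly_toPoly_upwind_mul p v hd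
  have h2 := integralPoly_toPoly_inflow_mul p hd
  have h3 := integralPoly_derivative_mul (toPoly p v) (toPoly p v)
  rw [mul_comm (derivative _)] at h3
  rw [ip_eq_integralPoly, mul_comm, map_add, map_smul, add_mul, map_add, smul_mul_assoc, map_smul,
    h1, h2, evalAt_apply, evalAt_apply, smul_eq_mul]
  linear_combination h3

theorem ip_add_right (p : ℕ) (v w z : Fin (p + 1) → ℝ) : ip p v (w + z) = ip p v w + ip p v z := by
  simp only [ip_eq_integralPoly, map_add, mul_add]

theorem ip_smul_right (p : ℕ) (r : ℝ) (v w : Fin (p + 1) → ℝ) :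
    ip p v (r • w) = r * ip p v w := by
  simp only [ip_eq_integralPoly, map_smul, mul_smul_comm, smul_eq_mul]

theorem hasDerivWithinAt_ip_self (p : ℕ) {E : ℝ → Fin (p + 1) → ℝ} {E' : Fin (p + 1) → ℝ}
    {S : Set ℝ} {t : ℝ} (h : HasDerivWithinAt E E' S t) :
    HasDerivWithinAt (fun t => ip p (E t) (E t)) (2 * ip p (E t) E') S t := by
  rw [hasDerivWithinAt_pi] at h
  have := HasDerivWithinAt.fun_sum (u := Finset.univ)
    (A := fun (k : Fin (p + 1)) (t : ℝ) => 2 / (2 * ((k : ℕ) : ℝ) + 1) * (E t k * E t k))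
    (fun k _ => ((h k).mul (h k)).const_mul (2 / (2 * ((k : ℕ) : ℝ) + 1)))
  refine this.congr_deriv ?_
  rw [ip, Finset.mul_sum]
  refine Finset.sum_congr rfl fun k _ => ?_
  ring

theorem sum_ip_le_sqrt_mul_sqrt {p : ℕ} {ι : Type*} [Fintype ι] (E s : ι → Fin (p + 1) → ℝ) :
    ∑ j, ip p (E j) (s j) ≤ √(∑ j, ip p (E j) (E j)) * √(∑ j, ip p (s j) (s j)) := by
  have h := Real.sum_mul_le_sqrt_mul_sqrt (Finset.univ : Finset (ι × Fin (p + 1)))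
    (fun x => √(2 / (2 * ((x.2 : ℕ) : ℝ) + 1)) * E x.1 x.2)
    (fun x => √(2 / (2 * ((x.2 : ℕ) : ℝ) + 1)) * s x.1 x.2)
  have key : ∀ A B : ι → Fin (p + 1) → ℝ,
      ∑ x : ι × Fin (p + 1), (√(2 / (2 * ((x.2 : ℕ) : ℝ) + 1)) * A x.1 x.2) *
        (√(2 / (2 * ((x.2 : ℕ) : ℝ) + 1)) * B x.1 x.2) = ∑ j, ip p (A j) (B j) := by
    intro A B
    rw [Fintype.sum_prod_type]
    refine Finset.sum_congr rfl fun j _ => Finset.sum_congr rfl fun k _ => ?_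
    have h2 : √(2 / (2 * ((k : ℕ) : ℝ) + 1)) * √(2 / (2 * ((k : ℕ) : ℝ) + 1)) =
      2 / (2 * ((k : ℕ) : ℝ) + 1) := Real.mul_self_sqrt (by positivity)
    linear_combination (A j k * B j k) * h2
  simp only [sq] at h
  rwa [key, key, key] at h

/-- The semidiscrete upwind scheme with a source. -/
def HasSchemeDeriv (p : ℕ) (r : ℝ) {N : ℕ} (E s : ZMod N → ℝ → Fin (p + 1) → ℝ) : Prop :=
  ∀ (j : ZMod N) (t : ℝ), 0 ≤ t → HasDerivWithinAt (E j)
    (r • (upwind p (E j t) + evalAt p 1 (E (j - 1) t) • inflow p) + s j t) (Set.Ici 0) t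

theorem sum_ip_scheme_nonpos (p : ℕ) {N : ℕ} [NeZero N] (E : ZMod N → Fin (p + 1) → ℝ) :
    ∑ j, ip p (E j) (upwind p (E j) + evalAt p 1 (E (j - 1)) • inflow p) ≤ 0 := by
  simp only [ip_upwind, Finset.sum_add_distrib, Finset.sum_sub_distrib]
  have h := Equiv.sum_comp (Equiv.subRight (1 : ZMod N)) (fun j => evalAt p 1 (E j) ^ 2)
  simp only [Equiv.subRight_apply] at h
  rw [h, sub_self, add_zero, Finset.sum_neg_distrib]
  exact neg_nonpos.mpr (Finset.sum_nonneg fun j _ => sq_nonneg _)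

/-- The scheme is a contraction in `L²`, so the norm grows at most at the rate of the source. A
majorant with a known primitive `Φ` replaces the integral of the source. -/
theorem sqrt_energy_le (p : ℕ) {r : ℝ} (hr : 0 ≤ r) {N : ℕ} [NeZero N]
    {E s : ZMod N → ℝ → Fin (p + 1) → ℝ} (hE : HasSchemeDeriv p r E s) {Φ Φ' : ℝ → ℝ}
    (hΦ : ∀ t, HasDerivAt Φ (Φ' t) t)
    (hs : ∀ t, 0 ≤ t → √(∑ j, ip p (s j t) (s j t)) ≤ Φ' t) {t : ℝ} (ht : 0 ≤ t) :
    √(∑ j, ip p (E j t) (E j t)) ≤ √(∑ j, ip p (E j 0) (E j 0)) + (Φ t - Φ 0) := by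
  set F : ℝ → ℝ := fun t => ∑ j, ip p (E j t) (E j t) with hF
  set F' : ℝ → ℝ := fun t => ∑ j, 2 * ip p (E j t)
    (r • (upwind p (E j t) + evalAt p 1 (E (j - 1) t) • inflow p) + s j t) with hF'
  have hF0 : ∀ t, 0 ≤ F t := fun t => Finset.sum_nonneg fun j _ => ip_self_nonneg _ _
  have hFd : ∀ t, 0 ≤ t → HasDerivWithinAt F (F' t) (Set.Ici 0) t := fun t ht =>
    HasDerivWithinAt.fun_sum fun j _ => hasDerivWithinAt_ip_self p (hE j t ht)
  have hF'le : ∀ t, 0 ≤ t → F' t ≤ 2 * √(F t) * Φ' t := by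
    intro t ht
    have h1 : F' t = 2 * r * (∑ j, ip p (E j t)
        (upwind p (E j t) + evalAt p 1 (E (j - 1) t) • inflow p)) +
        2 * ∑ j, ip p (E j t) (s j t) := by
      simp only [hF', ip_add_right p _ (r • _), ip_smul_right]
      rw [Finset.mul_sum, Finset.mul_sum, ← Finset.sum_add_distrib]
      exact Finset.sum_congr rfl fun j _ => by ring
    have h2 := sum_ip_scheme_nonpos p (fun j => E j t)
    have h3 := sum_ip_le_sqrt_mul_sqrt (fun j => E j t) (fun j => s j t)
    have h4 := mul_le_mul_of_nonneg_left (hs t ht) (Real.sqrt_nonneg (F t))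
    have h5 := mul_nonpos_of_nonneg_of_nonpos (mul_nonneg zero_le_two hr) h2
    rw [h1]
    linarith
  refine le_of_forall_pos_le_add fun ε hε => ?_
  -- The square root is regularized because `√F` need not be differentiable where `F` vanishes.
  have hpos : ∀ t, 0 < F t + ε ^ 2 := fun t => by have := hF0 t; positivity
  set y : ℝ → ℝ := fun t => √(F t + ε ^ 2) with hy
  have hyd : ∀ t, 0 ≤ t →
      HasDerivWithinAt (fun t => y t - Φ t) (F' t / (2 * √(F t + ε ^ 2)) - Φ' t) (Set.Ici 0) t :=
    fun t ht => (((hFd t ht).add_const _).sqrt (hpos t).ne').sub (hΦ t).hasDerivWithinAt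
  have hanti : AntitoneOn (fun t => y t - Φ t) (Set.Ici 0) := by
    refine antitoneOn_of_hasDerivWithinAt_nonpos (convex_Ici 0)
      (f' := fun t => F' t / (2 * √(F t + ε ^ 2)) - Φ' t)
      (fun t ht => (hyd t ht).continuousWithinAt) ?_ ?_
    · intro t ht
      rw [interior_Ici] at ht ⊢
      exact (hyd t ht.le).mono Set.Ioi_subset_Ici_self
    · intro t ht
      rw [interior_Ici] at ht
      have hΦ'0 : 0 ≤ Φ' t := (Real.sqrt_nonneg _).trans (hs t ht.le)
      have hsq : √(F t) ≤ √(F t + ε ^ 2) := Real.sqrt_le_sqrt (by nlinarith)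
      have hsp := Real.sqrt_pos.mpr (hpos t)
      rw [sub_nonpos, div_le_iff₀ (by positivity)]
      refine (hF'le t ht.le).trans ?_
      nlinarith
  have h1 := hanti (Set.mem_Ici.mpr le_rfl) (Set.mem_Ici.mpr ht) ht
  have h2 : √(F t) ≤ y t := Real.sqrt_le_sqrt (by nlinarith)
  have h3 : y 0 ≤ √(F 0) + ε := by
    refine (Real.sqrt_le_left (by positivity)).mpr ?_
    nlinarith [Real.sq_sqrt (hF0 0), mul_nonneg (Real.sqrt_nonneg (F 0)) hε.le]
  simp only at h1
  linarith

/-! ### From the energy to pointwise bounds -/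

theorem sum_norm_le_sqrt (p : ℕ) {N : ℕ} [NeZero N] (D : ZMod N → Fin (p + 1) → ℝ) :
    ∑ j, ‖D j‖ ≤ √N * √((p + 1) * ∑ j, ip p (D j) (D j)) := by
  have h := Real.sum_mul_le_sqrt_mul_sqrt (Finset.univ : Finset (ZMod N))
    (fun _ => (1 : ℝ)) (fun j => ‖D j‖)
  simp only [one_mul, one_pow, Finset.sum_const, Finset.card_univ, ZMod.card, nsmul_eq_mul,
    mul_one] at h
  refine h.trans (mul_le_mul_of_nonneg_left (Real.sqrt_le_sqrt ?_) (Real.sqrt_nonneg _))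
  rw [Finset.mul_sum]
  exact Finset.sum_le_sum fun j _ => norm_sq_le_ip p (D j)

theorem norm_sub_le_sum_norm_sub {N : ℕ} [NeZero N] {V : Type*} [NormedAddCommGroup V]
    (E : ZMod N → V) (i j : ZMod N) : ‖E j - E i‖ ≤ ∑ l, ‖E l - E (l - 1)‖ := by
  have key : ∀ n : ℕ, E (i + n) - E i =
      ∑ l ∈ Finset.range n, (E (i + (l + 1 : ℕ)) - E (i + (l + 1 : ℕ) - 1)) := by
    intro n
    rw [← (by simp : E (i + ((0 : ℕ) : ZMod N)) = E i),
      ← Finset.sum_range_sub (fun l : ℕ => E (i + (l : ZMod N)))]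
    refine Finset.sum_congr rfl fun l _ => ?_
    congr 2
    push_cast; ring
  have hj : j = i + ((j - i).val : ZMod N) := by simp
  -- The walk from `i` to `j` makes less than one lap, so no difference is used twice.
  have hinj : Set.InjOn (fun l : ℕ => i + ((l + 1 : ℕ) : ZMod N))
      (Finset.range (j - i).val : Finset ℕ) := by
    intro x hx y hy hxy
    have hN := ZMod.val_lt (j - i)
    simp only [Finset.coe_range, Set.mem_Iio] at hx hy
    simp only [Nat.cast_add, Nat.cast_one, add_right_inj, add_left_inj] at hxy
    rw [ZMod.natCast_eq_natCast_iff'] at hxy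
    rwa [Nat.mod_eq_of_lt (by omega), Nat.mod_eq_of_lt (by omega)] at hxy
  calc ‖E j - E i‖ = ‖E (i + ((j - i).val : ZMod N)) - E i‖ := by rw [← hj]
    _ ≤ ∑ l ∈ Finset.range (j - i).val,
        ‖E (i + (l + 1 : ℕ)) - E (i + (l + 1 : ℕ) - 1)‖ := by
      rw [key]; exact norm_sum_le _ _
    _ = ∑ l ∈ (Finset.range (j - i).val).image (fun l : ℕ => i + ((l + 1 : ℕ) : ZMod N)),
        ‖E l - E (l - 1)‖ := by rw [Finset.sum_image hinj]
    _ ≤ _ := Finset.sum_le_sum_of_subset_of_nonneg (Finset.subset_univ _)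
        fun _ _ _ => norm_nonneg _

/-- A discrete Sobolev inequality: the energy controls the mean over the cells, and the energy of
the differences controls the total variation. It avoids the loss of `h ^ (1/2)` of an inverse
inequality. -/
theorem norm_le_of_energy_le (p : ℕ) {N : ℕ} [NeZero N] (E : ZMod N → Fin (p + 1) → ℝ) {M D : ℝ}
    (hM : √(∑ j, ip p (E j) (E j)) ≤ √N * M)
    (hD : √(∑ j, ip p (E j - E (j - 1)) (E j - E (j - 1))) ≤ √N * D) (j : ZMod N) :
    ‖E j‖ ≤ √(p + 1) * (M + N * D) := by
  have hN : (0 : ℝ) < N := by exact_mod_cast Nat.pos_of_ne_zero (NeZero.ne N)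
  have hp : (0 : ℝ) ≤ p + 1 := by positivity
  have hNs : √(N : ℝ) * √N = N := Real.mul_self_sqrt hN.le
  have h1 : ∑ l, ‖E l - E (l - 1)‖ ≤ √(p + 1) * (N * D) := by
    refine (sum_norm_le_sqrt p fun l => E l - E (l - 1)).trans ?_
    rw [Real.sqrt_mul hp]
    calc √(N : ℝ) * (√(p + 1) * √(∑ j, ip p (E j - E (j - 1)) (E j - E (j - 1))))
        ≤ √(N : ℝ) * (√(p + 1) * (√N * D)) := by gcongr
      _ = √(p + 1) * ((√(N : ℝ) * √N) * D) := by ring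
      _ = _ := by rw [hNs]
  have h2 : ∑ l, ‖E l‖ ≤ N * (√(p + 1) * M) := by
    refine (sum_norm_le_sqrt p E).trans ?_
    rw [Real.sqrt_mul hp]
    calc √(N : ℝ) * (√(p + 1) * √(∑ j, ip p (E j) (E j)))
        ≤ √(N : ℝ) * (√(p + 1) * (√N * M)) := by gcongr
      _ = (√(N : ℝ) * √N) * (√(p + 1) * M) := by ring
      _ = _ := by rw [hNs]
  have h3 : ∀ i, ‖E j‖ ≤ ‖E i‖ + √(p + 1) * (N * D) := fun i => by
    have := norm_sub_le_sum_norm_sub E i j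
    have h4 : ‖E j‖ ≤ ‖E i‖ + ‖E j - E i‖ := by
      calc ‖E j‖ = ‖E i + (E j - E i)‖ := by rw [add_sub_cancel]
        _ ≤ _ := norm_add_le _ _
    linarith
  -- Average of `h3` over all cells `i`.
  have h5 : (N : ℝ) * ‖E j‖ ≤ N * (√(p + 1) * M) + N * (√(p + 1) * (N * D)) := by
    have := Finset.sum_le_sum fun i (_ : i ∈ (Finset.univ : Finset (ZMod N))) => h3 i
    rw [Finset.sum_add_distrib] at this
    simp only [Finset.sum_const, Finset.card_univ, ZMod.card, nsmul_eq_mul] at this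
    linarith
  rw [← mul_add] at h5
  have := le_of_mul_le_mul_left h5 hN
  linarith

theorem sqrt_sum_ip_le (p : ℕ) {N : ℕ} [NeZero N] {s : ZMod N → Fin (p + 1) → ℝ} {b : ℝ}
    (hs : ∀ j, ‖s j‖ ≤ b) : √(∑ j, ip p (s j) (s j)) ≤ √N * (√(2 * (p + 1)) * b) := by
  have hb : 0 ≤ b := (norm_nonneg _).trans (hs 0)
  refine (Real.sqrt_le_left (by positivity)).mpr ?_
  rw [mul_pow, mul_pow, Real.sq_sqrt (by positivity), Real.sq_sqrt (by positivity)]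
  calc ∑ j, ip p (s j) (s j) ≤ ∑ _j : ZMod N, 2 * (p + 1) * b ^ 2 :=
        Finset.sum_le_sum fun j _ => (ip_self_le p (s j)).trans (by gcongr; exact hs j)
    _ = _ := by simp

/-- Translation invariance of the scheme on the uniform mesh: smoothness on the scale of the mesh is
propagated. -/
theorem HasSchemeDeriv.sub_shift {p : ℕ} {r : ℝ} {N : ℕ} {E s : ZMod N → ℝ → Fin (p + 1) → ℝ}
    (hE : HasSchemeDeriv p r E s) :
    HasSchemeDeriv p r (fun j t => E j t - E (j - 1) t) (fun j t => s j t - s (j - 1) t) := by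
  intro j t ht
  refine ((hE j t ht).sub (hE (j - 1) t ht)).congr_deriv ?_
  rw [map_sub, map_sub]
  module

/-- The fast part of the source has size `1 / h` but lives for a time of order `h`; its time
integral is at most `β₁ / σ`, uniformly in the mesh. -/
theorem sqrt_energy_le_of_source_le (p : ℕ) {L a σ : ℝ} (hL : 0 < L) (ha : 0 < a) (hσ : 0 < σ)
    {N : ℕ} [NeZero N] {E s : ZMod N → ℝ → Fin (p + 1) → ℝ}
    (hE : HasSchemeDeriv p (a / (L / N)) E s) {M β₀ β₁ : ℝ} (hβ₁ : 0 ≤ β₁)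
    (hE0 : ∀ j, ‖E j 0‖ ≤ M)
    (hs : ∀ j t, 0 ≤ t → ‖s j t‖ ≤ β₀ + β₁ * (a / (L / N)) * Real.exp (-(σ * a * t / (L / N))))
    {t : ℝ} (ht : 0 ≤ t) :
    √(∑ j, ip p (E j t) (E j t)) ≤ √N * (√(2 * (p + 1)) * (M + β₀ * t + β₁ / σ)) := by
  have hN : (0 : ℝ) < N := by exact_mod_cast Nat.pos_of_ne_zero (NeZero.ne N)
  have hh : 0 < L / N := by positivity
  set h := L / N
  set κ : ℝ := √N * √(2 * (p + 1)) with hκ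
  have hκ0 : 0 ≤ κ := by positivity
  have hd : ∀ t, HasDerivAt (fun t => κ * (β₀ * t - β₁ / σ * Real.exp (-(σ * a * t / h))))
      (κ * (β₀ + β₁ * (a / h) * Real.exp (-(σ * a * t / h)))) t := by
    intro t
    have h1 : HasDerivAt (fun t => -(σ * a * t / h)) (-(σ * a / h)) t := by
      have := (((hasDerivAt_id t).const_mul (σ * a)).div_const h).fun_neg
      simpa using this
    refine ((((hasDerivAt_id t).const_mul β₀).sub (h1.exp.const_mul (β₁ / σ))).const_mul
      κ).congr_deriv ?_
    field_simp
    ring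
  have h1 := sqrt_energy_le p (by positivity : 0 ≤ a / h) hE hd (fun t ht => by
    rw [hκ, mul_assoc]; exact sqrt_sum_ip_le p fun j => hs j t ht) ht
  have h2 := sqrt_sum_ip_le p hE0
  refine h1.trans ((add_le_add_left h2 _).trans ?_)
  rw [← mul_assoc, ← mul_assoc, ← hκ, ← mul_sub, ← mul_add]
  refine mul_le_mul_of_nonneg_left ?_ hκ0
  have h3 : 0 ≤ β₁ / σ * Real.exp (-(σ * a * t / h)) := by positivity
  simp only [mul_zero, zero_div, neg_zero, Real.exp_zero, mul_one]
  linarith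

/-- Stability of the scheme in the maximum norm for data and sources that are smooth on the scale
of the mesh. -/
theorem norm_le_of_smooth_source (p : ℕ) {L a σ : ℝ} (hL : 0 < L) (ha : 0 < a) (hσ : 0 < σ)
    {N : ℕ} [NeZero N] {E s : ZMod N → ℝ → Fin (p + 1) → ℝ}
    (hE : HasSchemeDeriv p (a / (L / N)) E s) {M β₀ β₁ : ℝ} (hβ₁ : 0 ≤ β₁)
    (hE0 : ∀ j, ‖E j 0‖ ≤ M) (hE1 : ∀ j, ‖E j 0 - E (j - 1) 0‖ ≤ L / N * M)
    (hs0 : ∀ j t, 0 ≤ t → ‖s j t‖ ≤ β₀ + β₁ * (a / (L / N)) * Real.exp (-(σ * a * t / (L / N))))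
    (hs1 : ∀ j t, 0 ≤ t → ‖s j t - s (j - 1) t‖ ≤
      L / N * (β₀ + β₁ * (a / (L / N)) * Real.exp (-(σ * a * t / (L / N)))))
    {t : ℝ} (ht : 0 ≤ t) (j : ZMod N) :
    ‖E j t‖ ≤ √(p + 1) * √(2 * (p + 1)) * (1 + L) * (M + β₀ * t + β₁ / σ) := by
  have hN : (0 : ℝ) < N := by exact_mod_cast Nat.pos_of_ne_zero (NeZero.ne N)
  have h1 := sqrt_energy_le_of_source_le p hL ha hσ hE hβ₁ hE0 hs0 ht
  -- The factor `L / N` gained by the differences pays for the factor `N` in `norm_le_of_energy_le`.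
  have h2 := sqrt_energy_le_of_source_le p hL ha hσ hE.sub_shift
    (M := L / N * M) (β₀ := L / N * β₀) (β₁ := L / N * β₁) (by positivity) hE1
    (fun j t ht => (hs1 j t ht).trans (le_of_eq (by ring))) ht
  refine (norm_le_of_energy_le p (fun j => E j t) h1 h2 j).trans (le_of_eq ?_)
  field_simp

/-! ### Exponential decay on one periodic cell -/

theorem hasDerivAt_linearMap_comp {V F : Type*} [NormedAddCommGroup V] [NormedSpace ℝ V]
    [FiniteDimensional ℝ V] [NormedAddCommGroup F] [NormedSpace ℝ F] (l : V →ₗ[ℝ] F)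
    {z : ℝ → V} {z' : V} {t : ℝ} (h : HasDerivAt z z' t) :
    HasDerivAt (fun t => l (z t)) (l z') t :=
  (LinearMap.toContinuousLinearMap l).hasFDerivAt.comp_hasDerivAt t h

/-- The scheme on one cell with periodic boundary condition. -/
def periodicOp (p : ℕ) : (Fin (p + 1) → ℝ) →ₗ[ℝ] (Fin (p + 1) → ℝ) :=
  upwind p + (evalAt p 1).smulRight (inflow p)

theorem periodicOp_apply (p : ℕ) (v : Fin (p + 1) → ℝ) :
    periodicOp p v = upwind p v + evalAt p 1 v • inflow p := rfl

/-- The jump of a cell polynomial, extended periodically. -/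
def periodicJump (p : ℕ) : (Fin (p + 1) → ℝ) →ₗ[ℝ] ℝ := evalAt p (-1) - evalAt p 1

theorem two_mul_apply_zero (p : ℕ) (v : Fin (p + 1) → ℝ) :
    2 * v 0 = integralPoly (toPoly p v) := by
  have h := congrFun (coefL_toPoly p v) 0
  rw [coefL_apply] at h
  simp only [Fin.val_zero, legendre_zero, mul_one] at h
  push_cast at h
  linarith

/-- Conservation of the mean: tested with a constant, outflow and periodic inflow cancel. -/
theorem periodicOp_apply_zero (p : ℕ) (v : Fin (p + 1) → ℝ) : periodicOp p v 0 = 0 := by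
  have h1 := integralPoly_toPoly_upwind_mul p v (q := 1) (by simp)
  have h2 := integralPoly_toPoly_inflow_mul p (q := 1) (by simp)
  have h3 := two_mul_apply_zero p (periodicOp p v)
  simp only [mul_one, derivative_one, mul_zero, map_zero, eval_one] at h1 h2
  rw [periodicOp_apply, map_add, map_smul, map_add, map_smul, h1, h2, evalAt_apply] at h3
  simp only [smul_eq_mul] at h3
  rw [periodicOp_apply, evalAt_apply]
  linarith

theorem ip_periodicOp (p : ℕ) (v : Fin (p + 1) → ℝ) :
    ip p v (periodicOp p v) = -periodicJump p v ^ 2 := by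
  rw [periodicOp_apply, ip_upwind, periodicJump, LinearMap.sub_apply]; ring

theorem toPoly_periodicOp_of_jump_eq_zero (p : ℕ) {v : Fin (p + 1) → ℝ}
    (h : periodicJump p v = 0) :
    toPoly p (periodicOp p v) = (-2 : ℝ) • derivative (toPoly p v) := by
  rw [periodicJump, LinearMap.sub_apply, sub_eq_zero, evalAt_apply, evalAt_apply] at h
  rw [periodicOp_apply, map_add, toPoly_upwind, map_smul, evalAt_apply, h, sub_add_cancel]

/-- In degree `d + 1` the `d`-th derivative would be affine and nonconstant, with different values
at `±1`. -/
theorem natDegree_eq_zero_of_iterate_derivative_periodic (f : ℝ[X])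
    (h : ∀ n, (derivative^[n] f).eval (-1) = (derivative^[n] f).eval 1) : f.natDegree = 0 := by
  by_contra hd
  obtain ⟨d, hd⟩ := Nat.exists_eq_succ_of_ne_zero hd
  have h0 : f ≠ 0 := by rintro rfl; simp at hd
  have h1 : (derivative^[d + 1] f).natDegree = 0 := by
    have := natDegree_iterate_derivative f (d + 1)
    omega
  have h2 := integralPoly_derivative (derivative^[d] f)
  rw [← Function.iterate_succ_apply' derivative d f, h d, sub_self, eq_C_of_natDegree_eq_zero h1,
    integralPoly_C, coeff_iterate_derivative, zero_add, ← Nat.succ_eq_add_one, ← hd] at h2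
  have h4 := f.natDegree.factorial_ne_zero
  simp [Nat.descFactorial_self, h4] at h2
  exact h0 h2

/-- Observability of the one-cell problem through the jump. While the jumps vanish the operator is
`-2 d/dξ`, so every derivative is periodic; the polynomial is constant, and its mean is zero. -/
theorem eq_zero_of_periodicJump_pow_eq_zero (p : ℕ) {v : Fin (p + 1) → ℝ} (hv : v 0 = 0)
    (h : ∀ n, periodicJump p ((periodicOp p ^ n) v) = 0) : v = 0 := by
  have h1 : ∀ n, toPoly p ((periodicOp p ^ n) v) =
      (-2 : ℝ) ^ n • derivative^[n] (toPoly p v) := by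
    intro n
    induction n with
    | zero => simp
    | succ n ih =>
      rw [pow_succ', Module.End.mul_apply, toPoly_periodicOp_of_jump_eq_zero p (h n), ih,
        Function.iterate_succ_apply', derivative_smul, smul_smul, pow_succ']
  have h2 : (toPoly p v).natDegree = 0 := by
    refine natDegree_eq_zero_of_iterate_derivative_periodic _ fun n => ?_
    have h3 := h n
    rw [periodicJump, LinearMap.sub_apply, evalAt_apply, evalAt_apply, h1, eval_smul, eval_smul,
      ← smul_sub, smul_eq_mul] at h3
    have h4 : ((-2 : ℝ)) ^ n ≠ 0 := pow_ne_zero _ (by norm_num)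
    exact sub_eq_zero.mp ((mul_eq_zero.mp h3).resolve_left h4)
  have h5 := two_mul_apply_zero p v
  rw [hv, eq_C_of_natDegree_eq_zero h2, integralPoly_C] at h5
  have h6 : (toPoly p v).coeff 0 = 0 := by linarith
  apply toPoly_injective
  rw [eq_C_of_natDegree_eq_zero h2, h6, map_zero, map_zero]

/-- The flow of the scheme on one periodic cell. -/
def periodicFlow (p : ℕ) (t : ℝ) : (Fin (p + 1) → ℝ) →L[ℝ] (Fin (p + 1) → ℝ) :=
  NormedSpace.exp (t • LinearMap.toContinuousLinearMap (periodicOp p))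

theorem periodicFlow_zero (p : ℕ) : periodicFlow p 0 = 1 := by
  rw [periodicFlow, zero_smul, NormedSpace.exp_zero]

theorem hasDerivAt_periodicFlow_clm (p : ℕ) (t : ℝ) :
    HasDerivAt (periodicFlow p)
      (periodicFlow p t * LinearMap.toContinuousLinearMap (periodicOp p)) t :=
  hasDerivAt_exp_smul_const (𝕂 := ℝ) (LinearMap.toContinuousLinearMap (periodicOp p)) t

theorem hasDerivAt_periodicFlow (p : ℕ) (v : Fin (p + 1) → ℝ) (t : ℝ) :
    HasDerivAt (fun t => periodicFlow p t v) (periodicOp p (periodicFlow p t v)) t := by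
  have h := hasDerivAt_exp_smul_const' (𝕂 := ℝ) (LinearMap.toContinuousLinearMap (periodicOp p)) t
  exact (h.clm_apply (hasDerivAt_const t v)).congr_deriv (by simp [periodicFlow])

theorem periodicFlow_add (p : ℕ) (s t : ℝ) :
    periodicFlow p (s + t) = periodicFlow p s * periodicFlow p t := by
  let : NormedAlgebra ℚ ((Fin (p + 1) → ℝ) →L[ℝ] (Fin (p + 1) → ℝ)) :=
    NormedAlgebra.restrictScalars ℚ ℝ _
  rw [periodicFlow, add_smul, NormedSpace.exp_add_of_commute]
  · rfl
  · exact ((Commute.refl _).smul_left s).smul_right t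

theorem periodicFlow_apply_zero (p : ℕ) (v : Fin (p + 1) → ℝ) (t : ℝ) :
    periodicFlow p t v 0 = v 0 := by
  have h : ∀ t, HasDerivAt (fun t => periodicFlow p t v 0) 0 t := fun t => by
    have := (hasDerivAt_pi.mp (hasDerivAt_periodicFlow p v t)) 0
    rwa [periodicOp_apply_zero] at this
  have := is_const_of_deriv_eq_zero (fun t => (h t).differentiableAt) (fun t => (h t).deriv) t 0
  rw [this, periodicFlow_zero]; rfl

theorem hasDerivAt_ip_periodicFlow (p : ℕ) (v : Fin (p + 1) → ℝ) (t : ℝ) :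
    HasDerivAt (fun t => ip p (periodicFlow p t v) (periodicFlow p t v))
      (2 * -periodicJump p (periodicFlow p t v) ^ 2) t := by
  have h := hasDerivWithinAt_ip_self p (hasDerivAt_periodicFlow p v t).hasDerivWithinAt
    (S := Set.univ)
  rwa [hasDerivWithinAt_univ, ip_periodicOp] at h

theorem antitone_ip_periodicFlow (p : ℕ) (v : Fin (p + 1) → ℝ) :
    Antitone (fun t => ip p (periodicFlow p t v) (periodicFlow p t v)) := by
  refine antitone_of_hasDerivAt_nonpos (hasDerivAt_ip_periodicFlow p v) fun t => ?_
  change 2 * -periodicJump p (periodicFlow p t v) ^ 2 ≤ 0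
  nlinarith [sq_nonneg (periodicJump p (periodicFlow p t v))]

theorem eq_zero_of_ip_eq_zero {p : ℕ} {v : Fin (p + 1) → ℝ} (h : ip p v v = 0) : v = 0 := by
  have := norm_sq_le_ip p v
  rw [h, mul_zero] at this
  exact norm_eq_zero.mp (pow_eq_zero_iff two_ne_zero |>.mp (le_antisymm this (sq_nonneg _)))

/-- LaSalle's argument: if the energy did not drop it would be constant on `[0, 1]`, the jump would
vanish there together with all its time derivatives, and observability would give zero. -/
theorem ip_periodicFlow_one_lt (p : ℕ) {v : Fin (p + 1) → ℝ} (hv : v 0 = 0) (hne : v ≠ 0) :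
    ip p (periodicFlow p 1 v) (periodicFlow p 1 v) < ip p v v := by
  have hanti := antitone_ip_periodicFlow p v
  have h0 : ip p (periodicFlow p 0 v) (periodicFlow p 0 v) = ip p v v := by
    rw [periodicFlow_zero]; rfl
  by_contra hcon
  have hconst : ∀ t ∈ Set.Icc (0 : ℝ) 1,
      ip p (periodicFlow p t v) (periodicFlow p t v) = ip p v v := fun t ht =>
    le_antisymm (h0 ▸ hanti ht.1) ((not_lt.mp hcon).trans (hanti ht.2))
  have hjump : ∀ n, ∀ t ∈ Set.Ioo (0 : ℝ) 1,
      periodicJump p ((periodicOp p ^ n) (periodicFlow p t v)) = 0 := by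
    intro n
    induction n with
    | zero =>
      intro t ht
      have h1 : HasDerivAt (fun t => ip p (periodicFlow p t v) (periodicFlow p t v)) 0 t := by
        refine (hasDerivAt_const t (ip p v v)).congr_of_eventuallyEq ?_
        filter_upwards [Ioo_mem_nhds ht.1 ht.2] with s hs
        exact hconst s (Set.Ioo_subset_Icc_self hs)
      have h2 := (hasDerivAt_ip_periodicFlow p v t).unique h1
      have h3 : periodicJump p (periodicFlow p t v) ^ 2 = 0 := by linarith
      simpa using h3
    | succ n ih =>
      intro t ht
      have h1 : HasDerivAt (fun t => periodicJump p ((periodicOp p ^ n) (periodicFlow p t v)))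
          0 t := by
        refine (hasDerivAt_const t (0 : ℝ)).congr_of_eventuallyEq ?_
        filter_upwards [Ioo_mem_nhds ht.1 ht.2] with s hs
        exact ih s hs
      have h2 := hasDerivAt_linearMap_comp (periodicJump p ∘ₗ (periodicOp p ^ n))
        (hasDerivAt_periodicFlow p v t)
      have h3 := h2.unique h1
      rwa [pow_succ, Module.End.mul_apply]
  have hhalf : (1 / 2 : ℝ) ∈ Set.Ioo (0 : ℝ) 1 := by norm_num
  have h1 := eq_zero_of_periodicJump_pow_eq_zero p (v := periodicFlow p (1 / 2) v)
    (by rw [periodicFlow_apply_zero, hv]) (fun n => hjump n _ hhalf)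
  have h2 := hconst _ (Set.Ioo_subset_Icc_self hhalf)
  rw [h1] at h2
  exact hne (eq_zero_of_ip_eq_zero (by rw [← h2]; simp [ip]))

theorem continuous_ip_self (p : ℕ) : Continuous (fun v : Fin (p + 1) → ℝ => ip p v v) := by
  unfold ip
  fun_prop

theorem ip_smul_self (p : ℕ) (r : ℝ) (v : Fin (p + 1) → ℝ) :
    ip p (r • v) (r • v) = r ^ 2 * ip p v v := by
  simp only [ip, Finset.mul_sum, Pi.smul_apply, smul_eq_mul]
  exact Finset.sum_congr rfl fun k _ => by ring

theorem exists_ip_periodicFlow_one_le (p : ℕ) :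
    ∃ q : ℝ, 0 < q ∧ q < 1 ∧ ∀ v : Fin (p + 1) → ℝ, v 0 = 0 →
      ip p (periodicFlow p 1 v) (periodicFlow p 1 v) ≤ q * ip p v v := by
  set K : Set (Fin (p + 1) → ℝ) := {v | v 0 = 0 ∧ ip p v v = 1} with hK
  have hKc : IsCompact K := by
    refine Metric.isCompact_of_isClosed_isBounded ?_ ?_
    · exact (isClosed_eq (continuous_apply 0) continuous_const).inter
        (isClosed_eq (continuous_ip_self p) continuous_const)
    · rw [isBounded_iff_forall_norm_le]
      refine ⟨√(p + 1), fun v hv => Real.le_sqrt_of_sq_le ?_⟩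
      have := norm_sq_le_ip p v
      rwa [hv.2, mul_one] at this
  have hq : ∃ q : ℝ, q < 1 ∧ ∀ v ∈ K, ip p (periodicFlow p 1 v) (periodicFlow p 1 v) ≤ q := by
    -- For `p = 0` the only mean-free vector is zero and the sphere is empty.
    rcases K.eq_empty_or_nonempty with h | h
    · exact ⟨0, one_pos, by simp [h]⟩
    · obtain ⟨w, hw, hmax⟩ := hKc.exists_isMaxOn h
        ((continuous_ip_self p).comp (periodicFlow p 1).continuous).continuousOn
      refine ⟨_, ?_, fun v hv => hmax hv⟩
      have hne : w ≠ 0 := by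
        rintro rfl
        have := hw.2
        simp [ip] at this
      exact hw.2 ▸ ip_periodicFlow_one_lt p hw.1 hne
  obtain ⟨q, hq1, hq⟩ := hq
  -- The maximum with `1 / 2` makes the factor positive, so that its logarithm can serve as a rate.
  refine ⟨max q (1 / 2), lt_max_of_lt_right (by norm_num), max_lt hq1 (by norm_num),
    fun v hv => ?_⟩
  rcases (ip_self_nonneg p v).eq_or_lt with h0 | h0
  · rw [eq_zero_of_ip_eq_zero h0.symm]; simp [ip]
  · set r := √(ip p v v) with hr
    have hr0 : 0 < r := Real.sqrt_pos.mpr h0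
    have hr2 : r ^ 2 = ip p v v := Real.sq_sqrt h0.le
    have h1 := hq (r⁻¹ • v) ⟨by simp [hv], by
      rw [ip_smul_self, ← hr2, inv_pow, inv_mul_cancel₀ (by positivity)]⟩
    rw [map_smul, ip_smul_self, inv_pow, inv_mul_le_iff₀ (by positivity), hr2] at h1
    rw [mul_comm]
    exact h1.trans (mul_le_mul_of_nonneg_left (le_max_left _ _) h0.le)

theorem exists_periodicFlow_decay (p : ℕ) :
    ∃ κ B : ℝ, 0 < κ ∧ 0 ≤ B ∧ ∀ v : Fin (p + 1) → ℝ, v 0 = 0 → ∀ t : ℝ, 0 ≤ t →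
      ‖periodicFlow p t v‖ ≤ B * Real.exp (-(κ * t)) * ‖v‖ := by
  obtain ⟨q, hq0, hq1, hq⟩ := exists_ip_periodicFlow_one_le p
  have hpow : ∀ n : ℕ, ∀ v : Fin (p + 1) → ℝ, v 0 = 0 →
      ip p (periodicFlow p n v) (periodicFlow p n v) ≤ q ^ n * ip p v v := by
    intro n
    induction n with
    | zero => intro v _; simp [periodicFlow_zero]
    | succ n ih =>
      intro v hv
      have h1 := ih (periodicFlow p 1 v) (by rw [periodicFlow_apply_zero, hv])
      push_cast
      rw [periodicFlow_add, pow_succ, mul_assoc]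
      exact h1.trans (mul_le_mul_of_nonneg_left (hq v hv) (by positivity))
  have hlog : Real.log q < 0 := Real.log_neg hq0 hq1
  -- Half the logarithm, since the energy is quadratic in the norm; the factor `q⁻¹` accounts for
  -- rounding `t` down to an integer.
  refine ⟨-Real.log q / 2, √((p + 1) * (q⁻¹ * (2 * (p + 1)))), by linarith, Real.sqrt_nonneg _,
    fun v hv t ht => ?_⟩
  have h1 := norm_sq_le_ip p (periodicFlow p t v)
  have h2 := antitone_ip_periodicFlow p v (Nat.floor_le ht)
  have h3 := hpow ⌊t⌋₊ v hv
  have h4 : q ^ ⌊t⌋₊ ≤ q⁻¹ * Real.exp (-(-Real.log q / 2 * t)) ^ 2 := by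
    have h5 : t - 1 ≤ ⌊t⌋₊ := (Nat.sub_one_lt_floor t).le
    rw [← Real.exp_nat_mul, ← Real.rpow_natCast, Real.rpow_def_of_pos hq0,
      ← Real.exp_log (inv_pos.mpr hq0), ← Real.exp_add, Real.log_inv]
    apply Real.exp_le_exp.mpr
    push_cast
    nlinarith
  have h6 := ip_self_le p v
  have hp : (0 : ℝ) ≤ p + 1 := by positivity
  refine abs_le_of_sq_le_sq' ?_ (by positivity) |>.2
  rw [mul_pow, mul_pow, Real.sq_sqrt (by positivity)]
  calc ‖periodicFlow p t v‖ ^ 2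
      ≤ (p + 1) * (q ^ ⌊t⌋₊ * ip p v v) :=
        h1.trans (mul_le_mul_of_nonneg_left (h2.trans h3) hp)
    _ ≤ (p + 1) * ((q⁻¹ * Real.exp (-(-Real.log q / 2 * t)) ^ 2) *
        (2 * (p + 1) * ‖v‖ ^ 2)) := by
        have := ip_self_nonneg p v
        gcongr
    _ = _ := by ring

/-! ### The transient modes -/

/-- Only half the rate `κ` of the flow is used, so that the convolution with a source of rate `κ /
2` keeps that rate without a factor `t`. Hence one `σ` serves all orders of a chain. -/
theorem exists_duhamel_bound (p : ℕ) :
    ∃ σ B : ℝ, 0 < σ ∧ 0 ≤ B ∧ ∀ (Z f : ℝ → Fin (p + 1) → ℝ) (M : ℝ),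
      (∀ t, HasDerivAt Z (periodicOp p (Z t) + f t) t) → Z 0 0 = 0 → (∀ t, f t 0 = 0) →
      (∀ t, 0 ≤ t → ‖f t‖ ≤ M * Real.exp (-(σ * t))) →
      ∀ t, 0 ≤ t → ‖Z t‖ ≤ B * (‖Z 0‖ + M) * Real.exp (-(σ * t)) := by
  obtain ⟨κ, B, hκ, hB, hdecay⟩ := exists_periodicFlow_decay p
  refine ⟨κ / 2, B * (1 + 2 / κ), by positivity, by positivity,
    fun Z f M hZ hZ0 hf0 hf t ht => ?_⟩
  have hM : 0 ≤ M := by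
    have := (norm_nonneg _).trans (hf 0 le_rfl)
    simpa using this
  -- Duhamel's formula in differential form: `φ` joins the free flow of `Z 0` to `Z t`, and its
  -- derivative contains only the source. The comparison function in `hbd` replaces the integral.
  set φ : ℝ → Fin (p + 1) → ℝ := fun x => periodicFlow p (t - x) (Z x)
  have hφ : ∀ x, HasDerivAt φ (periodicFlow p (t - x) (f x)) x := by
    intro x
    have h1 : HasDerivAt (fun x => periodicFlow p (t - x))
        (-(periodicFlow p (t - x) * LinearMap.toContinuousLinearMap (periodicOp p))) x := by
      have := (hasDerivAt_periodicFlow_clm p (t - x)).scomp x ((hasDerivAt_id x).const_sub t)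
      rw [neg_one_smul] at this
      exact this
    refine (h1.clm_apply (hZ x)).congr_deriv ?_
    simp
  have hbd : ∀ x, HasDerivAt (fun x => B * Real.exp (-(κ * t)) * ‖Z 0‖ +
        2 / κ * (B * M * Real.exp (-(κ * t) + κ / 2 * x)))
      (B * M * Real.exp (-(κ * t) + κ / 2 * x)) x := by
    intro x
    have h1 : HasDerivAt (fun x => -(κ * t) + κ / 2 * x) (κ / 2) x := by
      simpa using ((hasDerivAt_id x).const_mul (κ / 2)).const_add (-(κ * t))
    refine (((h1.exp.const_mul (B * M)).const_mul (2 / κ)).const_add _).congr_deriv ?_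
    field_simp
  have hfence := image_norm_le_of_norm_deriv_right_le_deriv_boundary (f := φ) (a := 0) (b := t)
    (fun x _ => (hφ x).continuousAt.continuousWithinAt)
    (fun x _ => (hφ x).hasDerivWithinAt) (B := _) ?_ hbd ?_ (Set.right_mem_Icc.mpr ht)
  · simp only [φ, sub_self, periodicFlow_zero] at hfence
    refine hfence.trans ?_
    have h1 : -(κ * t) + κ / 2 * t = -(κ / 2 * t) := by ring
    rw [h1]
    have h2 : Real.exp (-(κ * t)) ≤ Real.exp (-(κ / 2 * t)) :=
      Real.exp_le_exp.mpr (by nlinarith)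
    have h3 : 0 ≤ 2 / κ := by positivity
    calc _ ≤ B * Real.exp (-(κ / 2 * t)) * ‖Z 0‖ + 2 / κ * (B * M * Real.exp (-(κ / 2 * t))) := by
          gcongr
      _ ≤ B * Real.exp (-(κ / 2 * t)) * ‖Z 0‖ + 2 / κ * (B * M * Real.exp (-(κ / 2 * t))) +
          (B * (2 / κ) * ‖Z 0‖ + B * M) * Real.exp (-(κ / 2 * t)) :=
          le_add_of_nonneg_right (by positivity)
      _ = _ := by ring
  · simp only [φ, sub_zero]
    refine (hdecay _ hZ0 t ht).trans (le_add_of_nonneg_right (by positivity))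
  · intro x hx
    refine (hdecay _ (hf0 x) (t - x) (by linarith [hx.2])).trans ?_
    calc B * Real.exp (-(κ * (t - x))) * ‖f x‖
        ≤ B * Real.exp (-(κ * (t - x))) * (M * Real.exp (-(κ / 2 * x))) := by
          gcongr; exact hf x hx.1
      _ = B * M * (Real.exp (-(κ * (t - x))) * Real.exp (-(κ / 2 * x))) := by ring
      _ = _ := by
          rw [← Real.exp_add]; congr 2; ring

/-- The coefficients of the backward shift `exp (-h ∂ₓ)`. -/
def shiftCoeff (n : ℕ) : ℝ := (-1) ^ n / n.factorial

/-- The expansion of the scheme in powers of `h ∂ₓ`, up to the order `p`. -/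
def chainOp (p : ℕ) : (Fin (p + 1) → Fin (p + 1) → ℝ) →ₗ[ℝ] (Fin (p + 1) → Fin (p + 1) → ℝ) :=
  LinearMap.pi fun m => upwind p ∘ₗ LinearMap.proj m +
    (∑ i ∈ Finset.univ.filter (· ≤ m),
      shiftCoeff ((m : ℕ) - i) • (evalAt p 1 ∘ₗ LinearMap.proj i)).smulRight (inflow p)

/-- A family of functions of the fast time that solves the expansion of the scheme in powers of
`h ∂ₓ` up to the order `p`. -/
def IsChain (p : ℕ) (z : ℕ → ℝ → Fin (p + 1) → ℝ) : Prop :=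
  ∀ m ≤ p, ∀ t, HasDerivAt (z m) (upwind p (z m t) +
    (∑ i ∈ Finset.range (m + 1), shiftCoeff (m - i) * evalAt p 1 (z i t)) • inflow p) t

theorem exists_isChain (p : ℕ) (Z₀ : ℕ → Fin (p + 1) → ℝ) :
    ∃ z : ℕ → ℝ → Fin (p + 1) → ℝ, IsChain p z ∧ ∀ m ≤ p, z m 0 = Z₀ m := by
  set A := LinearMap.toContinuousLinearMap (chainOp p)
  set W : ℝ → Fin (p + 1) → Fin (p + 1) → ℝ := fun t => NormedSpace.exp (t • A) (fun m => Z₀ m)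
  have hW : ∀ t, HasDerivAt W (chainOp p (W t)) t := fun t => by
    have h := hasDerivAt_exp_smul_const' (𝕂 := ℝ) A t
    exact (h.clm_apply (hasDerivAt_const t _)).congr_deriv (by simp [W, A])
  refine ⟨fun m t => if hm : m < p + 1 then W t ⟨m, hm⟩ else 0, fun m hm t => ?_, fun m hm => ?_⟩
  · have h := hasDerivAt_pi.mp (hW t) ⟨m, Nat.lt_succ_of_le hm⟩
    simp only [Nat.lt_succ_of_le hm, dif_pos]
    refine h.congr_deriv ?_
    simp only [chainOp, LinearMap.pi_apply, LinearMap.add_apply, LinearMap.comp_apply,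
      LinearMap.proj_apply, LinearMap.smulRight_apply, LinearMap.sum_apply, LinearMap.smul_apply,
      smul_eq_mul]
    congr 2
    refine Finset.sum_bij (fun i _ => (i : ℕ)) ?_ ?_ ?_ ?_
    · intro i hi
      simp only [Finset.mem_filter, Finset.mem_univ, true_and, Fin.le_def] at hi
      simpa [Nat.lt_succ_iff] using hi
    · intro i _ j _ hij
      exact Fin.ext hij
    · intro i hi
      rw [Finset.mem_range] at hi
      exact ⟨⟨i, by omega⟩, by simp [Fin.le_def]; omega, rfl⟩
    · intro i _
      simp [i.2]
  · simp only [Nat.lt_succ_of_le hm, dif_pos, W, zero_smul, NormedSpace.exp_zero]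
    rfl

/-- The coefficients of the dual smooth mode. -/
def dualMonomial (i : ℕ) : ℝ[X] := C ((-1) ^ i) * taylorMonomial i

theorem natDegree_dualMonomial_le (i : ℕ) : (dualMonomial i).natDegree ≤ i :=
  (natDegree_C_mul_le _ _).trans (natDegree_taylorMonomial_le i)

theorem eval_one_dualMonomial (i : ℕ) : (dualMonomial i).eval 1 = shiftCoeff i := by
  rw [dualMonomial, eval_mul, eval_taylorMonomial, shiftCoeff]; norm_num; rfl

theorem eval_neg_one_dualMonomial (i : ℕ) :
    (dualMonomial i).eval (-1) = if i = 0 then 1 else 0 := by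
  rw [dualMonomial, eval_mul, eval_taylorMonomial]
  by_cases h : i = 0 <;> simp [h]

theorem derivative_dualMonomial_succ (i : ℕ) :
    derivative (dualMonomial (i + 1)) = C (-1 / 2) * dualMonomial i := by
  rw [dualMonomial, dualMonomial, taylorMonomial_succ, derivative_C_mul, derivative_C_mul,
    derivative_primitive, ← mul_assoc, ← mul_assoc, ← C_mul, ← C_mul]
  congr 2; ring

theorem dualMonomial_zero : dualMonomial 0 = 1 := by simp [dualMonomial, taylorMonomial]

/-- The pairing of a cell polynomial with the coefficients of the dual mode. -/
def dualPairing (p i : ℕ) : (Fin (p + 1) → ℝ) →ₗ[ℝ] ℝ :=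
  integralPoly ∘ₗ (LinearMap.mulRight ℝ (dualMonomial i)) ∘ₗ toPoly p

theorem dualPairing_apply (p i : ℕ) (v : Fin (p + 1) → ℝ) :
    dualPairing p i v = integralPoly (toPoly p v * dualMonomial i) := rfl

theorem dualPairing_zero (p : ℕ) (v : Fin (p + 1) → ℝ) : dualPairing p 0 v = 2 * v 0 := by
  rw [dualPairing_apply, dualMonomial_zero, mul_one, two_mul_apply_zero]

/-- The inflow enters only for `i = 0`, since the other dual monomials vanish at `-1`. The test
functions of the scheme have degree at most `p`, which is why the expansion stops at order `p`. -/
theorem dualPairing_upwind {p i : ℕ} (hi : i ≤ p) (v : Fin (p + 1) → ℝ) (y : ℝ) :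
    dualPairing p i (upwind p v + y • inflow p) =
      2 * integralPoly (toPoly p v * derivative (dualMonomial i)) -
        2 * (shiftCoeff i * evalAt p 1 v) + if i = 0 then 2 * y else 0 := by
  have hd := (natDegree_dualMonomial_le i).trans hi
  rw [map_add, map_smul, dualPairing_apply, dualPairing_apply,
    integralPoly_toPoly_upwind_mul p v hd, integralPoly_toPoly_inflow_mul p hd,
    eval_one_dualMonomial, eval_neg_one_dualMonomial, evalAt_apply, smul_eq_mul]
  split_ifs <;> ring

/-- The coefficient of order `m` in the pairing of a chain with the dual mode. -/
def chainPairing (p : ℕ) (z : ℕ → Fin (p + 1) → ℝ) (m : ℕ) : ℝ :=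
  ∑ n ∈ Finset.range (m + 1), dualPairing p (m - n) (z n)

/-- The dual mode takes at `1` the coefficients of the backward shift, so its outflow terms cancel
the inflow from the neighbouring cell. What remains is the derivative of the mode, which lowers the
order by one: the pairing is transported exactly. -/
theorem IsChain.hasDerivAt_chainPairing {p : ℕ} {z : ℕ → ℝ → Fin (p + 1) → ℝ} (hz : IsChain p z)
    {m : ℕ} (hm : m ≤ p) (t : ℝ) :
    HasDerivAt (fun t => chainPairing p (fun n => z n t) m)
      (-(if m = 0 then 0 else chainPairing p (fun n => z n t) (m - 1))) t := by
  have h1 := HasDerivAt.fun_sum (u := Finset.range (m + 1))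
    (A := fun n t => dualPairing p (m - n) (z n t)) (fun n hn =>
      hasDerivAt_linearMap_comp (dualPairing p (m - n))
        (hz n ((Nat.lt_succ_iff.mp (Finset.mem_range.mp hn)).trans hm) t))
  refine h1.congr_deriv ?_
  rw [Finset.sum_congr rfl fun n _ => dualPairing_upwind (by omega) (z n t) _,
    Finset.sum_add_distrib, Finset.sum_sub_distrib, ← Finset.mul_sum, ← Finset.mul_sum]
  have h2 : ∑ n ∈ Finset.range (m + 1), (if m - n = 0 then
      2 * ∑ i ∈ Finset.range (n + 1), shiftCoeff (n - i) * evalAt p 1 (z i t) else 0) =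
      2 * ∑ i ∈ Finset.range (m + 1), shiftCoeff (m - i) * evalAt p 1 (z i t) := by
    rw [Finset.sum_range_succ, Finset.sum_eq_zero, zero_add, Nat.sub_self, if_pos rfl]
    intro n hn
    rw [Finset.mem_range] at hn
    rw [if_neg (by omega)]
  rw [h2, sub_add_cancel, Finset.sum_range_succ, Nat.sub_self, dualMonomial_zero, derivative_one,
    mul_zero, map_zero, add_zero]
  cases m with
  | zero => simp
  | succ m =>
    rw [if_neg m.succ_ne_zero, Nat.add_sub_cancel, chainPairing, Finset.mul_sum,
      ← Finset.sum_neg_distrib]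
    refine Finset.sum_congr rfl fun n hn => ?_
    rw [Finset.mem_range] at hn
    rw [show m + 1 - n = (m - n) + 1 by omega, derivative_dualMonomial_succ, mul_left_comm,
      integralPoly_C_mul, dualPairing_apply]
    ring

theorem IsChain.chainPairing_eq_zero {p : ℕ} {z : ℕ → ℝ → Fin (p + 1) → ℝ} (hz : IsChain p z)
    (h0 : ∀ m ≤ p, chainPairing p (fun n => z n 0) m = 0) {m : ℕ} (hm : m ≤ p) (t : ℝ) :
    chainPairing p (fun n => z n t) m = 0 := by
  induction m generalizing t with
  | zero =>
    have h1 := fun t => hz.hasDerivAt_chainPairing hm t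
    simp only [if_true, neg_zero] at h1
    rw [is_const_of_deriv_eq_zero (fun t => (h1 t).differentiableAt) (fun t => (h1 t).deriv) t 0]
    exact h0 0 hm
  | succ m ih =>
    have h1 := fun t => hz.hasDerivAt_chainPairing hm t
    simp only [Nat.succ_ne_zero, if_false, Nat.add_sub_cancel, ih (by omega), neg_zero] at h1
    rw [is_const_of_deriv_eq_zero (fun t => (h1 t).differentiableAt) (fun t => (h1 t).deriv) t 0]
    exact h0 _ hm

theorem exists_linearMap_bound {V F : Type*} [NormedAddCommGroup V] [NormedSpace ℝ V]
    [FiniteDimensional ℝ V] [NormedAddCommGroup F] [NormedSpace ℝ F] (l : V →ₗ[ℝ] F) :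
    ∃ B : ℝ, 0 ≤ B ∧ ∀ v, ‖l v‖ ≤ B * ‖v‖ :=
  ⟨‖LinearMap.toContinuousLinearMap l‖, norm_nonneg _,
    fun v => (LinearMap.toContinuousLinearMap l).le_opNorm v⟩

theorem coefL_one_apply_zero (p : ℕ) : coefL p 1 0 = 1 := by
  have h := two_mul_apply_zero p (coefL p 1)
  rw [toPoly_coefL p (by simp), ← C_1, integralPoly_C] at h
  rw [← C_1]
  linarith

theorem periodicOp_coefL_one (p : ℕ) : periodicOp p (coefL p 1) = 0 := by
  rw [periodicOp_apply, upwind_coefL_profile_zero, evalAt_apply, toPoly_coefL p (by simp)]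
  simp

/-- Chains that are orthogonal to the dual mode decay exponentially. -/
theorem exists_chain_decay (p : ℕ) :
    ∃ σ : ℝ, 0 < σ ∧ ∀ z : ℕ → ℝ → Fin (p + 1) → ℝ, IsChain p z →
      (∀ m ≤ p, chainPairing p (fun n => z n 0) m = 0) →
      ∀ m ≤ p, ∃ M : ℝ, 0 ≤ M ∧ ∀ t, 0 ≤ t → ‖z m t‖ ≤ M * Real.exp (-(σ * t)) := by
  obtain ⟨σ, B, hσ, hB, hduh⟩ := exists_duhamel_bound p
  refine ⟨σ, hσ, fun z hz h0 m => ?_⟩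
  induction m using Nat.strong_induction_on with
  | _ m ih =>
    intro hm
    have ih' : ∀ n, ∃ M : ℝ, 0 ≤ M ∧ (n < m → ∀ t, 0 ≤ t → ‖z n t‖ ≤ M * Real.exp (-(σ * t))) := by
      intro n
      by_cases hn : n < m
      · obtain ⟨M, hM, h⟩ := ih n hn (by omega)
        exact ⟨M, hM, fun _ => h⟩
      · exact ⟨0, le_rfl, fun h => absurd h hn⟩
    choose M hM0 hM using ih'
    choose D hD0 hD using fun i => exists_linearMap_bound (dualPairing p i)
    obtain ⟨E, hE0, hE⟩ := exists_linearMap_bound (evalAt p 1)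
    set e := coefL p 1 with he
    -- The vanishing pairing of order `m` contains twice the mean of `z m`; the rest involves lower
    -- orders, which decay already.
    have hmean : ∀ t, 0 ≤ t → |z m t 0| ≤
        (∑ n ∈ Finset.range m, D (m - n) * M n) * Real.exp (-(σ * t)) := by
      intro t ht
      have h1 := hz.chainPairing_eq_zero h0 hm t
      rw [chainPairing, Finset.sum_range_succ, Nat.sub_self, dualPairing_zero] at h1
      have h2 : |∑ n ∈ Finset.range m, dualPairing p (m - n) (z n t)| ≤
          (∑ n ∈ Finset.range m, D (m - n) * M n) * Real.exp (-(σ * t)) := by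
        rw [Finset.sum_mul]
        refine (Finset.abs_sum_le_sum_abs _ _).trans (Finset.sum_le_sum fun n hn => ?_)
        refine (hD (m - n) (z n t)).trans ?_
        rw [mul_assoc]
        exact mul_le_mul_of_nonneg_left (hM n (Finset.mem_range.mp hn) t ht) (hD0 _)
      have h3 : z m t 0 = -(1 / 2) * ∑ n ∈ Finset.range m, dualPairing p (m - n) (z n t) := by
        linarith
      rw [h3, abs_mul]
      refine le_trans ?_ h2
      exact mul_le_of_le_one_left (abs_nonneg _) (by norm_num [abs_of_neg])
    -- The term `i = m` of the inflow closes the cell periodically; the lower orders form a decaying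
    -- source.
    set G : ℝ → ℝ := fun t => ∑ i ∈ Finset.range m, shiftCoeff (m - i) * evalAt p 1 (z i t) with hG
    have hGb : ∀ t, 0 ≤ t → |G t| ≤
        (∑ i ∈ Finset.range m, |shiftCoeff (m - i)| * (E * M i)) * Real.exp (-(σ * t)) := by
      intro t ht
      rw [Finset.sum_mul]
      refine (Finset.abs_sum_le_sum_abs _ _).trans (Finset.sum_le_sum fun i hi => ?_)
      rw [abs_mul, mul_assoc, mul_assoc]
      refine mul_le_mul_of_nonneg_left ((hE (z i t)).trans ?_) (abs_nonneg _)
      exact mul_le_mul_of_nonneg_left (hM i (Finset.mem_range.mp hi) t ht) hE0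
    have hzd : ∀ t, HasDerivAt (z m) (periodicOp p (z m t) + G t • inflow p) t := by
      intro t
      refine (hz m hm t).congr_deriv ?_
      rw [Finset.sum_range_succ, Nat.sub_self, periodicOp_apply, add_smul]
      simp only [shiftCoeff, pow_zero, Nat.factorial_zero, Nat.cast_one, div_one, one_mul, hG]
      abel
    -- Constants are stationary for `periodicOp`, so removing the mean leaves a mean-free problem
    -- for Duhamel's bound.
    set f := inflow p - inflow p 0 • e with hf
    have hfd : ∀ t, HasDerivAt (fun t => z m t - z m t 0 • e)
        (periodicOp p (z m t - z m t 0 • e) + G t • f) t := by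
      intro t
      have h1 := hasDerivAt_pi.mp (hzd t) 0
      refine ((hzd t).sub (h1.smul_const e)).congr_deriv ?_
      rw [map_sub, map_smul, he, periodicOp_coefL_one, Pi.add_apply, periodicOp_apply_zero, hf, he]
      simp only [Pi.smul_apply, smul_eq_mul]
      module
    have he0 : e 0 = 1 := coefL_one_apply_zero p
    have h1 := hduh (fun t => z m t - z m t 0 • e) (fun t => G t • f)
      ((∑ i ∈ Finset.range m, |shiftCoeff (m - i)| * (E * M i)) * ‖f‖) hfd
      (by simp [he0]) (fun t => by simp [hf, he0]) (fun t ht => by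
        rw [norm_smul, mul_right_comm]
        exact mul_le_mul_of_nonneg_right (hGb t ht) (norm_nonneg _))
    refine ⟨B * (‖z m 0 - z m 0 0 • e‖ +
      (∑ i ∈ Finset.range m, |shiftCoeff (m - i)| * (E * M i)) * ‖f‖) +
      (∑ n ∈ Finset.range m, D (m - n) * M n) * ‖e‖, ?_, fun t ht => ?_⟩
    · have h2 : 0 ≤ ∑ i ∈ Finset.range m, |shiftCoeff (m - i)| * (E * M i) :=
        Finset.sum_nonneg fun i _ => mul_nonneg (abs_nonneg _) (mul_nonneg hE0 (hM0 i))
      have h3 : 0 ≤ ∑ n ∈ Finset.range m, D (m - n) * M n :=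
        Finset.sum_nonneg fun i _ => mul_nonneg (hD0 _) (hM0 i)
      positivity
    · calc ‖z m t‖ = ‖(z m t - z m t 0 • e) + z m t 0 • e‖ := by rw [sub_add_cancel]
        _ ≤ ‖z m t - z m t 0 • e‖ + ‖z m t 0 • e‖ := norm_add_le _ _
        _ ≤ _ := add_le_add (h1 t ht) ((norm_smul_le _ _).trans
            (mul_le_mul_of_nonneg_right (hmean t ht) (norm_nonneg e)))
        _ = _ := by rw [add_mul]; congr 1; ring

/-- The system is a Cauchy product, solved by dividing formal power series; leading zeros of `b`
pass to the quotient. -/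
theorem exists_triangular_solution {μ : ℕ → ℝ} (hμ : μ 0 ≠ 0) (b : ℕ → ℝ) :
    ∃ c : ℕ → ℝ, (∀ m, ∑ n ∈ Finset.range (m + 1), μ (m - n) * c n = b m) ∧
      ∀ k, (∀ m < k, b m = 0) → ∀ m < k, c m = 0 := by
  set φ : PowerSeries ℝ := PowerSeries.mk μ
  have hφ : PowerSeries.constantCoeff φ ≠ 0 := by
    rw [← PowerSeries.coeff_zero_eq_constantCoeff_apply, PowerSeries.coeff_mk]; exact hμ
  set ψ : PowerSeries ℝ := PowerSeries.mk b * φ⁻¹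
  have hψ : ψ * φ = PowerSeries.mk b := by
    rw [mul_assoc, PowerSeries.inv_mul_cancel _ hφ, mul_one]
  have hc : ∀ m, ∑ n ∈ Finset.range (m + 1), μ (m - n) * PowerSeries.coeff n ψ = b m := by
    intro m
    have h := congrArg (PowerSeries.coeff m) hψ
    rw [PowerSeries.coeff_mk, PowerSeries.coeff_mul,
      Finset.Nat.sum_antidiagonal_eq_sum_range_succ
        (fun i j => PowerSeries.coeff i ψ * PowerSeries.coeff j φ)] at h
    rw [← h]
    exact Finset.sum_congr rfl fun n _ => by rw [PowerSeries.coeff_mk, mul_comm]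
  refine ⟨fun m => PowerSeries.coeff m ψ, hc, fun k hk m => ?_⟩
  induction m using Nat.strong_induction_on with
  | _ m ih =>
    intro hm
    have h := hc m
    rw [Finset.sum_range_succ, hk m hm, Finset.sum_eq_zero, zero_add, Nat.sub_self] at h
    · exact (mul_eq_zero.mp h).resolve_left hμ
    · intro n hn
      rw [Finset.mem_range] at hn
      have := ih n hn (by omega)
      simp only at this
      rw [this, mul_zero]

/-- For every Legendre polynomial there is an exponentially decaying chain that starts from it, up
to constants of the order of its degree. -/
theorem exists_transient (p : ℕ) :
    ∃ σ : ℝ, 0 < σ ∧ ∃ (z : ℕ → ℕ → ℝ → Fin (p + 1) → ℝ) (c : ℕ → ℕ → ℝ) (M : ℝ), 0 ≤ M ∧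
      ∀ k ≤ p, IsChain p (z k) ∧ (∀ m < k, c k m = 0) ∧
        (∀ m ≤ p, z k m 0 = (if m = 0 then coefL p (legendre k) else 0) - c k m • coefL p 1) ∧
        ∀ m ≤ p, ∀ t, 0 ≤ t → ‖z k m t‖ ≤ M * Real.exp (-(σ * t)) := by
  obtain ⟨σ, hσ, hdecay⟩ := exists_chain_decay p
  refine ⟨σ, hσ, ?_⟩
  have hμ : dualPairing p 0 (coefL p 1) ≠ 0 := by
    rw [dualPairing_zero, coefL_one_apply_zero]; norm_num
  -- The constants are chosen so that `P_k` minus them has zero pairing with the dual mode at every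
  -- order up to `p`.
  choose c hc hc0 using fun k => exists_triangular_solution
    (μ := fun i => dualPairing p i (coefL p 1)) hμ
    (fun m => dualPairing p m (coefL p (legendre k)))
  choose z hz hz0 using fun k => exists_isChain p fun m =>
    (if m = 0 then coefL p (legendre k) else 0) - c k m • coefL p 1
  have hpair : ∀ k, ∀ m ≤ p, chainPairing p (fun n => z k n 0) m = 0 := by
    intro k m hm
    have h1 : ∀ n ∈ Finset.range (m + 1), dualPairing p (m - n) (z k n 0) =
        (if n = 0 then dualPairing p m (coefL p (legendre k)) else 0) -
          dualPairing p (m - n) (coefL p 1) * c k n := by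
      intro n hn
      rw [Finset.mem_range] at hn
      rw [hz0 k n (by omega), map_sub, map_smul, smul_eq_mul, mul_comm]
      congr 1
      split_ifs with h
      · rw [h, Nat.sub_zero]
      · rw [map_zero]
    rw [chainPairing, Finset.sum_congr rfl h1, Finset.sum_sub_distrib, hc k m,
      Finset.sum_ite_eq' (Finset.range (m + 1)) 0, if_pos (by simp), sub_self]
  have hM : ∀ k m, ∃ M : ℝ, 0 ≤ M ∧
      (m ≤ p → ∀ t, 0 ≤ t → ‖z k m t‖ ≤ M * Real.exp (-(σ * t))) := by
    intro k m
    by_cases hm : m ≤ p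
    · obtain ⟨M, hM, h⟩ := hdecay (z k) (hz k) (hpair k) m hm
      exact ⟨M, hM, fun _ => h⟩
    · exact ⟨0, le_rfl, fun h => absurd h hm⟩
  choose M hM0 hM using hM
  refine ⟨z, c, ∑ k ∈ Finset.range (p + 1), ∑ m ∈ Finset.range (p + 1), M k m,
    Finset.sum_nonneg fun k _ => Finset.sum_nonneg fun m _ => hM0 k m, fun k hk =>
    ⟨hz k, hc0 k k fun m hm => ?_, hz0 k, fun m hm t ht => (hM k m hm t ht).trans ?_⟩⟩
  -- The dual monomial of order `m` has degree at most `m < k`, so `P_k` does not see it: the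
  -- remnant that fails to decay starts at order `h ^ k`.
  · rw [dualPairing_apply, toPoly_coefL p ((natDegree_legendre_le k).trans hk)]
    refine integralPoly_legendre_mul_eq_zero (degree_le_natDegree.trans_lt ?_)
    exact_mod_cast (natDegree_dualMonomial_le m).trans_lt hm
  · refine mul_le_mul_of_nonneg_right ?_ (Real.exp_nonneg _)
    have h1 : M k m ≤ ∑ m ∈ Finset.range (p + 1), M k m :=
      Finset.single_le_sum (f := fun m => M k m) (fun m _ => hM0 k m)
        (Finset.mem_range.mpr (Nat.lt_succ_of_le hm))
    exact h1.trans (Finset.single_le_sum (f := fun k => ∑ m ∈ Finset.range (p + 1), M k m)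
      (fun k _ => Finset.sum_nonneg fun m _ => hM0 k m)
      (Finset.mem_range.mpr (Nat.lt_succ_of_le hk)))

/-! ### Taylor expansion of smooth functions with bounded derivatives -/

theorem abs_sub_le_of_hasDerivAt {f f' : ℝ → ℝ} {B : ℝ} (hf : ∀ x, HasDerivAt f (f' x) x)
    (hB : ∀ x, |f' x| ≤ B) (x y : ℝ) : |f y - f x| ≤ B * |y - x| :=
  Convex.norm_image_sub_le_of_norm_hasDerivWithin_le (s := Set.univ)
    (fun x _ => (hf x).hasDerivWithinAt) (fun x _ => hB x) convex_univ (Set.mem_univ x)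
    (Set.mem_univ y)

/-- The sequence of the derivatives of a smooth function. -/
def IsDerivFamily (D : ℕ → ℝ → ℝ) : Prop := ∀ i x, HasDerivAt (D i) (D (i + 1) x) x

theorem IsDerivFamily.shift {D : ℕ → ℝ → ℝ} (hD : IsDerivFamily D) (k : ℕ) :
    IsDerivFamily (fun i => D (i + k)) := fun i x => by
  have := hD (i + k) x
  rwa [show i + k + 1 = i + 1 + k by ring] at this

/-- The remainder of the Taylor polynomial of degree `n` at `x` with increment `d`. -/
def taylorRem (D : ℕ → ℝ → ℝ) (n : ℕ) (x d : ℝ) : ℝ :=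
  D 0 (x + d) - ∑ i ∈ Finset.range (n + 1), d ^ i / i.factorial * D i x

theorem IsDerivFamily.hasDerivAt_taylorRem {D : ℕ → ℝ → ℝ} (hD : IsDerivFamily D) (n : ℕ)
    (x d : ℝ) : HasDerivAt (fun x => taylorRem D n x d) (taylorRem (fun i => D (i + 1)) n x d) x :=
  ((hD 0 (x + d)).comp_add_const x d).sub
    (HasDerivAt.fun_sum fun i _ => (hD i x).const_mul _)

theorem IsDerivFamily.hasDerivAt_taylorRem_increment {D : ℕ → ℝ → ℝ} (hD : IsDerivFamily D)
    (n : ℕ) (x d : ℝ) :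
    HasDerivAt (fun d => taylorRem D (n + 1) x d) (taylorRem (fun i => D (i + 1)) n x d) d := by
  have h1 : ∀ i ∈ Finset.range (n + 1), HasDerivAt
      (fun d : ℝ => d ^ (i + 1) / (i + 1).factorial * D (i + 1) x)
      (d ^ i / i.factorial * D (i + 1) x) d := fun i _ => by
    refine (((hasDerivAt_pow (i + 1) d).div_const _).mul_const _).congr_deriv ?_
    rw [Nat.factorial_succ]
    push_cast
    have : (i.factorial : ℝ) ≠ 0 := by exact_mod_cast i.factorial_ne_zero
    field_simp
  have h2 := ((hD 0 (x + d)).comp_const_add x d).sub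
    ((HasDerivAt.fun_sum h1).add_const (D 0 x))
  refine (h2.congr_deriv rfl).congr_of_eventuallyEq (Filter.Eventually.of_forall fun d => ?_)
  simp [taylorRem, Finset.sum_range_succ' _ (n + 1)]

theorem IsDerivFamily.abs_taylorRem_le {D : ℕ → ℝ → ℝ} (hD : IsDerivFamily D) (n : ℕ) {B : ℝ}
    (hB : ∀ x, |D (n + 1) x| ≤ B) (x d : ℝ) : |taylorRem D n x d| ≤ B * |d| ^ (n + 1) := by
  induction n generalizing D d with
  | zero =>
    have := abs_sub_le_of_hasDerivAt (hD 0) hB x (x + d)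
    simpa [taylorRem] using this
  | succ n ih =>
    have h0 : taylorRem D (n + 1) x 0 = 0 := by
      simp [taylorRem, Finset.sum_range_succ' _ (n + 1)]
    have h1 := Convex.norm_image_sub_le_of_norm_hasDerivWithin_le
      (f := fun d => taylorRem D (n + 1) x d) (f' := fun d => taylorRem (fun i => D (i + 1)) n x d)
      (s := Metric.closedBall (0 : ℝ) |d|) (x := 0) (y := d) (C := B * |d| ^ (n + 1))
      (fun s _ => (hD.hasDerivAt_taylorRem_increment n x s).hasDerivWithinAt)
      (fun s hs => by
        have hs' : |s| ≤ |d| := by simpa using hs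
        have hB0 : 0 ≤ B := (abs_nonneg _).trans (hB 0)
        refine (ih (hD.shift 1) hB s).trans ?_
        gcongr) (convex_closedBall _ _) (by simp) (by simp)
    rw [h0, sub_zero, sub_zero, Real.norm_eq_abs, Real.norm_eq_abs] at h1
    rw [pow_succ, ← mul_assoc]
    exact h1

theorem isDerivFamily_iteratedDeriv {g : ℝ → ℝ} (hg : ContDiff ℝ ∞ g) :
    IsDerivFamily (fun i => iteratedDeriv i g) := fun i x => by
  have h : ContDiff ℝ ∞ (iteratedDeriv i g) := by
    rw [iteratedDeriv_eq_iterate]; exact ContDiff.iterate_deriv i hg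
  have h2 := (h.differentiable (by simp) x).hasDerivAt
  rwa [← iteratedDeriv_succ] at h2

theorem periodic_iteratedDeriv {g : ℝ → ℝ} {L : ℝ} (hp : Function.Periodic g L) (i : ℕ) :
    Function.Periodic (iteratedDeriv i g) L := fun x => by
  have h := congrFun (iteratedDeriv_comp_add_const i g L) x
  rw [← h, show (fun z => g (z + L)) = g from funext hp]

theorem exists_abs_le_of_periodic {f : ℝ → ℝ} {L : ℝ} (hL : 0 < L) (hf : Continuous f)
    (hp : Function.Periodic f L) : ∃ B : ℝ, 0 ≤ B ∧ ∀ x, |f x| ≤ B := by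
  obtain ⟨B, hB⟩ := isCompact_Icc.exists_bound_of_continuousOn (s := Set.Icc 0 L) hf.continuousOn
  refine ⟨B, (norm_nonneg _).trans (hB 0 ⟨le_rfl, hL.le⟩), fun x => ?_⟩
  obtain ⟨y, hy, hxy⟩ := hp.exists_mem_Ico₀ hL x
  rw [hxy]
  exact hB y (Set.Ico_subset_Icc_self hy)

/-! ### The exact solution -/

theorem IsSmoothPeriodicSolution.contDiff_initial {a L : ℝ} {u : ℝ → ℝ → ℝ}
    (hu : IsSmoothPeriodicSolution a L u) : ContDiff ℝ ∞ (fun x => u x 0) := by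
  rw [← contDiffOn_univ]
  exact hu.smooth.comp (f := fun x : ℝ => (x, (0 : ℝ)))
    (contDiff_id.prodMk contDiff_const).contDiffOn (fun x _ => by simp)

/-- The derivative along a characteristic vanishes at positive times, where the equation holds;
continuity suffices at `t = 0` for the mean value theorem. -/
theorem IsSmoothPeriodicSolution.eq_transport {a L : ℝ} {u : ℝ → ℝ → ℝ}
    (hu : IsSmoothPeriodicSolution a L u) (x : ℝ) {t : ℝ} (ht : 0 ≤ t) :
    u x t = u (x - a * t) 0 := by
  rcases ht.eq_or_lt with rfl | ht
  · simp
  have hcont : ContinuousOn (fun s => Function.uncurry u (x - a * t + a * s, s)) (Set.Icc 0 t) :=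
    hu.smooth.continuousOn.comp (f := fun s : ℝ => (x - a * t + a * s, s))
      (by fun_prop) (fun s hs => by simpa using hs.1)
  have hder : ∀ s ∈ Set.Ioo 0 t,
      HasDerivAt (fun s => Function.uncurry u (x - a * t + a * s, s)) 0 s := by
    intro s hs
    set y := x - a * t + a * s
    have hnhds : (Set.univ : Set ℝ) ×ˢ Set.Ici (0 : ℝ) ∈ nhds (y, s) :=
      prod_mem_nhds Filter.univ_mem (Ici_mem_nhds hs.1)
    have hd : HasFDerivAt (Function.uncurry u) (fderiv ℝ (Function.uncurry u) (y, s)) (y, s) :=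
      ((hu.smooth.contDiffAt hnhds).differentiableAt (by simp)).hasFDerivAt
    set A := fderiv ℝ (Function.uncurry u) (y, s)
    have h1 : HasDerivAt (fun r => u y r) (A (0, 1)) s :=
      hd.comp_hasDerivAt s ((hasDerivAt_const s y).prodMk (hasDerivAt_id s))
    have h2 : HasDerivAt (fun r => u r s) (A (1, 0)) y :=
      HasFDerivAt.comp_hasDerivAt (f := fun r : ℝ => (r, s)) y hd
        ((hasDerivAt_id y).prodMk (hasDerivAt_const y s))
    have h3 := hu.pde y s hs.1
    rw [h1.deriv, h2.deriv] at h3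
    have h4 : HasDerivAt (fun s => x - a * t + a * s) a s := by
      simpa using ((hasDerivAt_id s).const_mul a).const_add (x - a * t)
    have h5 := HasFDerivAt.comp_hasDerivAt (f := fun s : ℝ => (x - a * t + a * s, s)) s hd
      (h4.prodMk (hasDerivAt_id s))
    refine h5.congr_deriv ?_
    rw [show ((a, 1) : ℝ × ℝ) = (0, 1) + a • (1, 0) by simp, map_add, map_smul, smul_eq_mul, h3]
  obtain ⟨c, _, hc⟩ := exists_hasDerivAt_eq_slope _ _ ht hcont hder
  have h6 := (eq_div_iff (by linarith : t - 0 ≠ 0)).mp hc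
  simp only [Function.uncurry_apply_pair, zero_mul, mul_zero, add_zero, sub_add_cancel] at h6
  linarith

theorem IsSmoothPeriodicSolution.periodic_initial {a L : ℝ} {u : ℝ → ℝ → ℝ}
    (hu : IsSmoothPeriodicSolution a L u) : Function.Periodic (fun x => u x 0) L :=
  fun x => hu.periodic x 0 le_rfl

/-! ### The mesh -/

/-- The left end of a cell. -/
def node (x₀ L : ℝ) (N : ℕ) (j : ZMod N) : ℝ := x₀ + (j.val : ℝ) * (L / N)

/-- Reducing an index modulo `N` moves the node by a multiple of `L`. So the left neighbour in `ZMod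
N` is, for periodic functions, a shift by `-h`, also across the seam. -/
theorem periodic_node_intCast {α : Type*} {f : ℝ → α} {L : ℝ} (hf : Function.Periodic f L)
    (x₀ : ℝ) {N : ℕ} (hN : 0 < N) (n : ℤ) (y : ℝ) :
    f (node x₀ L N (n : ZMod N) + y) = f (x₀ + n * (L / N) + y) := by
  have : NeZero N := ⟨hN.ne'⟩
  have hN' : (N : ℝ) ≠ 0 := by exact_mod_cast hN.ne'
  have h1 : (((n : ZMod N).val : ℤ) : ℝ) = n - N * (n / (N : ℤ) : ℤ) := by
    rw [ZMod.val_intCast]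
    have := Int.emod_add_mul_ediv n N
    have h2 : ((n % (N : ℤ) + N * (n / (N : ℤ)) : ℤ) : ℝ) = n := by rw [this]
    push_cast at h2 ⊢
    linarith
  have h3 : node x₀ L N (n : ZMod N) + y = x₀ + n * (L / N) + y - (n / (N : ℤ) : ℤ) * L := by
    rw [node, show (((n : ZMod N).val : ℕ) : ℝ) = (((n : ZMod N).val : ℤ) : ℝ) by simp, h1]
    field_simp
    ring
  rw [h3, hf.sub_int_mul_eq]

theorem periodic_node_sub_one {α : Type*} {f : ℝ → α} {L : ℝ} (hf : Function.Periodic f L)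
    (x₀ : ℝ) {N : ℕ} (hN : 0 < N) (j : ZMod N) (y : ℝ) :
    f (node x₀ L N (j - 1) + y) = f (node x₀ L N j - L / N + y) := by
  have : NeZero N := ⟨hN.ne'⟩
  have h := periodic_node_intCast hf x₀ hN ((j.val : ℤ) - 1) y
  have h1 : (((j.val : ℤ) - 1 : ℤ) : ZMod N) = j - 1 := by simp
  rw [h1] at h
  rw [h, node]
  congr 1
  push_cast
  ring

/-! ### Finite-dimensional spaces of smooth functions on the mesh -/

/-- `g` factors through the range of `f`, and a linear map on this finite-dimensional space is
bounded. -/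
theorem exists_norm_le_of_ker_le {E F G : Type*} [NormedAddCommGroup E] [NormedSpace ℝ E]
    [FiniteDimensional ℝ E] [NormedAddCommGroup F] [NormedSpace ℝ F] [NormedAddCommGroup G]
    [NormedSpace ℝ G] (f : E →ₗ[ℝ] F) (g : E →ₗ[ℝ] G)
    (h : LinearMap.ker f ≤ LinearMap.ker g) : ∃ B : ℝ, 0 ≤ B ∧ ∀ x, ‖g x‖ ≤ B * ‖f x‖ := by
  obtain ⟨B, hB, hle⟩ := exists_linearMap_bound
    (((LinearMap.ker f).liftQ g h) ∘ₗ f.quotKerEquivRange.symm.toLinearMap)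
  refine ⟨B, hB, fun x => ?_⟩
  have := hle ⟨f x, LinearMap.mem_range_self f x⟩
  rw [LinearMap.comp_apply, LinearEquiv.coe_coe, LinearMap.quotKerEquivRange_symm_apply_image,
    Submodule.mkQ_apply, Submodule.liftQ_apply] at this
  exact this

/-- Linear combinations of the derivatives of a function. -/
def derivComb {n : ℕ} (D : ℕ → ℝ → ℝ) (b : Fin n → ℝ) (i : ℕ) (x : ℝ) : ℝ :=
  ∑ m, b m * D (m + i) x

theorem IsDerivFamily.derivComb {D : ℕ → ℝ → ℝ} (hD : IsDerivFamily D) {n : ℕ} (b : Fin n → ℝ) :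
    IsDerivFamily (derivComb D b) := fun i x =>
  HasDerivAt.fun_sum fun m _ => (hD (m + i) x).const_mul (b m)

theorem periodic_derivComb {D : ℕ → ℝ → ℝ} {L : ℝ} (hp : ∀ i, Function.Periodic (D i) L) {n : ℕ}
    (b : Fin n → ℝ) (i : ℕ) : Function.Periodic (derivComb D b i) L := fun x => by
  simp only [derivComb, hp _ x]

/-- On a fine mesh, the maximum over the mesh controls all derivatives of linear combinations of a
fixed finite set of derivatives of a smooth periodic function. -/
theorem exists_derivComb_bound {D : ℕ → ℝ → ℝ} (hD : IsDerivFamily D) {L : ℝ} (hL : 0 < L)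
    (hp : ∀ i, Function.Periodic (D i) L) (x₀ : ℝ) (n I : ℕ) :
    ∃ (B : ℝ) (N₀ : ℕ), 0 ≤ B ∧ ∀ N : ℕ, 0 < N → N₀ ≤ N → ∀ (b : Fin n → ℝ) (S : ℝ),
      (∀ j : ZMod N, |derivComb D b 0 (node x₀ L N j)| ≤ S) →
        ∀ i ≤ I, ∀ x, |derivComb D b i x| ≤ B * S := by
  have hcont : ∀ i, Continuous (D i) := fun i =>
    continuous_iff_continuousAt.mpr fun x => (hD i x).continuousAt
  choose B hB0 hB using fun i => exists_abs_le_of_periodic hL (hcont i) (hp i)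
  set G : ℕ → BoundedContinuousFunction ℝ ℝ := fun i =>
    BoundedContinuousFunction.ofNormedAddCommGroup (D i) (hcont i) (B i) (hB i) with hG
  set F : ℕ → (Fin n → ℝ) →ₗ[ℝ] BoundedContinuousFunction ℝ ℝ := fun i =>
    ∑ m : Fin n, (LinearMap.proj m : (Fin n → ℝ) →ₗ[ℝ] ℝ).smulRight (G (m + i)) with hF
  have hFapp : ∀ i b x, F i b x = derivComb D b i x := by
    intro i b x
    simp [hF, hG, DGAdvection.derivComb]
  -- A combination that vanishes identically has vanishing derivatives. No independence of the
  -- derivatives is required.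
  have hker : ∀ i, LinearMap.ker (F 0) ≤ LinearMap.ker (F i) := by
    intro i b hb
    rw [LinearMap.mem_ker] at hb ⊢
    have h0 : ∀ i, ∀ x, derivComb D b i x = 0 := by
      intro i
      induction i with
      | zero => intro x; rw [← hFapp, hb]; rfl
      | succ i ih =>
        intro x
        have h1 := hD.derivComb b i x
        rw [show DGAdvection.derivComb D b i = fun _ => 0 from funext ih] at h1
        exact h1.unique (hasDerivAt_const x 0)
    ext x
    rw [hFapp, h0]; rfl
  choose C hC0 hC using fun i => exists_norm_le_of_ker_le (F 0) (F i) (hker i)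
  -- For such `N` the variation between two nodes is at most half the supremum and can be absorbed.
  obtain ⟨N₀, hN₀⟩ := exists_nat_ge (2 * L * C 1)
  refine ⟨∑ i ∈ Finset.range (I + 1), 2 * C i, N₀,
    Finset.sum_nonneg fun i _ => by have := hC0 i; positivity, fun N hN hNN b S hS i hi x => ?_⟩
  have hNr : (0 : ℝ) < N := by exact_mod_cast hN
  have : NeZero N := ⟨hN.ne'⟩
  have hS0 : 0 ≤ S := (abs_nonneg _).trans (hS 0)
  set h := L / N with hh
  have hh0 : 0 < h := by positivity
  have hhC : h * C 1 ≤ 1 / 2 := by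
    rw [hh, div_mul_eq_mul_div, div_le_iff₀ hNr]
    have : (N₀ : ℝ) ≤ N := by exact_mod_cast hNN
    linarith
  have habs : ∀ i x, |derivComb D b i x| ≤ ‖F i b‖ := fun i x => by
    rw [← hFapp]; exact (F i b).norm_coe_le_norm x
  have h0 : ‖F 0 b‖ ≤ S + h * C 1 * ‖F 0 b‖ := by
    rw [BoundedContinuousFunction.norm_le (by have := hC0 1; positivity)]
    intro x
    rw [hFapp, Real.norm_eq_abs]
    set k := ⌊(x - x₀) / h⌋ with hk
    have hk1 : (k : ℝ) * h ≤ x - x₀ := (le_div_iff₀ hh0).mp (Int.floor_le _)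
    have hk2 : x - x₀ < (k + 1) * h := (div_lt_iff₀ hh0).mp (Int.lt_floor_add_one _)
    have h1 := hS (k : ZMod N)
    have h2 := periodic_node_intCast (periodic_derivComb hp b 0) x₀ hN k 0
    rw [add_zero, add_zero] at h2
    rw [h2] at h1
    have h3 := abs_sub_le_of_hasDerivAt (hD.derivComb b 0) (habs 1) (x₀ + k * h) x
    have h4 : |x - (x₀ + k * h)| ≤ h := by rw [abs_le]; constructor <;> linarith
    have h5 : ‖F 1 b‖ * |x - (x₀ + k * h)| ≤ C 1 * ‖F 0 b‖ * h :=
      mul_le_mul (hC 1 b) h4 (abs_nonneg _) (mul_nonneg (hC0 1) (norm_nonneg _))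
    have h6 : |DGAdvection.derivComb D b 0 x| ≤ |DGAdvection.derivComb D b 0 (x₀ + k * h)| +
        |DGAdvection.derivComb D b 0 x - DGAdvection.derivComb D b 0 (x₀ + k * h)| := by
      have := abs_add_le (DGAdvection.derivComb D b 0 (x₀ + k * h))
        (DGAdvection.derivComb D b 0 x - DGAdvection.derivComb D b 0 (x₀ + k * h))
      rwa [add_sub_cancel] at this
    linarith
  have h1 : ‖F 0 b‖ ≤ 2 * S := by
    have := mul_le_mul_of_nonneg_right hhC (norm_nonneg (F 0 b))
    linarith
  calc |derivComb D b i x| ≤ C i * ‖F 0 b‖ := (habs i x).trans (hC i b)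
    _ ≤ C i * (2 * S) := mul_le_mul_of_nonneg_left h1 (hC0 i)
    _ = (2 * C i) * S := by ring
    _ ≤ _ := mul_le_mul_of_nonneg_right (Finset.single_le_sum (f := fun i => 2 * C i)
        (fun i _ => by have := hC0 i; positivity)
        (Finset.mem_range.mpr (Nat.lt_succ_of_le hi))) hS0

/-! ### The smooth part of the discrete solution -/

/-- The discrete profile that belongs to a smooth function, on a cell with the left end `y`. -/
def slowPart (p : ℕ) (G : ℕ → ℝ → ℝ) (h y : ℝ) : Fin (p + 1) → ℝ :=
  ∑ m ∈ Finset.range (2 * p + 2), (h ^ m * G m y) • coefL p (profile p m)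

/-- The residual of the discrete profile in the scheme, scaled by `h / a`. -/
def slowResidual (p : ℕ) (G : ℕ → ℝ → ℝ) (h y : ℝ) : Fin (p + 1) → ℝ :=
  (h ^ (2 * p + 2) * G (2 * p + 2) y) • coefL p (profile p (2 * p + 1)) -
    taylorRem G (2 * p + 1) (y - h) h • inflow p

theorem hasDerivAt_slowPart {p : ℕ} {G : ℕ → ℝ → ℝ} (hG : IsDerivFamily G) (h y : ℝ) :
    HasDerivAt (slowPart p G h) (slowPart p (fun i => G (i + 1)) h y) y :=
  HasDerivAt.fun_sum fun m _ => ((hG m y).const_mul (h ^ m)).smul_const _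

theorem hasDerivAt_slowResidual {p : ℕ} {G : ℕ → ℝ → ℝ} (hG : IsDerivFamily G) (h y : ℝ) :
    HasDerivAt (slowResidual p G h) (slowResidual p (fun i => G (i + 1)) h y) y :=
  (((hG _ y).const_mul (h ^ (2 * p + 2))).smul_const _).sub
    (((hG.hasDerivAt_taylorRem (2 * p + 1) (y - h) h).comp_sub_const y h).smul_const (inflow p))

theorem periodic_slowPart (p : ℕ) {G : ℕ → ℝ → ℝ} {L : ℝ} (hp : ∀ i, Function.Periodic (G i) L)
    (h : ℝ) : Function.Periodic (slowPart p G h) L := fun y => by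
  simp only [slowPart, hp _ y]

theorem periodic_slowResidual (p : ℕ) {G : ℕ → ℝ → ℝ} {L : ℝ}
    (hp : ∀ i, Function.Periodic (G i) L) (h : ℝ) :
    Function.Periodic (slowResidual p G h) L := fun y => by
  have h1 : ∀ i, G i (y + L - h) = G i (y - h) := fun i => by
    rw [← hp i (y - h)]; congr 1; ring
  have h2 : G 0 (y + L - h + h) = G 0 (y - h + h) := by
    rw [← hp 0 (y - h + h)]; congr 1; ring
  simp only [slowResidual, taylorRem, hp _ y, h1, h2]

theorem evalAt_one_slowPart (p : ℕ) (G : ℕ → ℝ → ℝ) (h y : ℝ) :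
    evalAt p 1 (slowPart p G h y) = G 0 (y + h) - taylorRem G (2 * p + 1) y h := by
  rw [taylorRem, sub_sub_cancel, slowPart, map_sum]
  refine Finset.sum_congr rfl fun m hm => ?_
  rw [Finset.mem_range] at hm
  rw [map_smul, evalAt_apply, toPoly_coefL p (natDegree_profile_le p m),
    eval_one_profile (by omega), smul_eq_mul]
  ring

/-- Lowering the profile index by one amounts to `-h ∂ₓ`, up to the top order. The lifting left by
the constant profile is balanced by the outflow of the left neighbour, a Taylor polynomial of `G 0`
about `y - h` with increment `h`. -/
theorem upwind_slowPart (p : ℕ) (G : ℕ → ℝ → ℝ) (h y : ℝ) :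
    upwind p (slowPart p G h y) + evalAt p 1 (slowPart p G h (y - h)) • inflow p =
      -(h • slowPart p (fun i => G (i + 1)) h y) + slowResidual p G h y := by
  have h1 : upwind p (slowPart p G h y) = -(G 0 y • inflow p) -
      ∑ m ∈ Finset.range (2 * p + 1), (h ^ (m + 1) * G (m + 1) y) • coefL p (profile p m) := by
    rw [slowPart, map_sum, Finset.sum_range_succ']
    simp only [map_smul, upwind_coefL_profile_succ]
    rw [show profile p 0 = 1 from rfl, upwind_coefL_profile_zero]
    simp only [smul_neg, Finset.sum_neg_distrib, pow_zero, one_mul]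
    abel
  have h2 : h • slowPart p (fun i => G (i + 1)) h y =
      (∑ m ∈ Finset.range (2 * p + 1), (h ^ (m + 1) * G (m + 1) y) • coefL p (profile p m)) +
        (h ^ (2 * p + 2) * G (2 * p + 2) y) • coefL p (profile p (2 * p + 1)) := by
    rw [slowPart, Finset.sum_range_succ, smul_add, Finset.smul_sum]
    congr 1
    · exact Finset.sum_congr rfl fun m _ => by rw [smul_smul]; congr 1; ring
    · rw [smul_smul]; congr 1; ring
  rw [h1, h2, evalAt_one_slowPart, slowResidual, sub_add_cancel]
  module

theorem norm_slowResidual_le {p : ℕ} {G : ℕ → ℝ → ℝ} (hG : IsDerivFamily G) {S : ℝ}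
    (hS : ∀ x, |G (2 * p + 2) x| ≤ S) {h : ℝ} (hh : 0 ≤ h) (y : ℝ) :
    ‖slowResidual p G h y‖ ≤
      (‖coefL p (profile p (2 * p + 1))‖ + ‖inflow p‖) * S * h ^ (2 * p + 2) := by
  have h1 := hG.abs_taylorRem_le (2 * p + 1) hS (y - h) h
  rw [abs_of_nonneg hh] at h1
  refine (norm_sub_le _ _).trans ?_
  rw [norm_smul, norm_smul, Real.norm_eq_abs, Real.norm_eq_abs, abs_mul,
    abs_of_nonneg (by positivity : 0 ≤ h ^ (2 * p + 2))]
  calc _ ≤ h ^ (2 * p + 2) * S * ‖coefL p (profile p (2 * p + 1))‖ +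
        S * h ^ (2 * p + 1 + 1) * ‖inflow p‖ := by
        gcongr; exact hS y
    _ = _ := by ring

theorem norm_sub_le_of_hasDerivAt {V : Type*} [NormedAddCommGroup V] [NormedSpace ℝ V]
    {f f' : ℝ → V} {B : ℝ} (hf : ∀ x, HasDerivAt f (f' x) x) (hB : ∀ x, ‖f' x‖ ≤ B) (x y : ℝ) :
    ‖f y - f x‖ ≤ B * |y - x| :=
  Convex.norm_image_sub_le_of_norm_hasDerivWithin_le (s := Set.univ)
    (fun x _ => (hf x).hasDerivWithinAt) (fun x _ => hB x) convex_univ (Set.mem_univ x)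
    (Set.mem_univ y)

theorem norm_slowResidual_sub_le {p : ℕ} {G : ℕ → ℝ → ℝ} (hG : IsDerivFamily G) {S : ℝ}
    (hS : ∀ x, |G (2 * p + 3) x| ≤ S) {h : ℝ} (hh : 0 ≤ h) (y : ℝ) :
    ‖slowResidual p G h y - slowResidual p G h (y - h)‖ ≤
      h * ((‖coefL p (profile p (2 * p + 1))‖ + ‖inflow p‖) * S * h ^ (2 * p + 2)) := by
  have h1 := norm_sub_le_of_hasDerivAt (fun x => hasDerivAt_slowResidual (p := p) hG h x)
    (fun x => norm_slowResidual_le (hG.shift 1) (fun x => hS x) hh x) (y - h) y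
  rwa [sub_sub_cancel, abs_of_nonneg hh, mul_comm] at h1

/-! ### The transient part of the discrete solution -/

/-- A combination of a chain with the derivatives of a function. -/
def transPart (p : ℕ) (w : ℕ → Fin (p + 1) → ℝ) (D : ℕ → ℝ → ℝ) (h x : ℝ) : Fin (p + 1) → ℝ :=
  ∑ m ∈ Finset.range (p + 1), (h ^ m * D m x) • w m

/-- The right-hand side of the equations of a chain. -/
def chainDeriv (p : ℕ) (w : ℕ → Fin (p + 1) → ℝ) (m : ℕ) : Fin (p + 1) → ℝ :=
  upwind p (w m) +
    (∑ i ∈ Finset.range (m + 1), shiftCoeff (m - i) * evalAt p 1 (w i)) • inflow p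

/-- The residual of a chain in the scheme, scaled by `h / a`. -/
def transResidual (p : ℕ) (w : ℕ → Fin (p + 1) → ℝ) (D : ℕ → ℝ → ℝ) (h x : ℝ) :
    Fin (p + 1) → ℝ :=
  (∑ i ∈ Finset.range (p + 1), h ^ i * evalAt p 1 (w i) *
    taylorRem (fun l => D (l + i)) (p - i) x (-h)) • inflow p

theorem sum_shiftCoeff_comm (p : ℕ) (e : ℕ → ℝ) (D : ℕ → ℝ) (h : ℝ) :
    ∑ m ∈ Finset.range (p + 1), h ^ m * D m *
        ∑ i ∈ Finset.range (m + 1), shiftCoeff (m - i) * e i =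
      ∑ i ∈ Finset.range (p + 1), h ^ i * e i *
        ∑ l ∈ Finset.range (p - i + 1), (-h) ^ l / l.factorial * D (l + i) := by
  have h1 := Finset.sum_Ico_Ico_comm 0 (p + 1)
    (fun i m => h ^ m * D m * (shiftCoeff (m - i) * e i))
  simp only [Finset.range_eq_Ico, Finset.mul_sum]
  rw [← h1]
  refine Finset.sum_congr rfl fun i hi => ?_
  rw [Finset.mem_Ico] at hi
  rw [Finset.sum_Ico_eq_sum_range, Finset.range_eq_Ico, show p + 1 - i = p - i + 1 by omega]
  refine Finset.sum_congr rfl fun l _ => ?_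
  rw [Nat.add_sub_cancel_left, shiftCoeff, add_comm i l, pow_add, neg_pow]
  ring

/-- The equations of a chain are the scheme with the backward shift expanded. Truncation leaves
Taylor remainders of order `p + 1 - i` weighted by `h ^ i`, all of total order `p + 1`. -/
theorem upwind_transPart (p : ℕ) (w : ℕ → Fin (p + 1) → ℝ) (D : ℕ → ℝ → ℝ) (h x : ℝ) :
    upwind p (transPart p w D h x) + evalAt p 1 (transPart p w D h (x - h)) • inflow p =
      transPart p (chainDeriv p w) D h x + transResidual p w D h x := by
  have h1 : transPart p (chainDeriv p w) D h x = upwind p (transPart p w D h x) +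
      (∑ m ∈ Finset.range (p + 1), h ^ m * D m x *
        ∑ i ∈ Finset.range (m + 1), shiftCoeff (m - i) * evalAt p 1 (w i)) • inflow p := by
    simp only [transPart, chainDeriv, smul_add, Finset.sum_add_distrib, map_sum, map_smul,
      smul_smul]
    rw [Finset.sum_smul]
  rw [h1, add_assoc, transResidual, ← add_smul, sum_shiftCoeff_comm p
    (fun i => evalAt p 1 (w i)) (fun m => D m x) h, ← Finset.sum_add_distrib]
  congr 2
  rw [transPart, map_sum]
  refine Finset.sum_congr rfl fun i _ => ?_
  rw [taylorRem, zero_add, map_smul, smul_eq_mul, ← sub_eq_add_neg]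
  ring

theorem abs_sum_range_le {n : ℕ} {f : ℕ → ℝ} {B : ℝ} (hf : ∀ i < n, |f i| ≤ B) :
    |∑ i ∈ Finset.range n, f i| ≤ n * B := by
  refine (Finset.abs_sum_le_sum_abs _ _).trans ((Finset.sum_le_card_nsmul _ _ B
    fun i hi => hf i (Finset.mem_range.mp hi)).trans ?_)
  simp

theorem norm_sum_range_le {V : Type*} [NormedAddCommGroup V] {n : ℕ} {f : ℕ → V} {B : ℝ}
    (hf : ∀ i < n, ‖f i‖ ≤ B) : ‖∑ i ∈ Finset.range n, f i‖ ≤ n * B := by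
  refine (norm_sum_le _ _).trans ((Finset.sum_le_card_nsmul _ _ B
    fun i hi => hf i (Finset.mem_range.mp hi)).trans ?_)
  simp

theorem norm_transResidual_le {p : ℕ} {Eb : ℝ} (hEb : ∀ v, ‖evalAt p 1 v‖ ≤ Eb * ‖v‖)
    (hEb0 : 0 ≤ Eb) {w : ℕ → Fin (p + 1) → ℝ} {W : ℝ} (hw : ∀ i ≤ p, ‖w i‖ ≤ W)
    {D : ℕ → ℝ → ℝ} (hD : IsDerivFamily D) {S : ℝ} (hS : ∀ x, |D (p + 1) x| ≤ S) {h : ℝ}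
    (hh : 0 ≤ h) (x : ℝ) :
    ‖transResidual p w D h x‖ ≤ ((p + 1 : ℕ) * (Eb * W * S * h ^ (p + 1))) * ‖inflow p‖ := by
  rw [transResidual, norm_smul]
  refine mul_le_mul_of_nonneg_right (abs_sum_range_le fun i hi => ?_) (norm_nonneg _)
  have h1 := (hD.shift i).abs_taylorRem_le (p - i) (B := S) (fun x => by
    rw [show p - i + 1 + i = p + 1 by omega]; exact hS x) x (-h)
  rw [abs_neg, abs_of_nonneg hh] at h1
  have h2 : |evalAt p 1 (w i)| ≤ Eb * W :=
    (hEb (w i)).trans (mul_le_mul_of_nonneg_left (hw i (by omega)) hEb0)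
  have h3 : 0 ≤ Eb * W := (abs_nonneg _).trans h2
  rw [abs_mul, abs_mul, abs_of_nonneg (by positivity : 0 ≤ h ^ i)]
  calc _ ≤ h ^ i * (Eb * W) * (S * h ^ (p - i + 1)) := by gcongr
    _ = Eb * W * S * (h ^ i * h ^ (p - i + 1)) := by ring
    _ = _ := by rw [← pow_add, show i + (p - i + 1) = p + 1 by omega]

theorem hasDerivAt_transResidual {p : ℕ} (w : ℕ → Fin (p + 1) → ℝ) {D : ℕ → ℝ → ℝ}
    (hD : IsDerivFamily D) (h x : ℝ) :
    HasDerivAt (transResidual p w D h) (transResidual p w (fun i => D (i + 1)) h x) x := by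
  have h1 : ∀ i, HasDerivAt (fun x => taylorRem (fun l => D (l + i)) (p - i) x (-h))
      (taylorRem (fun l => D (l + i + 1)) (p - i) x (-h)) x := fun i => by
    have := (hD.shift i).hasDerivAt_taylorRem (p - i) x (-h)
    simpa only [add_right_comm] using this
  exact (HasDerivAt.fun_sum fun i _ => (h1 i).const_mul _).smul_const _

theorem norm_transResidual_sub_le {p : ℕ} {Eb : ℝ} (hEb : ∀ v, ‖evalAt p 1 v‖ ≤ Eb * ‖v‖)
    (hEb0 : 0 ≤ Eb) {w : ℕ → Fin (p + 1) → ℝ} {W : ℝ} (hw : ∀ i ≤ p, ‖w i‖ ≤ W)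
    {D : ℕ → ℝ → ℝ} (hD : IsDerivFamily D) {S : ℝ} (hS : ∀ x, |D (p + 2) x| ≤ S) {h : ℝ}
    (hh : 0 ≤ h) (x : ℝ) :
    ‖transResidual p w D h x - transResidual p w D h (x - h)‖ ≤
      h * (((p + 1 : ℕ) * (Eb * W * S * h ^ (p + 1))) * ‖inflow p‖) := by
  have h1 := norm_sub_le_of_hasDerivAt (fun x => hasDerivAt_transResidual w hD h x)
    (fun x => norm_transResidual_le hEb hEb0 hw (hD.shift 1) hS hh x) (x - h) x
  rwa [sub_sub_cancel, abs_of_nonneg hh, mul_comm] at h1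

theorem exists_norm_chainDeriv_le (p : ℕ) :
    ∃ B : ℝ, 0 ≤ B ∧ ∀ (w : ℕ → Fin (p + 1) → ℝ) (W : ℝ), (∀ i ≤ p, ‖w i‖ ≤ W) →
      ∀ m ≤ p, ‖chainDeriv p w m‖ ≤ B * W := by
  obtain ⟨U, hU0, hU⟩ := exists_linearMap_bound (upwind p)
  obtain ⟨E, hE0, hE⟩ := exists_linearMap_bound (evalAt p 1)
  refine ⟨U + (p + 1 : ℕ) * E * ‖inflow p‖, by positivity, fun w W hw m hm => ?_⟩
  have hW : 0 ≤ W := (norm_nonneg _).trans (hw 0 (Nat.zero_le _))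
  have hs : ∀ n, |shiftCoeff n| ≤ 1 := fun n => by
    rw [shiftCoeff, abs_div, abs_pow, abs_neg, abs_one, one_pow, Nat.abs_cast]
    exact div_le_one_of_le₀ (by exact_mod_cast n.factorial_pos) (by positivity)
  have h1 : |∑ i ∈ Finset.range (m + 1), shiftCoeff (m - i) * evalAt p 1 (w i)| ≤
      (p + 1 : ℕ) * (E * W) := by
    refine (abs_sum_range_le (B := E * W) fun i hi => ?_).trans ?_
    · rw [abs_mul]
      calc _ ≤ 1 * (E * W) := by
            refine mul_le_mul (hs _) ((hE _).trans ?_) (abs_nonneg _) zero_le_one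
            exact mul_le_mul_of_nonneg_left (hw i (by omega)) hE0
        _ = _ := one_mul _
    · have : ((m + 1 : ℕ) : ℝ) ≤ (p + 1 : ℕ) := by exact_mod_cast Nat.succ_le_succ hm
      gcongr
  calc _ ≤ ‖upwind p (w m)‖ + _ := norm_add_le _ _
    _ ≤ U * W + (p + 1 : ℕ) * (E * W) * ‖inflow p‖ := by
        refine add_le_add ((hU _).trans (mul_le_mul_of_nonneg_left (hw m hm) hU0)) ?_
        rw [norm_smul]
        exact mul_le_mul_of_nonneg_right h1 (norm_nonneg _)
    _ = _ := by ring

/-! ### Bounds for the source in the equation of the error -/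

/-- Exponentially decaying chains `z k` that start from the Legendre polynomials, up to the
constants `c k`. -/
structure IsTransient (p : ℕ) (σ : ℝ) (z : ℕ → ℕ → ℝ → Fin (p + 1) → ℝ) (c : ℕ → ℕ → ℝ)
    (M : ℝ) : Prop where
  rate_pos : 0 < σ
  nonneg : 0 ≤ M
  chain : ∀ k ≤ p, IsChain p (z k)
  coeff_eq_zero : ∀ k ≤ p, ∀ m < k, c k m = 0
  initial : ∀ k ≤ p, ∀ m ≤ p,
    z k m 0 = (if m = 0 then coefL p (legendre k) else 0) - c k m • coefL p 1
  decay : ∀ k ≤ p, ∀ m ≤ p, ∀ t, 0 ≤ t → ‖z k m t‖ ≤ M * Real.exp (-(σ * t))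

theorem exists_isTransient (p : ℕ) : ∃ σ z c M, IsTransient p σ z c M := by
  obtain ⟨σ, hσ, z, c, M, hM, h⟩ := exists_transient p
  exact ⟨σ, z, c, M, hσ, hM, fun k hk => (h k hk).1, fun k hk => (h k hk).2.1,
    fun k hk => (h k hk).2.2.1, fun k hk => (h k hk).2.2.2⟩

/-- The exact solution `G 0` and the coefficients `v k 0` of the initial error, with their
derivatives. -/
structure SmoothData (p : ℕ) (L h S : ℝ) (G : ℕ → ℝ → ℝ) (v : ℕ → ℕ → ℝ → ℝ) : Prop where
  nonneg : 0 ≤ S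
  family : IsDerivFamily G
  periodic : ∀ i, Function.Periodic (G i) L
  bound : ∀ i ≤ 2 * p + 4, ∀ x, |G i x| ≤ S
  family_error : ∀ k, IsDerivFamily (v k)
  periodic_error : ∀ k i, Function.Periodic (v k i) L
  bound_error : ∀ k ≤ p, ∀ i ≤ p + 3, ∀ x, |v k i x| ≤ S * h ^ (2 * p + 1 - k)

/-- The sum of the residuals of the transient parts. -/
def transSource (p : ℕ) (w : ℕ → ℕ → Fin (p + 1) → ℝ) (v : ℕ → ℕ → ℝ → ℝ) (h x : ℝ) :
    Fin (p + 1) → ℝ :=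
  ∑ k ∈ Finset.range (p + 1), transResidual p (w k) (v k) h x

/-- The source in the equation of the error, scaled by `h / a`. -/
def source (p : ℕ) (a h : ℝ) (z : ℕ → ℕ → ℝ → Fin (p + 1) → ℝ) (G : ℕ → ℝ → ℝ)
    (v : ℕ → ℕ → ℝ → ℝ) (t x : ℝ) : Fin (p + 1) → ℝ :=
  slowResidual p G h (x - a * t) + transSource p (fun k m => z k m (a * t / h)) v h x

/-- The time derivative of the source in the equation of the error, scaled by `h / a`. -/
def sourceDeriv (p : ℕ) (a h : ℝ) (z : ℕ → ℕ → ℝ → Fin (p + 1) → ℝ) (G : ℕ → ℝ → ℝ)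
    (v : ℕ → ℕ → ℝ → ℝ) (t x : ℝ) : Fin (p + 1) → ℝ :=
  (-a) • slowResidual p (fun i => G (i + 1)) h (x - a * t) +
    (a / h) • transSource p (fun k => chainDeriv p fun m => z k m (a * t / h)) v h x

theorem hasDerivAt_fast_time (a h t : ℝ) : HasDerivAt (fun t => a * t / h) (a / h) t := by
  simpa using ((hasDerivAt_id t).const_mul a).div_const h

theorem hasDerivAt_char (a x t : ℝ) : HasDerivAt (fun t => x - a * t) (-a) t := by
  simpa using ((hasDerivAt_id t).const_mul a).const_sub x

theorem hasDerivAt_source {p : ℕ} {σ M : ℝ} {z : ℕ → ℕ → ℝ → Fin (p + 1) → ℝ} {c : ℕ → ℕ → ℝ}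
    (hz : IsTransient p σ z c M) {G : ℕ → ℝ → ℝ} (hG : IsDerivFamily G) (v : ℕ → ℕ → ℝ → ℝ)
    (a h t x : ℝ) :
    HasDerivAt (fun t => source p a h z G v t x) (sourceDeriv p a h z G v t x) t := by
  refine HasDerivAt.add ?_ ?_
  · exact (hasDerivAt_slowResidual hG h (x - a * t)).scomp t (hasDerivAt_char a x t)
  · unfold transSource
    rw [Finset.smul_sum]
    refine HasDerivAt.fun_sum fun k hk => ?_
    have hk' : k ≤ p := Nat.lt_succ_iff.mp (Finset.mem_range.mp hk)
    unfold transResidual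
    rw [smul_smul, Finset.mul_sum]
    refine HasDerivAt.smul_const (HasDerivAt.fun_sum fun i hi => ?_) _
    have hi' : i ≤ p := Nat.lt_succ_iff.mp (Finset.mem_range.mp hi)
    have h1 := (hz.chain k hk' i hi' (a * t / h)).scomp t (hasDerivAt_fast_time a h t)
    have h2 := hasDerivAt_linearMap_comp (evalAt p 1) h1
    refine ((h2.const_mul (h ^ i)).mul_const _).congr_deriv ?_
    rw [map_smul, smul_eq_mul]
    unfold chainDeriv
    ring

theorem periodic_transSource (p : ℕ) (w : ℕ → ℕ → Fin (p + 1) → ℝ) {v : ℕ → ℕ → ℝ → ℝ} {L : ℝ}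
    (hp : ∀ k i, Function.Periodic (v k i) L) (h : ℝ) :
    Function.Periodic (transSource p w v h) L := fun x => by
  have h2 : ∀ k i, v k i (x + L + -h) = v k i (x + -h) := fun k i => by
    rw [← hp k i (x + -h)]; congr 1; ring
  simp only [transSource, transResidual, taylorRem, hp _ _ x, h2]

theorem SmoothData.periodic_source {p : ℕ} {L h S : ℝ} {G : ℕ → ℝ → ℝ} {v : ℕ → ℕ → ℝ → ℝ}
    (hd : SmoothData p L h S G v) (a : ℝ) (z : ℕ → ℕ → ℝ → Fin (p + 1) → ℝ) (t : ℝ) :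
    Function.Periodic (source p a h z G v t) L := fun x => by
  rw [source, source, periodic_transSource p _ hd.periodic_error, add_sub_right_comm,
    periodic_slowResidual p hd.periodic]

theorem SmoothData.periodic_sourceDeriv {p : ℕ} {L h S : ℝ} {G : ℕ → ℝ → ℝ}
    {v : ℕ → ℕ → ℝ → ℝ} (hd : SmoothData p L h S G v) (a : ℝ)
    (z : ℕ → ℕ → ℝ → Fin (p + 1) → ℝ) (t : ℝ) :
    Function.Periodic (sourceDeriv p a h z G v t) L := fun x => by
  rw [sourceDeriv, sourceDeriv, periodic_transSource p _ hd.periodic_error, add_sub_right_comm,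
    periodic_slowResidual p fun i => hd.periodic (i + 1)]

/-- The truncation contributes `h ^ (p+1)` and the data `h ^ (2p+1-k)` with `k ≤ p`, in total at
least `h ^ (2p+2)`. Chains up to order `p` are therefore long enough. -/
theorem exists_transSource_bound (p : ℕ) :
    ∃ A : ℝ, 0 ≤ A ∧ ∀ {L h S : ℝ} {G : ℕ → ℝ → ℝ} {v : ℕ → ℕ → ℝ → ℝ}, 0 ≤ h → h ≤ 1 →
      SmoothData p L h S G v → ∀ (w : ℕ → ℕ → Fin (p + 1) → ℝ) (W : ℝ),
      (∀ k ≤ p, ∀ i ≤ p, ‖w k i‖ ≤ W) → ∀ x,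
        ‖transSource p w v h x‖ ≤ A * W * S * h ^ (2 * p + 2) ∧
        ‖transSource p w v h x - transSource p w v h (x - h)‖ ≤
          h * (A * W * S * h ^ (2 * p + 2)) := by
  obtain ⟨Eb, hEb0, hEb⟩ := exists_linearMap_bound (evalAt p 1)
  refine ⟨(p + 1 : ℕ) * ((p + 1 : ℕ) * Eb * ‖inflow p‖), by positivity,
    fun {L h S G v} hh hh1 hd w W hw x => ?_⟩
  have hW : 0 ≤ W := (norm_nonneg _).trans (hw 0 (Nat.zero_le _) 0 (Nat.zero_le _))
  have hS := hd.nonneg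
  have hpow : ∀ k ≤ p, ((p + 1 : ℕ) * (Eb * W * (S * h ^ (2 * p + 1 - k)) * h ^ (p + 1))) *
      ‖inflow p‖ ≤ (p + 1 : ℕ) * Eb * ‖inflow p‖ * W * S * h ^ (2 * p + 2) := by
    intro k hk
    have h1 : h ^ (2 * p + 1 - k) * h ^ (p + 1) ≤ h ^ (2 * p + 2) := by
      rw [← pow_add]; exact pow_le_pow_of_le_one hh hh1 (by omega)
    calc _ = (p + 1 : ℕ) * Eb * ‖inflow p‖ * W * S * (h ^ (2 * p + 1 - k) * h ^ (p + 1)) := by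
          ring
      _ ≤ _ := by gcongr
  constructor
  · refine (norm_sum_range_le (B := (p + 1 : ℕ) * Eb * ‖inflow p‖ * W * S * h ^ (2 * p + 2))
      fun k hk => ?_).trans (le_of_eq (by ring))
    have hk' : k ≤ p := Nat.lt_succ_iff.mp hk
    exact (norm_transResidual_le hEb hEb0 (hw k hk') (hd.family_error k)
      (hd.bound_error k hk' (p + 1) (by omega)) hh x).trans (hpow k hk')
  · rw [transSource, transSource, ← Finset.sum_sub_distrib]
    refine (norm_sum_range_le
      (B := h * ((p + 1 : ℕ) * Eb * ‖inflow p‖ * W * S * h ^ (2 * p + 2)))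
      fun k hk => ?_).trans (le_of_eq (by ring))
    have hk' : k ≤ p := Nat.lt_succ_iff.mp hk
    exact (norm_transResidual_sub_le hEb hEb0 (hw k hk') (hd.family_error k)
      (hd.bound_error k hk' (p + 2) (by omega)) hh x).trans
        (mul_le_mul_of_nonneg_left (hpow k hk') hh)

/-- Size and cell difference of the source and of its time derivative are the inputs of the maximum
norm stability. Differentiating the transient costs `a / h` but keeps the exponential, so its time
integral stays bounded. -/
theorem exists_source_bound {p : ℕ} {σ M : ℝ} {z : ℕ → ℕ → ℝ → Fin (p + 1) → ℝ}
    {c : ℕ → ℕ → ℝ} (hz : IsTransient p σ z c M) :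
    ∃ A : ℝ, 0 ≤ A ∧ ∀ {a L h S : ℝ} {G : ℕ → ℝ → ℝ} {v : ℕ → ℕ → ℝ → ℝ}, 0 < a → 0 < h → h ≤ 1 →
      SmoothData p L h S G v → ∀ t x, 0 ≤ t →
        ‖source p a h z G v t x‖ ≤
          A * S * h ^ (2 * p + 2) * (1 + Real.exp (-(σ * a * t / h))) ∧
        ‖source p a h z G v t x - source p a h z G v t (x - h)‖ ≤
          h * (A * S * h ^ (2 * p + 2) * (1 + Real.exp (-(σ * a * t / h)))) ∧
        ‖sourceDeriv p a h z G v t x‖ ≤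
          A * S * h ^ (2 * p + 2) * (a + a / h * Real.exp (-(σ * a * t / h))) ∧
        ‖sourceDeriv p a h z G v t x - sourceDeriv p a h z G v t (x - h)‖ ≤
          h * (A * S * h ^ (2 * p + 2) * (a + a / h * Real.exp (-(σ * a * t / h)))) := by
  obtain ⟨A, hA, htr⟩ := exists_transSource_bound p
  obtain ⟨B, hB, hch⟩ := exists_norm_chainDeriv_le p
  have hM := hz.nonneg
  set A₀ := ‖coefL p (profile p (2 * p + 1))‖ + ‖inflow p‖ with hA₀
  have hA₀0 : 0 ≤ A₀ := by positivity
  refine ⟨A₀ + A * M + A * (B * M), by positivity, fun {a L h S G v} ha hh hh1 hd t x ht => ?_⟩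
  have hS := hd.nonneg
  set e := Real.exp (-(σ * a * t / h)) with he
  have he0 : 0 ≤ e := Real.exp_nonneg _
  have hτ : 0 ≤ a * t / h := by positivity
  have hw : ∀ k ≤ p, ∀ i ≤ p, ‖z k i (a * t / h)‖ ≤ M * e := fun k hk i hi => by
    have := hz.decay k hk i hi _ hτ
    rwa [show -(σ * (a * t / h)) = -(σ * a * t / h) by ring] at this
  have hw' : ∀ k ≤ p, ∀ i ≤ p, ‖chainDeriv p (fun m => z k m (a * t / h)) i‖ ≤ B * (M * e) :=
    fun k hk => hch _ _ (hw k hk)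
  have h1 := htr hh.le hh1 hd (fun k m => z k m (a * t / h)) _ hw
  have h2 := htr hh.le hh1 hd (fun k => chainDeriv p fun m => z k m (a * t / h)) _ hw'
  have g0 : ∀ y, ‖slowResidual p G h y‖ ≤ A₀ * S * h ^ (2 * p + 2) := fun y =>
    norm_slowResidual_le hd.family (hd.bound _ (by omega)) hh.le y
  have g1 : ∀ y, ‖slowResidual p G h y - slowResidual p G h (y - h)‖ ≤
      h * (A₀ * S * h ^ (2 * p + 2)) := fun y =>
    norm_slowResidual_sub_le hd.family (hd.bound _ (by omega)) hh.le y
  have g2 : ∀ y, ‖slowResidual p (fun i => G (i + 1)) h y‖ ≤ A₀ * S * h ^ (2 * p + 2) := fun y =>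
    norm_slowResidual_le (hd.family.shift 1) (hd.bound (2 * p + 3) (by omega)) hh.le y
  have g3 : ∀ y, ‖slowResidual p (fun i => G (i + 1)) h y -
      slowResidual p (fun i => G (i + 1)) h (y - h)‖ ≤ h * (A₀ * S * h ^ (2 * p + 2)) := fun y =>
    norm_slowResidual_sub_le (hd.family.shift 1) (hd.bound (2 * p + 4) (by omega)) hh.le y
  have hxs : x - h - a * t = x - a * t - h := by ring
  have hah : 0 ≤ a / h := by positivity
  set P := S * h ^ (2 * p + 2) with hP
  have hP0 : 0 ≤ P := by positivity
  have e1 : A₀ * P + A * (M * e) * P ≤ (A₀ + A * M + A * (B * M)) * P * (1 + e) := by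
    have : 0 ≤ A₀ * P * e + A * M * P + A * (B * M) * P * (1 + e) := by positivity
    linarith
  have e2 : a * (A₀ * P) + a / h * (A * (B * (M * e)) * P) ≤
      (A₀ + A * M + A * (B * M)) * P * (a + a / h * e) := by
    have : 0 ≤ A₀ * P * (a / h * e) + A * M * P * (a + a / h * e) + A * (B * M) * P * a := by
      positivity
    linarith
  simp only [mul_assoc _ S, ← hP] at h1 h2 g0 g1 g2 g3 ⊢
  refine ⟨?_, ?_, ?_, ?_⟩
  · exact ((norm_add_le _ _).trans (add_le_add (g0 _) (h1 x).1)).trans (by linarith)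
  · rw [source, source, add_sub_add_comm, hxs]
    refine ((norm_add_le _ _).trans (add_le_add (g1 _) (h1 x).2)).trans ?_
    rw [← mul_add]
    exact mul_le_mul_of_nonneg_left (by linarith) hh.le
  · refine (norm_add_le _ _).trans ?_
    rw [norm_smul, norm_smul, norm_neg, Real.norm_of_nonneg ha.le, Real.norm_of_nonneg hah]
    refine (add_le_add (mul_le_mul_of_nonneg_left (g2 _) ha.le)
      (mul_le_mul_of_nonneg_left (h2 x).1 hah)).trans ?_
    linarith
  · rw [sourceDeriv, sourceDeriv, add_sub_add_comm, ← smul_sub, ← smul_sub, hxs]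
    refine (norm_add_le _ _).trans ?_
    rw [norm_smul, norm_smul, norm_neg, Real.norm_of_nonneg ha.le, Real.norm_of_nonneg hah]
    refine (add_le_add (mul_le_mul_of_nonneg_left (g3 _) ha.le)
      (mul_le_mul_of_nonneg_left (h2 x).2 hah)).trans ?_
    have := mul_le_mul_of_nonneg_left e2 hh.le
    linarith

/-! ### The part of the initial error that does not decay -/

/-- The cell averages left over by the transient chains, with their derivatives. -/
def leftover (p : ℕ) (c : ℕ → ℕ → ℝ) (v : ℕ → ℕ → ℝ → ℝ) (h : ℝ) (i : ℕ) (x : ℝ) : ℝ :=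
  ∑ k ∈ Finset.range (p + 1), ∑ m ∈ Finset.range (p + 1), c k m * (h ^ m * v k (m + i) x)

theorem SmoothData.isDerivFamily_leftover {p : ℕ} {L h S : ℝ} {G : ℕ → ℝ → ℝ}
    {v : ℕ → ℕ → ℝ → ℝ} (hd : SmoothData p L h S G v) (c : ℕ → ℕ → ℝ) :
    IsDerivFamily (leftover p c v h) := fun i x =>
  HasDerivAt.fun_sum fun k _ => HasDerivAt.fun_sum fun m _ =>
    ((hd.family_error k (m + i) x).const_mul _).const_mul _

theorem SmoothData.periodic_leftover {p : ℕ} {L h S : ℝ} {G : ℕ → ℝ → ℝ}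
    {v : ℕ → ℕ → ℝ → ℝ} (hd : SmoothData p L h S G v) (c : ℕ → ℕ → ℝ) (i : ℕ) :
    Function.Periodic (leftover p c v h i) L := fun x => by
  simp only [leftover, hd.periodic_error _ _ x]

/-- A nonzero constant `c k m` has `m ≥ k`, so `h ^ m` makes up for the powers missing in `h ^
(2p+1-k)`. -/
theorem SmoothData.abs_leftover_le {p : ℕ} {σ M : ℝ} {z : ℕ → ℕ → ℝ → Fin (p + 1) → ℝ}
    {c : ℕ → ℕ → ℝ} (hz : IsTransient p σ z c M) {L h S : ℝ} {G : ℕ → ℝ → ℝ} {v : ℕ → ℕ → ℝ → ℝ}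
    (hd : SmoothData p L h S G v) (hh : 0 ≤ h) (hh1 : h ≤ 1) {i : ℕ} (hi : i ≤ 3) (x : ℝ) :
    |leftover p c v h i x| ≤
      (∑ k ∈ Finset.range (p + 1), ∑ m ∈ Finset.range (p + 1), |c k m|) *
        (S * h ^ (2 * p + 1)) := by
  rw [leftover, Finset.sum_mul]
  refine (Finset.abs_sum_le_sum_abs _ _).trans (Finset.sum_le_sum fun k hk => ?_)
  rw [Finset.sum_mul]
  refine (Finset.abs_sum_le_sum_abs _ _).trans (Finset.sum_le_sum fun m hm => ?_)
  have hk' : k ≤ p := Nat.lt_succ_iff.mp (Finset.mem_range.mp hk)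
  have hm' : m ≤ p := Nat.lt_succ_iff.mp (Finset.mem_range.mp hm)
  have hS := hd.nonneg
  rw [abs_mul]
  rcases lt_or_ge m k with hmk | hmk
  · rw [hz.coeff_eq_zero k hk' m hmk]; simp
  · refine mul_le_mul_of_nonneg_left ?_ (abs_nonneg _)
    rw [abs_mul, abs_of_nonneg (by positivity : 0 ≤ h ^ m)]
    calc h ^ m * |v k (m + i) x| ≤ h ^ m * (S * h ^ (2 * p + 1 - k)) := by
          gcongr; exact hd.bound_error k hk' _ (by omega) x
      _ = S * h ^ (m + (2 * p + 1 - k)) := by rw [pow_add]; ring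
      _ ≤ _ := mul_le_mul_of_nonneg_left (pow_le_pow_of_le_one hh hh1 (by omega)) hS

/-! ### The error equation -/

/-- The scheme applied to a grid function, scaled by `h / a`. -/
def schemeOp (p : ℕ) {N : ℕ} (E : ZMod N → Fin (p + 1) → ℝ) (j : ZMod N) : Fin (p + 1) → ℝ :=
  upwind p (E j) + evalAt p 1 (E (j - 1)) • inflow p

theorem schemeOp_add (p : ℕ) {N : ℕ} (E F : ZMod N → Fin (p + 1) → ℝ) (j : ZMod N) :
    schemeOp p (fun j => E j + F j) j = schemeOp p E j + schemeOp p F j := by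
  simp only [schemeOp, map_add]; module

theorem exists_norm_schemeOp_le (p : ℕ) :
    ∃ B : ℝ, 0 ≤ B ∧ ∀ {N : ℕ} (E : ZMod N → Fin (p + 1) → ℝ) (W : ℝ), (∀ j, ‖E j‖ ≤ W) →
      ∀ j, ‖schemeOp p E j‖ ≤ B * W := by
  obtain ⟨U, hU0, hU⟩ := exists_linearMap_bound (upwind p)
  obtain ⟨E, hE0, hE⟩ := exists_linearMap_bound (evalAt p 1)
  refine ⟨U + E * ‖inflow p‖, by positivity, fun {N} F W hW j => ?_⟩
  calc _ ≤ ‖upwind p (F j)‖ + ‖evalAt p 1 (F (j - 1)) • inflow p‖ := norm_add_le _ _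
    _ ≤ U * W + E * W * ‖inflow p‖ := by
        rw [norm_smul]
        refine add_le_add ((hU _).trans (mul_le_mul_of_nonneg_left (hW j) hU0)) ?_
        exact mul_le_mul_of_nonneg_right ((hE _).trans (mul_le_mul_of_nonneg_left (hW _) hE0))
          (norm_nonneg _)
    _ = _ := by ring

/-- On piecewise constants the scheme is plain upwind differencing, so slowly varying averages gain
a factor `h`. -/
theorem schemeOp_const_cells (p : ℕ) {N : ℕ} (f : ZMod N → ℝ) (j : ZMod N) :
    schemeOp p (fun j => f j • coefL p 1) j = -((f j - f (j - 1)) • inflow p) := by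
  rw [schemeOp, map_smul, map_smul, upwind_coefL_profile_zero, evalAt_apply,
    toPoly_coefL p (by simp), eval_one, smul_eq_mul, mul_one]
  module

/-- The right-hand side of the equation is the time derivative of `E`; by linearity it solves the
same scheme. -/
theorem HasSchemeDeriv.schemeOp {p : ℕ} {r : ℝ} {N : ℕ} {E s s' : ZMod N → ℝ → Fin (p + 1) → ℝ}
    (hE : HasSchemeDeriv p r E s) (hs : ∀ j t, 0 ≤ t → HasDerivAt (s j) (s' j t) t) :
    HasSchemeDeriv p r (fun j t => r • schemeOp p (fun j => E j t) j + s j t) s' := by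
  intro j t ht
  have key : ∀ {F : Type} [NormedAddCommGroup F] [NormedSpace ℝ F]
      (l : (Fin (p + 1) → ℝ) →ₗ[ℝ] F) (j : ZMod N),
      HasDerivWithinAt (fun t => l (E j t))
        (l (r • DGAdvection.schemeOp p (fun j => E j t) j + s j t)) (Set.Ici 0) t :=
    fun l j => (LinearMap.toContinuousLinearMap l).hasFDerivAt.comp_hasDerivWithinAt t (hE j t ht)
  exact (((key (upwind p) j).add ((key (evalAt p 1) (j - 1)).smul_const (inflow p))).const_smul
    r).add (hs j t ht).hasDerivWithinAt

/-- The part of the error that is neither the smooth profile nor a decaying chain is of order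
`h ^ (2 * p + 1)`, and so is its time derivative. -/
theorem exists_core_bound {p : ℕ} {σ M : ℝ} {z : ℕ → ℕ → ℝ → Fin (p + 1) → ℝ}
    {c : ℕ → ℕ → ℝ} (hz : IsTransient p σ z c M) {a L S T : ℝ} (ha : 0 < a) (hL : 0 < L)
    (hS : 0 ≤ S) (hT : 0 < T) :
    ∃ K : ℝ, 0 ≤ K ∧ ∀ (x₀ : ℝ) {N : ℕ}, 0 < N → L / N ≤ 1 →
      ∀ {G : ℕ → ℝ → ℝ} {v : ℕ → ℕ → ℝ → ℝ}, SmoothData p L (L / N) S G v →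
      ∀ (E : ZMod N → ℝ → Fin (p + 1) → ℝ) (ρ : ZMod N → Fin (p + 1) → ℝ),
        HasSchemeDeriv p (a / (L / N)) E
          (fun j t => (a / (L / N)) • source p a (L / N) z G v t (node x₀ L N j)) →
        (∀ j, E j 0 = leftover p c v (L / N) 0 (node x₀ L N j) • coefL p 1 + ρ j) →
        (∀ j, ‖ρ j‖ ≤ S * (L / N) ^ (2 * p + 3)) →
        ∀ j t, 0 ≤ t → t ≤ T → ‖E j t‖ ≤ K * (L / N) ^ (2 * p + 1) ∧
          ‖schemeOp p (fun j => E j t) j‖ ≤ K * (L / N) ^ (2 * p + 2) := by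
  obtain ⟨A, hA, hsrc⟩ := exists_source_bound hz
  obtain ⟨B, hB, hop⟩ := exists_norm_schemeOp_le p
  have hσ := hz.rate_pos
  set Cc : ℝ := ∑ k ∈ Finset.range (p + 1), ∑ m ∈ Finset.range (p + 1), |c k m| with hCc
  have hCc0 : 0 ≤ Cc := Finset.sum_nonneg fun _ _ => Finset.sum_nonneg fun _ _ => abs_nonneg _
  set one := coefL p (1 : ℝ[X]) with hone
  set Q : ℝ := √(p + 1) * √(2 * (p + 1)) * (1 + L) with hQ
  have hQ0 : 0 ≤ Q := by positivity
  set K₁ : ℝ := Q * ((Cc * ‖one‖ + 2) * S + a * A * S * T + A * S / σ) with hK₁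
  set K₂ : ℝ := Q * (a * (Cc * ‖inflow p‖ + 2 * B + 2 * A) * S + a ^ 2 * A * S * T +
    a * A * S / σ) with hK₂
  have hK₁0 : 0 ≤ K₁ := by positivity
  have hK₂0 : 0 ≤ K₂ := by positivity
  refine ⟨K₁ + (K₂ / a + 2 * A * S), by positivity,
    fun x₀ {N} hN hh1 {G v} hd E ρ hE hE0 hρ j t ht htT => ?_⟩
  have : NeZero N := ⟨hN.ne'⟩
  have hNr : (0 : ℝ) < N := by exact_mod_cast hN
  set h : ℝ := L / N with hh
  have hh0 : 0 < h := by positivity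
  set P : ℝ := h ^ (2 * p + 1) with hP
  have hP0 : 0 ≤ P := by positivity
  have hP2 : h ^ (2 * p + 2) = h * P := by rw [hP]; ring
  have hP3 : h ^ (2 * p + 3) = h * (h * P) := by rw [hP]; ring
  -- The remainder `ρ` has no smoothness from cell to cell. Its two spare powers of `h` pay for the
  -- factor `a / h` in the initial time derivative and for the cell difference.
  rw [hP3] at hρ
  rw [hP2]
  have hah : 0 ≤ a / h := by positivity
  have hahh : a / h * h = a := div_mul_cancel₀ a hh0.ne'
  set g : ℝ → ℝ := leftover p c v h 0 with hg
  have hnode : ∀ {α : Type} {f : ℝ → α}, Function.Periodic f L → ∀ j : ZMod N,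
      f (node x₀ L N (j - 1)) = f (node x₀ L N j - h) := fun {α f} hf j => by
    have := periodic_node_sub_one hf x₀ hN j 0
    rwa [add_zero, add_zero] at this
  have hfam := hd.isDerivFamily_leftover c
  have hgb : ∀ i ≤ 3, ∀ x, |leftover p c v h i x| ≤ Cc * (S * P) := fun i hi x =>
    hd.abs_leftover_le hz hh0.le hh1 hi x
  have hg1 : ∀ x, |g x - g (x - h)| ≤ h * (Cc * (S * P)) := fun x => by
    have := abs_sub_le_of_hasDerivAt (hfam 0) (hgb 1 (by norm_num)) (x - h) x
    rwa [sub_sub_cancel, abs_of_pos hh0, mul_comm] at this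
  have hg2 : ∀ x, |(g x - g (x - h)) - (g (x - h) - g (x - h - h))| ≤
      h * (h * (Cc * (S * P))) := fun x => by
    have h1 : ∀ x, HasDerivAt (fun x => g x - g (x - h))
        (leftover p c v h 1 x - leftover p c v h 1 (x - h)) x := fun x =>
      (hfam 0 x).sub ((hfam 0 (x - h)).comp_sub_const x h)
    have h2 : ∀ x, |leftover p c v h 1 x - leftover p c v h 1 (x - h)| ≤
        h * (Cc * (S * P)) := fun x => by
      have := abs_sub_le_of_hasDerivAt (hfam 1) (hgb 2 (by norm_num)) (x - h) x
      rwa [sub_sub_cancel, abs_of_pos hh0, mul_comm] at this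
    have := abs_sub_le_of_hasDerivAt h1 h2 (x - h) x
    rwa [sub_sub_cancel, abs_of_pos hh0, mul_comm] at this
  have hgper : Function.Periodic g L := hd.periodic_leftover c 0
  have hexp1 : ∀ t, 0 ≤ t → Real.exp (-(σ * a * t / h)) ≤ 1 := fun t ht =>
    Real.exp_le_one_iff.mpr (by rw [neg_nonpos]; positivity)
  have hSP : 0 ≤ S * P := mul_nonneg hS hP0
  have hhP : h * (S * P) ≤ S * P := mul_le_of_le_one_left hSP hh1
  have hρ1 : ∀ j, ‖ρ j‖ ≤ h * (S * P) := fun j => (hρ j).trans (by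
    have := mul_le_mul_of_nonneg_left hhP hh0.le
    linarith)
  -- bounds for the error
  have hE1 : ‖E j t‖ ≤
      Q * ((Cc * ‖one‖ + 2) * S * P + a * A * S * P * t + A * S * (h * P) / σ) := by
    refine norm_le_of_smooth_source p hL ha hσ hE (by positivity) (fun j => ?_) (fun j => ?_)
      (fun j t ht => ?_) (fun j t ht => ?_) ht j
    · rw [hE0 j]
      refine (norm_add_le _ _).trans ?_
      rw [norm_smul, Real.norm_eq_abs]
      have h1 := mul_le_mul_of_nonneg_right (hgb 0 (by norm_num) (node x₀ L N j)) (norm_nonneg one)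
      have h2 := hρ1 j
      linarith
    · rw [hE0 j, hE0 (j - 1), add_sub_add_comm, ← sub_smul]
      refine (norm_add_le _ _).trans ?_
      rw [norm_smul, Real.norm_eq_abs]
      have h0 := hnode hgper j
      rw [h0]
      have h1 := mul_le_mul_of_nonneg_right (hg1 (node x₀ L N j)) (norm_nonneg one)
      have h2 := (norm_sub_le (ρ j) (ρ (j - 1))).trans (add_le_add (hρ1 j) (hρ1 (j - 1)))
      linarith
    · rw [norm_smul, Real.norm_of_nonneg hah]
      have h1 := mul_le_mul_of_nonneg_left ((hsrc ha hh0 hh1 hd t (node x₀ L N j) ht).1) hah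
      rw [hP2] at h1
      refine h1.trans (le_of_eq ?_)
      linear_combination (A * S * P) * hahh
    · rw [← smul_sub, norm_smul, Real.norm_of_nonneg hah, hnode (hd.periodic_source a z t)]
      have h1 := mul_le_mul_of_nonneg_left ((hsrc ha hh0 hh1 hd t (node x₀ L N j) ht).2.1) hah
      rw [hP2] at h1
      refine h1.trans (le_of_eq ?_)
      linear_combination (A * S * P * h) * hahh
  have hE2 : ‖E j t‖ ≤ K₁ * P := by
    refine hE1.trans ((mul_le_mul_of_nonneg_left ?_ hQ0).trans (le_of_eq
      (a := Q * (((Cc * ‖one‖ + 2) * S + a * A * S * T + A * S / σ) * P)) (by rw [hK₁]; ring)))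
    have h1 : a * A * S * P * t ≤ a * A * S * P * T := by gcongr
    have h2 : A * S * (h * P) / σ ≤ A * S * P / σ := by
      gcongr; exact mul_le_of_le_one_left hP0 hh1
    calc _ ≤ (Cc * ‖one‖ + 2) * S * P + a * A * S * P * T + A * S * P / σ := by linarith
      _ = _ := by ring
  -- bounds for its time derivative
  set F : ZMod N → ℝ → Fin (p + 1) → ℝ := fun j t =>
    (a / h) • schemeOp p (fun j => E j t) j + (a / h) • source p a h z G v t (node x₀ L N j)
    with hF
  have hFd : HasSchemeDeriv p (a / h) F
      (fun j t => (a / h) • sourceDeriv p a h z G v t (node x₀ L N j)) :=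
    hE.schemeOp fun j t _ => (hasDerivAt_source hz hd.family v a h t _).const_smul (a / h)
  -- Initially the time derivative sees the leftover averages only through their difference, of
  -- order `h ^ (2p+2)`; this offsets the factor `a / h`.
  have hF0 : ∀ j, F j 0 = (a / h) • (-((g (node x₀ L N j) - g (node x₀ L N j - h)) • inflow p) +
      schemeOp p ρ j + source p a h z G v 0 (node x₀ L N j)) := fun j => by
    simp only [hF, hE0]
    rw [schemeOp_add, schemeOp_const_cells, ← smul_add]
    have h0 := hnode hgper j
    rw [h0]
  have hF1 : ‖F j t‖ ≤ Q * (a * (Cc * ‖inflow p‖ + 2 * B + 2 * A) * S * P +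
      a ^ 2 * A * S * P * t + a * A * S * P / σ) := by
    refine norm_le_of_smooth_source p hL ha hσ hFd (by positivity) (fun j => ?_) (fun j => ?_)
      (fun j t ht => ?_) (fun j t ht => ?_) ht j
    · rw [hF0, norm_smul, Real.norm_of_nonneg hah]
      have h1 := mul_le_mul_of_nonneg_right (hg1 (node x₀ L N j)) (norm_nonneg (inflow p))
      have h2 := hop ρ _ hρ1 j
      have h3 := (hsrc ha hh0 hh1 hd 0 (node x₀ L N j) le_rfl).1
      rw [hP2] at h3
      simp only [mul_zero, zero_div, neg_zero, Real.exp_zero] at h3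
      have h4 : ‖-((g (node x₀ L N j) - g (node x₀ L N j - h)) • inflow p) + schemeOp p ρ j +
          source p a h z G v 0 (node x₀ L N j)‖ ≤
          h * ((Cc * ‖inflow p‖ + 2 * B + 2 * A) * S * P) := by
        refine (norm_add₃_le).trans ?_
        rw [norm_neg, norm_smul, Real.norm_eq_abs]
        have : 0 ≤ h * (B * (S * P)) := by positivity
        linarith
      refine (mul_le_mul_of_nonneg_left h4 hah).trans (le_of_eq ?_)
      linear_combination ((Cc * ‖inflow p‖ + 2 * B + 2 * A) * S * P) * hahh
    · rw [hF0, hF0, ← smul_sub, norm_smul, Real.norm_of_nonneg hah]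
      have h0 := hnode hgper j
      have h0' : g (node x₀ L N (j - 1) - h) = g (node x₀ L N j - h - h) := by
        have := periodic_node_sub_one hgper x₀ hN j (-h)
        rwa [← sub_eq_add_neg, ← sub_eq_add_neg] at this
      rw [h0, h0', hnode (hd.periodic_source a z 0)]
      have h1 := mul_le_mul_of_nonneg_right (hg2 (node x₀ L N j)) (norm_nonneg (inflow p))
      have h2 := (norm_sub_le (schemeOp p ρ j) (schemeOp p ρ (j - 1))).trans
        (add_le_add (hop ρ _ hρ j) (hop ρ _ hρ (j - 1)))
      have h3 := (hsrc ha hh0 hh1 hd 0 (node x₀ L N j) le_rfl).2.1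
      rw [hP2] at h3
      simp only [mul_zero, zero_div, neg_zero, Real.exp_zero] at h3
      set n := node x₀ L N j
      have h4 : ‖-((g n - g (n - h)) • inflow p) + schemeOp p ρ j + source p a h z G v 0 n -
          (-((g (n - h) - g (n - h - h)) • inflow p) + schemeOp p ρ (j - 1) +
            source p a h z G v 0 (n - h))‖ ≤
          h * (h * ((Cc * ‖inflow p‖ + 2 * B + 2 * A) * S * P)) := by
        have h5 : -((g n - g (n - h)) • inflow p) + schemeOp p ρ j + source p a h z G v 0 n -
          (-((g (n - h) - g (n - h - h)) • inflow p) + schemeOp p ρ (j - 1) +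
            source p a h z G v 0 (n - h)) =
            -(((g n - g (n - h)) - (g (n - h) - g (n - h - h))) • inflow p) +
            (schemeOp p ρ j - schemeOp p ρ (j - 1)) +
            (source p a h z G v 0 n - source p a h z G v 0 (n - h)) := by
          rw [sub_smul (g n - g (n - h))]; abel
        rw [h5]
        refine (norm_add₃_le).trans ?_
        rw [norm_neg, norm_smul, Real.norm_eq_abs]
        linarith
      refine (mul_le_mul_of_nonneg_left h4 hah).trans (le_of_eq ?_)
      linear_combination (h * ((Cc * ‖inflow p‖ + 2 * B + 2 * A) * S * P)) * hahh
    · rw [norm_smul, Real.norm_of_nonneg hah]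
      have h1 := mul_le_mul_of_nonneg_left ((hsrc ha hh0 hh1 hd t (node x₀ L N j) ht).2.2.1) hah
      rw [hP2] at h1
      refine h1.trans (le_of_eq ?_)
      linear_combination (A * S * P * (a + a / h * Real.exp (-(σ * a * t / h)))) * hahh
    · rw [← smul_sub, norm_smul, Real.norm_of_nonneg hah, hnode (hd.periodic_sourceDeriv a z t)]
      have h1 := mul_le_mul_of_nonneg_left ((hsrc ha hh0 hh1 hd t (node x₀ L N j) ht).2.2.2) hah
      rw [hP2] at h1
      refine h1.trans (le_of_eq ?_)
      linear_combination (A * S * P * h * (a + a / h * Real.exp (-(σ * a * t / h)))) * hahh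
  have hF2 : ‖F j t‖ ≤ K₂ * P := by
    refine hF1.trans ((mul_le_mul_of_nonneg_left ?_ hQ0).trans (le_of_eq
      (a := Q * ((a * (Cc * ‖inflow p‖ + 2 * B + 2 * A) * S + a ^ 2 * A * S * T +
        a * A * S / σ) * P)) (by rw [hK₂]; ring)))
    have h1 : a ^ 2 * A * S * P * t ≤ a ^ 2 * A * S * P * T := by gcongr
    calc _ ≤ a * (Cc * ‖inflow p‖ + 2 * B + 2 * A) * S * P + a ^ 2 * A * S * P * T +
          a * A * S * P / σ := by linarith
      _ = _ := by ring
  -- Solving the equation for the scheme operator gains the factor `h / a` over the time derivative.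
  have hop1 : ‖schemeOp p (fun j => E j t) j‖ ≤ (K₂ / a + 2 * A * S) * (h * P) := by
    have h1 : schemeOp p (fun j => E j t) j =
        (h / a) • F j t - source p a h z G v t (node x₀ L N j) := by
      simp only [hF]
      rw [← smul_add, smul_smul, div_mul_div_cancel₀ ha.ne', div_self hh0.ne', one_smul,
        add_sub_cancel_right]
    have h2 := (hsrc ha hh0 hh1 hd t (node x₀ L N j) ht).1
    rw [hP2] at h2
    have h3 : A * S * (h * P) * (1 + Real.exp (-(σ * a * t / h))) ≤ A * S * (h * P) * 2 := by
      have := hexp1 t ht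
      gcongr; linarith
    rw [h1]
    refine (norm_sub_le _ _).trans ?_
    rw [norm_smul, Real.norm_of_nonneg (by positivity : 0 ≤ h / a)]
    calc _ ≤ h / a * (K₂ * P) + A * S * (h * P) * 2 := by
          refine add_le_add (mul_le_mul_of_nonneg_left hF2 (by positivity)) (h2.trans h3)
      _ = _ := by ring
  constructor
  · refine hE2.trans (mul_le_mul_of_nonneg_right ?_ hP0)
    have : 0 ≤ K₂ / a + 2 * A * S := by positivity
    linarith
  · exact hop1.trans (mul_le_mul_of_nonneg_right (by linarith) (by positivity))

/-! ### The initial data -/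

theorem IsStableProjection.map_sum {p : ℕ} {proj : ℕ → (ℝ → ℝ) → ℝ[X]}
    (hproj : IsStableProjection p proj) (N n : ℕ) {f : ℕ → ℝ → ℝ} (hf : ∀ m, ContDiff ℝ ∞ (f m)) :
    proj N (∑ m ∈ Finset.range n, f m) = ∑ m ∈ Finset.range n, proj N (f m) := by
  induction n with
  | zero => simpa using hproj.map_smul N 0 (f 0) (hf 0)
  | succ n ih =>
    rw [Finset.sum_range_succ, Finset.sum_range_succ, hproj.map_add N _ _ ?_ (hf n), ih]
    have := ContDiff.sum (𝕜 := ℝ) (s := Finset.range n) fun m _ => hf m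
    convert this using 1
    ext x; simp

theorem iteratedDeriv_taylorRem_comp {D : ℕ → ℝ → ℝ} (hD : IsDerivFamily D) (n i : ℕ) (x s : ℝ) :
    iteratedDeriv i (fun ξ => taylorRem D (n + i) x (s * (ξ + 1))) =
      fun ξ => s ^ i * taylorRem (fun l => D (l + i)) n x (s * (ξ + 1)) := by
  induction i generalizing n with
  | zero => simp
  | succ i ih =>
    rw [iteratedDeriv_succ, show n + (i + 1) = n + 1 + i by ring, ih]
    funext ξ
    refine HasDerivAt.deriv ?_
    have h1 := (hD.shift i).hasDerivAt_taylorRem_increment n x (s * (ξ + 1))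
    have h2 : HasDerivAt (fun ξ => s * (ξ + 1)) s ξ := by
      simpa using ((hasDerivAt_id ξ).add_const 1).const_mul s
    refine ((h1.comp ξ h2).const_mul (s ^ i)).congr_deriv ?_
    simp only [show ∀ l, l + 1 + i = l + (i + 1) from fun l => by ring]
    ring

theorem abs_half_mul_add_one_le {h ξ : ℝ} (hh : 0 ≤ h) (hξ : ξ ∈ Set.Icc (-1 : ℝ) 1) :
    |h / 2 * (ξ + 1)| ≤ h := by
  rw [abs_of_nonneg (mul_nonneg (by positivity) (by linarith [hξ.1]))]
  nlinarith [hξ.2]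

/-- Up to a small remainder, the projection of a smooth function on a cell is a linear combination
of the derivatives of the function at the left end of the cell, with coefficients independent of
the cell. -/
theorem IsStableProjection.exists_expansion {p : ℕ} {proj : ℕ → (ℝ → ℝ) → ℝ[X]}
    (hproj : IsStableProjection p proj) {g : ℝ → ℝ} (hg : ContDiff ℝ ∞ g) {L : ℝ} (hL : 0 < L)
    (hper : Function.Periodic g L) :
    ∃ (n : ℕ) (A : ℝ), 2 * p + 2 ≤ n ∧ 0 ≤ A ∧ ∀ (N : ℕ) (h : ℝ), 0 ≤ h → h ≤ 1 →
      ∃ b : ℕ → Fin (p + 1) → ℝ, ∀ x,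
        ‖coefL p (proj N (fun ξ => g (x + h / 2 * (ξ + 1)))) -
          ∑ m ∈ Finset.range n, iteratedDeriv m g x • b m‖ ≤ A * h ^ (2 * p + 3) := by
  obtain ⟨r, B, hB⟩ := hproj.stable
  obtain ⟨Q, hQ0, hQ⟩ := exists_norm_coefL_le p
  have hD := isDerivFamily_iteratedDeriv hg
  set D : ℕ → ℝ → ℝ := fun i => iteratedDeriv i g with hDdef
  -- The extra `r` orders let the remainder be differentiated up to `r` times; each derivative in
  -- `ξ` returns the power of `h` that it takes from the remainder.
  set M := 2 * p + 2 + r with hM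
  obtain ⟨W, hW0, hW⟩ := exists_abs_le_of_periodic hL
    (continuous_iff_continuousAt.mpr fun x => (hD (M + 1) x).continuousAt)
    (periodic_iteratedDeriv hper (M + 1))
  refine ⟨M + 1, Q * (|B| * W), by omega, by positivity, fun N h hh hh1 => ?_⟩
  set e : ℕ → ℝ → ℝ := fun m ξ => (ξ + 1) ^ m with he
  have hes : ∀ m, ContDiff ℝ ∞ (e m) := fun m => by simp only [he]; fun_prop
  have hes' : ∀ (m : ℕ) (q : ℝ), ContDiff ℝ ∞ (q • e m) := fun m q => (hes m).const_smul q
  -- The cell enters only through derivatives at its left end; the projected powers of `ξ + 1` are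
  -- common to all cells.
  refine ⟨fun m => ((h / 2) ^ m / m.factorial) • coefL p (proj N (e m)), fun x => ?_⟩
  set f : ℝ → ℝ := fun ξ => g (x + h / 2 * (ξ + 1)) with hf
  have hfs : ContDiff ℝ ∞ f := hg.comp (by fun_prop)
  set P : ℝ → ℝ := ∑ m ∈ Finset.range (M + 1), ((h / 2) ^ m / m.factorial * D m x) • e m with hP
  set R : ℝ → ℝ := fun ξ => taylorRem D M x (h / 2 * (ξ + 1)) with hR
  have hPs : ContDiff ℝ ∞ P := by
    have := ContDiff.sum (𝕜 := ℝ) (n := ∞) (s := Finset.range (M + 1))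
      (f := fun m => ((h / 2) ^ m / m.factorial * D m x) • e m) fun m _ => hes' m _
    convert this using 1
    ext x; simp [hP]
  have hfPR : f = P + R := by
    funext ξ
    have h1 : P ξ = ∑ i ∈ Finset.range (M + 1),
        (h / 2 * (ξ + 1)) ^ i / i.factorial * D i x := by
      rw [hP, Finset.sum_apply]
      refine Finset.sum_congr rfl fun m _ => ?_
      simp only [Pi.smul_apply, smul_eq_mul, he, mul_pow]
      ring
    rw [Pi.add_apply, h1]
    simp [hR, hf, taylorRem, hDdef]
  have hRs : ContDiff ℝ ∞ R := by
    have : R = f - P := by rw [hfPR, add_sub_cancel_left]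
    rw [this]; exact hfs.sub hPs
  have hsum : coefL p (proj N f) - ∑ m ∈ Finset.range (M + 1),
      D m x • (((h / 2) ^ m / m.factorial) • coefL p (proj N (e m))) = coefL p (proj N R) := by
    rw [hfPR, hproj.map_add N P R hPs hRs, hP, hproj.map_sum N (M + 1)
      fun m => hes' m _, _root_.map_add, _root_.map_sum, add_sub_right_comm,
      ← Finset.sum_sub_distrib, Finset.sum_eq_zero, zero_add]
    intro m _
    rw [hproj.map_smul N _ _ (hes m), _root_.map_smul, smul_smul, mul_comm, sub_self]
  rw [hsum]
  have hRb : ∀ i ≤ r, ∀ ξ ∈ Set.Icc (-1 : ℝ) 1, |iteratedDeriv i R ξ| ≤ W * h ^ (2 * p + 3) := by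
    intro i hi ξ hξ
    have h1 := iteratedDeriv_taylorRem_comp hD (M - i) i x (h / 2)
    rw [Nat.sub_add_cancel (by omega)] at h1
    have h2 := (hD.shift i).abs_taylorRem_le (M - i) (B := W) (fun x => by
      rw [show M - i + 1 + i = M + 1 by omega]; exact hW x) x (h / 2 * (ξ + 1))
    have h3 := abs_half_mul_add_one_le hh hξ
    rw [hR, h1, abs_mul, abs_of_nonneg (by positivity : 0 ≤ (h / 2) ^ i)]
    calc _ ≤ h ^ i * (W * h ^ (M - i + 1)) := by
          refine mul_le_mul (pow_le_pow_left₀ (by positivity) (by linarith) i) (h2.trans ?_)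
            (abs_nonneg _) (by positivity)
          gcongr
      _ = W * h ^ (M + 1) := by
          rw [mul_left_comm, ← pow_add, show i + (M - i + 1) = M + 1 by omega]
      _ ≤ _ := mul_le_mul_of_nonneg_left (pow_le_pow_of_le_one hh hh1 (by omega)) hW0
  have h4 := hQ (proj N R) (|B| * (W * h ^ (2 * p + 3))) fun ξ hξ =>
    (hB N R hRs _ hRb ξ hξ).trans (mul_le_mul_of_nonneg_right (le_abs_self B) (by positivity))
  exact h4.trans (le_of_eq (by ring))

theorem eval_toPoly_slowPart_sub (p : ℕ) (G : ℕ → ℝ → ℝ) (h y ξ : ℝ) :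
    (toPoly p (slowPart p G h y)).eval ξ - G 0 (y + h / 2 * (ξ + 1)) =
      (∑ m ∈ Finset.range (2 * p + 2),
        h ^ m * G m y * (profile p m - taylorMonomial m).eval ξ) -
        taylorRem G (2 * p + 1) y (h / 2 * (ξ + 1)) := by
  rw [taylorRem, slowPart, map_sum, eval_finsetSum, sub_sub_eq_add_sub, sub_left_inj,
    ← Finset.sum_add_distrib]
  refine Finset.sum_congr rfl fun m _ => ?_
  rw [map_smul, toPoly_coefL p (natDegree_profile_le p m), eval_smul, eval_sub,
    eval_taylorMonomial, smul_eq_mul]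
  simp only [mul_pow, div_pow]
  ring

/-- The moments of the error of the discrete profile. -/
theorem exists_moment_slowPart_bound (p : ℕ) :
    ∃ A : ℝ, 0 ≤ A ∧ ∀ {G : ℕ → ℝ → ℝ} {S h : ℝ}, IsDerivFamily G →
      (∀ i ≤ 2 * p + 2, ∀ x, |G i x| ≤ S) → 0 ≤ h → h ≤ 1 → ∀ k ≤ p, ∀ y,
        |∫ ξ in (-1 : ℝ)..1, ((toPoly p (slowPart p G h y)).eval ξ -
          G 0 (y + h / 2 * (ξ + 1))) * (legendre k).eval ξ| ≤ A * S * h ^ (2 * p + 1 - k) := by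
  choose B hB0 hB using fun k => exists_abs_eval_le (legendre k)
  set I : ℕ → ℕ → ℝ := fun k m => integralPoly ((profile p m - taylorMonomial m) * legendre k)
    with hI
  have hA : ∀ k, 0 ≤ 2 * B k + ∑ m ∈ Finset.range (2 * p + 2), |I k m| := fun k =>
    add_nonneg (mul_nonneg zero_le_two (hB0 k)) (Finset.sum_nonneg fun _ _ => abs_nonneg _)
  refine ⟨∑ k ∈ Finset.range (p + 1), (2 * B k + ∑ m ∈ Finset.range (2 * p + 2), |I k m|),
    Finset.sum_nonneg fun k _ => hA k, fun {G S h} hG hS hh hh1 k hk y => ?_⟩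
  have hS0 : 0 ≤ S := (abs_nonneg _).trans (hS 0 (Nat.zero_le _) 0)
  set H := h ^ (2 * p + 1 - k) with hH
  have hH0 : 0 ≤ H := by positivity
  set f : ℝ[X] := ∑ m ∈ Finset.range (2 * p + 2),
    C (h ^ m * G m y) * ((profile p m - taylorMonomial m) * legendre k) with hf
  have hGc : Continuous (G 0) := continuous_iff_continuousAt.mpr fun x => (hG 0 x).continuousAt
  have hRc : Continuous fun ξ => taylorRem G (2 * p + 1) y (h / 2 * (ξ + 1)) *
      (legendre k).eval ξ := by
    unfold taylorRem
    have := (legendre k).continuous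
    fun_prop
  have h1 : ∫ ξ in (-1 : ℝ)..1, ((toPoly p (slowPart p G h y)).eval ξ -
      G 0 (y + h / 2 * (ξ + 1))) * (legendre k).eval ξ = integralPoly f -
      ∫ ξ in (-1 : ℝ)..1, taylorRem G (2 * p + 1) y (h / 2 * (ξ + 1)) * (legendre k).eval ξ := by
    rw [integralPoly_apply, ← intervalIntegral.integral_sub
      (f.continuous.intervalIntegrable _ _) (hRc.intervalIntegrable _ _)]
    refine intervalIntegral.integral_congr fun ξ _ => ?_
    simp only [eval_toPoly_slowPart_sub, hf, eval_finsetSum, eval_mul, eval_C, mul_assoc]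
    rw [sub_mul, Finset.sum_mul]
    simp only [mul_assoc]
  have h2 : |integralPoly f| ≤ (∑ m ∈ Finset.range (2 * p + 2), |I k m|) * (S * H) := by
    rw [hf, map_sum, Finset.sum_mul]
    refine (Finset.abs_sum_le_sum_abs _ _).trans (Finset.sum_le_sum fun m hm => ?_)
    rw [Finset.mem_range] at hm
    rw [integralPoly_C_mul, abs_mul, mul_comm]
    -- Moments of order below `2p + 1 - k` vanish by orthogonality; above, the power of `h`
    -- suffices.
    rcases lt_or_ge (m + k) (2 * p + 1) with hmk | hmk
    · simp only [hI, integralPoly_profile_sub_mul_legendre hmk]; simp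
    · refine mul_le_mul_of_nonneg_left ?_ (abs_nonneg _)
      rw [abs_mul, abs_of_nonneg (by positivity : 0 ≤ h ^ m), mul_comm]
      exact mul_le_mul (hS m (by omega) y) (pow_le_pow_of_le_one hh hh1 (by omega))
        (by positivity) hS0
  have h3 : |∫ ξ in (-1 : ℝ)..1, taylorRem G (2 * p + 1) y (h / 2 * (ξ + 1)) *
      (legendre k).eval ξ| ≤ 2 * B k * (S * H) := by
    have := intervalIntegral.norm_integral_le_of_norm_le_const (a := -1) (b := 1)
      (f := fun ξ => taylorRem G (2 * p + 1) y (h / 2 * (ξ + 1)) * (legendre k).eval ξ)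
      (C := S * H * B k) fun ξ hξ => ?_
    · rw [Real.norm_eq_abs] at this
      refine this.trans (le_of_eq ?_)
      norm_num; ring
    · rw [Set.uIoc_of_le (by norm_num)] at hξ
      have hξ' : ξ ∈ Set.Icc (-1 : ℝ) 1 := ⟨hξ.1.le, hξ.2⟩
      rw [Real.norm_eq_abs, abs_mul]
      refine mul_le_mul ?_ (hB k ξ hξ') (abs_nonneg _) (by positivity)
      refine (hG.abs_taylorRem_le (2 * p + 1) (hS _ le_rfl) y _).trans ?_
      refine mul_le_mul_of_nonneg_left ?_ hS0
      exact (pow_le_pow_left₀ (abs_nonneg _) (abs_half_mul_add_one_le hh hξ') _).trans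
        (pow_le_pow_of_le_one hh hh1 (by omega))
  have h4 : 2 * B k + ∑ m ∈ Finset.range (2 * p + 2), |I k m| ≤
      ∑ k ∈ Finset.range (p + 1), (2 * B k + ∑ m ∈ Finset.range (2 * p + 2), |I k m|) :=
    Finset.single_le_sum (f := fun k => 2 * B k + ∑ m ∈ Finset.range (2 * p + 2), |I k m|)
      (fun k _ => hA k) (Finset.mem_range.mpr (Nat.lt_succ_of_le hk))
  rw [h1]
  calc _ ≤ |integralPoly f| + _ := abs_sub _ _
    _ ≤ (2 * B k + ∑ m ∈ Finset.range (2 * p + 2), |I k m|) * (S * H) := by linarith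
    _ ≤ _ := mul_le_mul_of_nonneg_right h4 (by positivity)
    _ = _ := (mul_assoc _ _ _).symm

/-- The initial error relative to the discrete profile, as a smooth function of the cell. -/
theorem exists_smoothData {p : ℕ} {proj : ℕ → (ℝ → ℝ) → ℝ[X]} (hproj : IsStableProjection p proj)
    {g : ℝ → ℝ} (hg : ContDiff ℝ ∞ g) {L : ℝ} (hL : 0 < L) (hper : Function.Periodic g L) (x₀ : ℝ)
    (W : (N : ℕ) → ZMod N → Fin (p + 1) → ℝ)
    (hW : ∀ N, 0 < N → ∀ j,
      W N j = coefL p (proj N (fun ξ => g (node x₀ L N j + L / N / 2 * (ξ + 1)))))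
    (hmom : ∀ k ≤ p, ∃ (K : ℝ) (N₁ : ℕ), ∀ N : ℕ, 0 < N → N₁ ≤ N → ∀ j : ZMod N,
      |∫ ξ in (-1 : ℝ)..1, ((toPoly p (W N j)).eval ξ -
        g (node x₀ L N j + L / N / 2 * (ξ + 1))) * (legendre k).eval ξ| ≤
          K * (L / N) ^ (2 * p + 1 - k)) :
    ∃ (S : ℝ) (N₀ : ℕ), 0 ≤ S ∧ ∀ N : ℕ, 0 < N → N₀ ≤ N → L / N ≤ 1 ∧
      ∃ (v : ℕ → ℕ → ℝ → ℝ) (ρ : ZMod N → Fin (p + 1) → ℝ),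
        SmoothData p L (L / N) S (fun i => iteratedDeriv i g) v ∧
        (∀ j, W N j = slowPart p (fun i => iteratedDeriv i g) (L / N) (node x₀ L N j) +
          (fun k : Fin (p + 1) => v k 0 (node x₀ L N j)) + ρ j) ∧
        ∀ j, ‖ρ j‖ ≤ S * (L / N) ^ (2 * p + 3) := by
  have hD := isDerivFamily_iteratedDeriv hg
  have hDper := fun i => periodic_iteratedDeriv hper i
  set G : ℕ → ℝ → ℝ := fun i => iteratedDeriv i g with hG
  have hDc : ∀ i, Continuous (G i) := fun i =>
    continuous_iff_continuousAt.mpr fun x => (hD i x).continuousAt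
  choose Bd hBd0 hBd using fun i => exists_abs_le_of_periodic hL (hDc i) (hDper i)
  set SG := ∑ i ∈ Finset.range (2 * p + 5), Bd i with hSG
  have hSG0 : 0 ≤ SG := Finset.sum_nonneg fun i _ => hBd0 i
  have hGb : ∀ i ≤ 2 * p + 4, ∀ x, |G i x| ≤ SG := fun i hi x => (hBd i x).trans
    (Finset.single_le_sum (fun i _ => hBd0 i) (Finset.mem_range.mpr (by omega)))
  obtain ⟨n, A, hn, hA0, hA⟩ := hproj.exists_expansion hg hL hper
  obtain ⟨Am, hAm0, hAm⟩ := exists_moment_slowPart_bound p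
  obtain ⟨Bc, N₂, hBc0, hBc⟩ := exists_derivComb_bound hD hL hDper x₀ n (p + 3)
  choose! K N₁ hK using hmom
  set Ks := ∑ k ∈ Finset.range (p + 1), |K k| with hKs
  have hKs0 : 0 ≤ Ks := Finset.sum_nonneg fun _ _ => abs_nonneg _
  obtain ⟨N₃, hN₃⟩ := exists_nat_ge L
  set Sv := (2 * p + 1) / 2 * (Ks + Am * SG) + A with hSv
  have hSv0 : 0 ≤ Sv := by positivity
  refine ⟨SG + A + Bc * Sv, N₂ + N₃ + ∑ k ∈ Finset.range (p + 1), N₁ k, by positivity,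
    fun N hN hNN => ?_⟩
  have hNr : (0 : ℝ) < N := by exact_mod_cast hN
  have hh1 : L / N ≤ 1 := by
    rw [div_le_one hNr]
    have : (N₃ : ℝ) ≤ N := by exact_mod_cast (by omega : N₃ ≤ N)
    linarith
  refine ⟨hh1, ?_⟩
  set h := L / N with hh
  have hh0 : 0 < h := by positivity
  obtain ⟨b, hb⟩ := hA N h hh0.le hh1
  -- Coefficients of the expansion of the projection minus those of the slow part, for one Legendre
  -- mode: they make `v k` a combination of `n` derivatives of `g`.
  set q : ℕ → Fin n → ℝ := fun k m => if hk : k < p + 1 then b m ⟨k, hk⟩ -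
    (if (m : ℕ) < 2 * p + 2 then h ^ (m : ℕ) * coefL p (profile p m) ⟨k, hk⟩ else 0) else 0 with hq
  have hv0 : ∀ x, (fun k : Fin (p + 1) => derivComb G (q k) 0 x) =
      (∑ m ∈ Finset.range n, G m x • b m) - slowPart p G h x := fun x => by
    have h1 : slowPart p G h x = ∑ m ∈ Finset.range n,
        if m < 2 * p + 2 then (h ^ m * G m x) • coefL p (profile p m) else 0 := by
      rw [slowPart, ← Finset.sum_filter]
      refine Finset.sum_congr ?_ fun _ _ => rfl
      ext m; simp only [Finset.mem_range, Finset.mem_filter]; omega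
    rw [h1, ← Finset.sum_sub_distrib, Finset.sum_range]
    funext k
    rw [Finset.sum_apply, derivComb]
    refine Finset.sum_congr rfl fun m _ => ?_
    simp only [hq, k.2, dif_pos, add_zero]
    split_ifs <;> simp [smul_eq_mul] <;> ring
  set ρ : ZMod N → Fin (p + 1) → ℝ := fun j =>
    W N j - ∑ m ∈ Finset.range n, G m (node x₀ L N j) • b m with hρ
  have hρb : ∀ j, ‖ρ j‖ ≤ A * h ^ (2 * p + 3) := fun j => by
    have := hb (node x₀ L N j)
    rwa [← hW N hN j] at this
  have hdec : ∀ j, W N j = slowPart p G h (node x₀ L N j) +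
      (fun k : Fin (p + 1) => derivComb G (q k) 0 (node x₀ L N j)) + ρ j := fun j => by
    simp only [hv0, hρ]; abel
  -- Both the numerical solution and the slow part have small moments against the exact data, so
  -- their difference has small Legendre coefficients. This holds at the nodes only; `hBc` below
  -- extends it to all points and derivatives.
  have hmesh : ∀ k ≤ p, ∀ j, |derivComb G (q k) 0 (node x₀ L N j)| ≤
      Sv * h ^ (2 * p + 1 - k) := by
    intro k hk j
    set y := node x₀ L N j with hy
    set kf : Fin (p + 1) := ⟨k, Nat.lt_succ_of_le hk⟩ with hkf
    have h1 : derivComb G (q k) 0 y = (W N j - slowPart p G h y) kf - ρ j kf := by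
      have := congrFun (hdec j) kf
      simp only [Pi.add_apply] at this
      rw [Pi.sub_apply, this, hkf]
      ring
    have hlc := (legendre k).continuous
    have h2 : integralPoly (toPoly p (W N j - slowPart p G h y) * legendre k) =
        (∫ ξ in (-1 : ℝ)..1, ((toPoly p (W N j)).eval ξ - G 0 (y + h / 2 * (ξ + 1))) *
          (legendre k).eval ξ) -
        ∫ ξ in (-1 : ℝ)..1, ((toPoly p (slowPart p G h y)).eval ξ - G 0 (y + h / 2 * (ξ + 1))) *
          (legendre k).eval ξ := by
      have hc0 := hDc 0
      have hc1 := (toPoly p (W N j)).continuous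
      have hc2 := (toPoly p (slowPart p G h y)).continuous
      rw [← intervalIntegral.integral_sub ((by fun_prop : Continuous _).intervalIntegrable _ _)
        ((by fun_prop : Continuous _).intervalIntegrable _ _), integralPoly_apply]
      refine intervalIntegral.integral_congr fun ξ _ => ?_
      simp only [map_sub, eval_mul, eval_sub]
      ring
    have hN₁ : N₁ k ≤ ∑ k ∈ Finset.range (p + 1), N₁ k :=
      Finset.single_le_sum (fun _ _ => Nat.zero_le _)
        (Finset.mem_range.mpr (Nat.lt_succ_of_le hk))
    have h3 := hK k hk N hN (by omega) j
    have h4 := hAm hD (fun i hi => hGb i (by omega)) hh0.le hh1 k hk y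
    have h5 : |K k| ≤ Ks := Finset.single_le_sum (f := fun k => |K k|) (fun _ _ => abs_nonneg _)
      (Finset.mem_range.mpr (Nat.lt_succ_of_le hk))
    have hg0 : G 0 = g := by rw [hG]; exact iteratedDeriv_zero
    rw [← hg0] at h3
    set H := h ^ (2 * p + 1 - k) with hH
    have hH0 : 0 ≤ H := by positivity
    have h6 : |integralPoly (toPoly p (W N j - slowPart p G h y) * legendre k)| ≤
        (Ks + Am * SG) * H := by
      rw [h2, add_mul]
      refine (abs_sub _ _).trans (add_le_add (h3.trans ?_) h4)
      exact mul_le_mul_of_nonneg_right ((le_abs_self _).trans h5) hH0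
    have h7 : |(W N j - slowPart p G h y) kf| ≤ (2 * p + 1) / 2 * ((Ks + Am * SG) * H) := by
      rw [← coefL_toPoly p (W N j - slowPart p G h y), coefL_apply, abs_mul,
        abs_of_nonneg (by positivity)]
      refine mul_le_mul ?_ h6 (abs_nonneg _) (by positivity)
      have : ((kf : ℕ) : ℝ) ≤ p := by exact_mod_cast hk
      linarith
    have h8 : |ρ j kf| ≤ A * H := (norm_le_pi_norm (ρ j) kf).trans ((hρb j).trans
      (mul_le_mul_of_nonneg_left (pow_le_pow_of_le_one hh0.le hh1 (by omega)) hA0))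
    rw [h1]
    calc _ ≤ _ := abs_sub _ _
      _ ≤ (2 * p + 1) / 2 * ((Ks + Am * SG) * H) + A * H := add_le_add h7 h8
      _ = _ := by rw [hSv]; ring
  refine ⟨fun k => derivComb G (q k), ρ, ⟨by positivity, hD, hDper, fun i hi x => ?_,
    fun k => hD.derivComb _, fun k => periodic_derivComb hDper _, fun k hk i hi x => ?_⟩, hdec,
    fun j => (hρb j).trans ?_⟩
  · have := mul_nonneg hBc0 hSv0
    linarith [hGb i hi x]
  · refine (hBc N hN (by omega) (q k) _ (hmesh k hk) i hi x).trans ?_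
    rw [← mul_assoc]
    exact mul_le_mul_of_nonneg_right (by linarith) (by positivity)
  · have := mul_nonneg hBc0 hSv0
    exact mul_le_mul_of_nonneg_right (by linarith) (by positivity)

/-! ### Decomposition of the numerical solution -/

theorem IsDGSolution.hasSchemeDeriv {p : ℕ} {a h : ℝ} {N : ℕ} {c : ZMod N → ℕ → ℝ → ℝ}
    (hc : IsDGSolution p a h c) :
    HasSchemeDeriv p (a / h) (fun j t k => c j k t) (fun _ _ => 0) := by
  intro j t ht
  refine hasDerivWithinAt_pi.mpr fun k => (hc j k (Nat.lt_succ_iff.mp k.2) t ht).congr_deriv ?_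
  rw [jump, numSol, numSol, cellPoly_eq_toPoly, cellPoly_eq_toPoly]
  simp only [← eval_mul]
  rw [← integralPoly_apply, upwind_apply, evalAt_apply, evalAt_apply]
  simp only [Pi.add_apply, Pi.smul_apply, Pi.sub_apply, Pi.zero_apply, coefL_apply, inflow,
    smul_eq_mul]
  ring

theorem hasDerivAt_slowPart_char {p : ℕ} {G : ℕ → ℝ → ℝ} (hG : IsDerivFamily G) (a : ℝ) {h : ℝ}
    (hh : h ≠ 0) (x t : ℝ) :
    HasDerivAt (fun t => slowPart p G h (x - a * t))
      ((a / h) • (upwind p (slowPart p G h (x - a * t)) +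
        evalAt p 1 (slowPart p G h (x - a * t - h)) • inflow p -
          slowResidual p G h (x - a * t))) t := by
  refine ((hasDerivAt_slowPart hG h (x - a * t)).scomp t (hasDerivAt_char a x t)).congr_deriv ?_
  rw [upwind_slowPart, add_sub_cancel_right, smul_neg, smul_smul, div_mul_cancel₀ a hh, neg_smul]

/-- The sum of the transient parts of the discrete solution. -/
def transSum (p : ℕ) (w : ℕ → ℕ → Fin (p + 1) → ℝ) (v : ℕ → ℕ → ℝ → ℝ) (h x : ℝ) :
    Fin (p + 1) → ℝ :=
  ∑ k ∈ Finset.range (p + 1), transPart p (w k) (v k) h x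

theorem upwind_transSum (p : ℕ) (w : ℕ → ℕ → Fin (p + 1) → ℝ) (v : ℕ → ℕ → ℝ → ℝ) (h x : ℝ) :
    upwind p (transSum p w v h x) + evalAt p 1 (transSum p w v h (x - h)) • inflow p =
      transSum p (fun k => chainDeriv p (w k)) v h x + transSource p w v h x := by
  simp only [transSum, transSource, map_sum, Finset.sum_smul, ← Finset.sum_add_distrib,
    upwind_transPart]

theorem periodic_transSum (p : ℕ) (w : ℕ → ℕ → Fin (p + 1) → ℝ) {v : ℕ → ℕ → ℝ → ℝ} {L : ℝ}
    (hp : ∀ k i, Function.Periodic (v k i) L) (h : ℝ) :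
    Function.Periodic (transSum p w v h) L := fun x => by
  simp only [transSum, transPart, hp _ _ x]

theorem hasDerivAt_transSum {p : ℕ} {σ M : ℝ} {z : ℕ → ℕ → ℝ → Fin (p + 1) → ℝ} {c : ℕ → ℕ → ℝ}
    (hz : IsTransient p σ z c M) (v : ℕ → ℕ → ℝ → ℝ) (a h t x : ℝ) :
    HasDerivAt (fun t => transSum p (fun k m => z k m (a * t / h)) v h x)
      ((a / h) • transSum p (fun k => chainDeriv p fun m => z k m (a * t / h)) v h x) t := by
  unfold transSum transPart
  rw [Finset.smul_sum]
  refine HasDerivAt.fun_sum fun k hk => ?_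
  rw [Finset.smul_sum]
  refine HasDerivAt.fun_sum fun m hm => ?_
  have h1 := (hz.chain k (Nat.lt_succ_iff.mp (Finset.mem_range.mp hk)) m
    (Nat.lt_succ_iff.mp (Finset.mem_range.mp hm)) (a * t / h)).scomp t (hasDerivAt_fast_time a h t)
  refine (h1.const_smul (h ^ m * v k m x)).congr_deriv ?_
  rw [smul_comm]
  rfl

theorem sum_smul_coefL_legendre (p : ℕ) (w : ℕ → ℝ) :
    ∑ k ∈ Finset.range (p + 1), w k • coefL p (legendre k) = fun k : Fin (p + 1) => w k := by
  rw [← coefL_toPoly p (fun k : Fin (p + 1) => w k), toPoly_apply, map_sum, Finset.sum_range]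
  simp only [map_smul]

/-- Only order zero of each chain carries `P_k`; the constants subtracted at all orders add up to
the leftover averages. -/
theorem transSum_initial {p : ℕ} {σ M : ℝ} {z : ℕ → ℕ → ℝ → Fin (p + 1) → ℝ} {c : ℕ → ℕ → ℝ}
    (hz : IsTransient p σ z c M) (v : ℕ → ℕ → ℝ → ℝ) (h x : ℝ) :
    transSum p (fun k m => z k m 0) v h x =
      (fun k : Fin (p + 1) => v k 0 x) - leftover p c v h 0 x • coefL p 1 := by
  rw [← sum_smul_coefL_legendre p fun k => v k 0 x, leftover, Finset.sum_smul,
    ← Finset.sum_sub_distrib]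
  refine Finset.sum_congr rfl fun k hk => ?_
  have hk' : k ≤ p := Nat.lt_succ_iff.mp (Finset.mem_range.mp hk)
  have h1 : transPart p (fun m => z k m 0) (v k) h x = ∑ m ∈ Finset.range (p + 1),
      ((if m = 0 then v k 0 x • coefL p (legendre k) else 0) -
        (c k m * (h ^ m * v k (m + 0) x)) • coefL p 1) := by
    refine Finset.sum_congr rfl fun m hm => ?_
    beta_reduce
    rw [hz.initial k hk' m (Nat.lt_succ_iff.mp (Finset.mem_range.mp hm)), smul_sub, smul_smul,
      add_zero, mul_comm (c k m)]
    by_cases hm0 : m = 0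
    · subst hm0; simp
    · simp [hm0]
  rw [h1, Finset.sum_sub_distrib, Finset.sum_smul]
  simp

theorem SmoothData.norm_transSum_le {p : ℕ} {σ M : ℝ} {z : ℕ → ℕ → ℝ → Fin (p + 1) → ℝ}
    {c : ℕ → ℕ → ℝ} (hz : IsTransient p σ z c M) {L h S : ℝ} {G : ℕ → ℝ → ℝ} {v : ℕ → ℕ → ℝ → ℝ}
    (hd : SmoothData p L h S G v) (hh : 0 ≤ h) (hh1 : h ≤ 1) {τ : ℝ} (hτ : 0 ≤ τ) (x : ℝ) :
    ‖transSum p (fun k m => z k m τ) v h x‖ ≤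
      ((p + 1 : ℕ) * ((p + 1 : ℕ) * (S * M))) * (h ^ (p + 1) * Real.exp (-(σ * τ))) := by
  have hS := hd.nonneg
  refine (norm_sum_range_le (B := (p + 1 : ℕ) * ((S * M) * (h ^ (p + 1) * Real.exp (-(σ * τ)))))
    fun k hk => ?_).trans (le_of_eq (by ring))
  have hk' : k ≤ p := Nat.lt_succ_iff.mp hk
  refine norm_sum_range_le fun m hm => ?_
  have hm' : m ≤ p := Nat.lt_succ_iff.mp hm
  have h1 : ‖h ^ m * v k m x‖ ≤ S * h ^ (p + 1) := by
    rw [norm_mul, Real.norm_of_nonneg (by positivity : 0 ≤ h ^ m), Real.norm_eq_abs]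
    calc _ ≤ 1 * (S * h ^ (2 * p + 1 - k)) :=
          mul_le_mul (pow_le_one₀ hh hh1) (hd.bound_error k hk' m (by omega) x) (abs_nonneg _)
            zero_le_one
      _ ≤ _ := by
          rw [one_mul]
          exact mul_le_mul_of_nonneg_left (pow_le_pow_of_le_one hh hh1 (by omega)) hS
  rw [norm_smul]
  calc _ ≤ S * h ^ (p + 1) * (M * Real.exp (-(σ * τ))) :=
        mul_le_mul h1 (hz.decay k hk' m hm' τ hτ) (norm_nonneg _) (by positivity)
    _ = _ := by ring

/-- The discrete solution without its smooth and its transient part. -/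
theorem hasSchemeDeriv_remainder {p : ℕ} {σ M : ℝ} {z : ℕ → ℕ → ℝ → Fin (p + 1) → ℝ}
    {c : ℕ → ℕ → ℝ} (hz : IsTransient p σ z c M) {L S : ℝ} (hL : 0 < L) {N : ℕ} (hN : 0 < N)
    {G : ℕ → ℝ → ℝ} {v : ℕ → ℕ → ℝ → ℝ} (hd : SmoothData p L (L / N) S G v) (a x₀ : ℝ)
    {U : ZMod N → ℝ → Fin (p + 1) → ℝ} (hU : HasSchemeDeriv p (a / (L / N)) U (fun _ _ => 0)) :
    HasSchemeDeriv p (a / (L / N))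
      (fun j t => U j t - slowPart p G (L / N) (node x₀ L N j - a * t) -
        transSum p (fun k m => z k m (a * t / (L / N))) v (L / N) (node x₀ L N j))
      (fun j t => (a / (L / N)) • source p a (L / N) z G v t (node x₀ L N j)) := by
  have hNr : (0 : ℝ) < N := by exact_mod_cast hN
  have hh0 : L / N ≠ 0 := by positivity
  intro j t ht
  refine (((hU j t ht).sub (hasDerivAt_slowPart_char hd.family a hh0 (node x₀ L N j)
    t).hasDerivWithinAt).sub (hasDerivAt_transSum hz v a (L / N) t
      (node x₀ L N j)).hasDerivWithinAt).congr_deriv ?_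
  have h1 := periodic_node_sub_one (periodic_slowPart p hd.periodic (L / N)) x₀ hN j (-(a * t))
  rw [← sub_eq_add_neg, ← sub_eq_add_neg, sub_right_comm] at h1
  have h2 := periodic_node_sub_one (periodic_transSum p
    (fun k m => z k m (a * t / (L / N))) hd.periodic_error (L / N)) x₀ hN j 0
  rw [add_zero, add_zero] at h2
  have h3 := upwind_transSum p (fun k m => z k m (a * t / (L / N))) v (L / N) (node x₀ L N j)
  beta_reduce
  rw [h1, h2, source, eq_sub_of_add_eq h3.symm]
  simp only [map_sub]
  module

/-! ### The strong form of the scheme -/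

/-- By `toPoly_inflow` the scheme operator is an exact derivative, and `R(1) = 0`. Hence it measures
the deviation from the superconvergent form. -/
theorem integral_toPoly_schemeOp (p : ℕ) {N : ℕ} (F : ZMod N → Fin (p + 1) → ℝ) (j : ZMod N)
    (ξ : ℝ) :
    ∫ s in ξ..1, (toPoly p (schemeOp p F j)).eval s =
      2 * (evalAt p ξ (F j) - evalAt p 1 (F j) -
        (-1) ^ (p + 1) / 2 * (evalAt p (-1) (F j) - evalAt p 1 (F (j - 1))) *
          (radau p).eval ξ) := by
  have h1 : toPoly p (schemeOp p F j) = derivative ((-2 : ℝ) • toPoly p (F j) -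
      ((evalAt p (-1) (F j) - evalAt p 1 (F (j - 1))) * (-1) ^ p) • radau p) := by
    rw [schemeOp, map_add, map_smul, toPoly_upwind, toPoly_inflow, derivative_sub,
      derivative_smul, derivative_smul, evalAt_apply, evalAt_apply]
    module
  rw [h1, integral_derivative_eval]
  simp only [eval_sub, eval_smul, smul_eq_mul, eval_one_radau, evalAt_apply]
  ring

theorem exists_strong_form_bound (p : ℕ) :
    ∃ A : ℝ, 0 ≤ A ∧ ∀ {N : ℕ} (F : ZMod N → Fin (p + 1) → ℝ) (j : ZMod N),
      ∀ ξ ∈ Set.Icc (-1 : ℝ) 1, |evalAt p ξ (F j) - evalAt p 1 (F j) -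
        (-1) ^ (p + 1) / 2 * (evalAt p (-1) (F j) - evalAt p 1 (F (j - 1))) *
          (radau p).eval ξ| ≤ A * ‖schemeOp p F j‖ := by
  obtain ⟨A, hA0, hA⟩ := exists_abs_eval_toPoly_le p
  refine ⟨A, hA0, fun {N} F j ξ hξ => ?_⟩
  have h1 := intervalIntegral.norm_integral_le_of_norm_le_const (a := ξ) (b := 1)
    (f := fun s => (toPoly p (schemeOp p F j)).eval s) (C := A * ‖schemeOp p F j‖)
    fun s hs => by
      rw [Set.uIoc_of_le hξ.2] at hs
      exact hA _ s ⟨hξ.1.trans hs.1.le, hs.2⟩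
  rw [integral_toPoly_schemeOp, Real.norm_eq_abs, abs_mul, abs_two,
    abs_of_nonneg (by linarith [hξ.2] : 0 ≤ 1 - ξ)] at h1
  have h2 : 0 ≤ A * ‖schemeOp p F j‖ := by positivity
  nlinarith [hξ.1]

/-! ### The expansion of the smooth part of the error -/

/-- The coefficient of the `l`-th integral of the Radau polynomial in the error of the discrete
profile. -/
def slowWeight (p : ℕ) (G : ℕ → ℝ → ℝ) (h : ℝ) (l : ℕ) (y : ℝ) : ℝ :=
  ∑ m ∈ Finset.range (2 * p + 2), h ^ m * G m y * (profileWeight p (m - l) / 2 ^ l)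

/-- Only `m ≥ p + 1 + l` carries a nonzero weight. -/
theorem exists_abs_slowWeight_le (p : ℕ) :
    ∃ A : ℝ, 0 ≤ A ∧ ∀ {G : ℕ → ℝ → ℝ} {S h : ℝ}, (∀ i ≤ 2 * p + 1, ∀ x, |G i x| ≤ S) →
      0 ≤ h → h ≤ 1 → ∀ l ≤ p, ∀ y, |slowWeight p G h l y| ≤ A * S * h ^ (p + 1 + l) := by
  have hw : ∀ l, 0 ≤ ∑ m ∈ Finset.range (2 * p + 2), |profileWeight p (m - l) / 2 ^ l| :=
    fun l => Finset.sum_nonneg fun _ _ => abs_nonneg _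
  refine ⟨∑ l ∈ Finset.range (p + 1), ∑ m ∈ Finset.range (2 * p + 2),
    |profileWeight p (m - l) / 2 ^ l|, Finset.sum_nonneg fun l _ => hw l,
    fun {G S h} hS hh hh1 l hl y => ?_⟩
  have hS0 : 0 ≤ S := (abs_nonneg _).trans (hS 0 (Nat.zero_le _) 0)
  have h1 : |slowWeight p G h l y| ≤ (∑ m ∈ Finset.range (2 * p + 2),
      |profileWeight p (m - l) / 2 ^ l|) * (S * h ^ (p + 1 + l)) := by
    rw [slowWeight, Finset.sum_mul]
    refine (Finset.abs_sum_le_sum_abs _ _).trans (Finset.sum_le_sum fun m hm => ?_)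
    rw [Finset.mem_range] at hm
    rw [abs_mul, mul_comm]
    rcases le_or_gt (m - l) p with hml | hml
    · rw [profileWeight_eq_zero hml]; simp
    · refine mul_le_mul_of_nonneg_left ?_ (abs_nonneg _)
      rw [abs_mul, abs_of_nonneg (by positivity : 0 ≤ h ^ m), mul_comm]
      exact mul_le_mul (hS m (by omega) y) (pow_le_pow_of_le_one hh hh1 (by omega))
        (by positivity) hS0
  refine h1.trans ?_
  rw [mul_assoc]
  exact mul_le_mul_of_nonneg_right (Finset.single_le_sum (f := fun l =>
    ∑ m ∈ Finset.range (2 * p + 2), |profileWeight p (m - l) / 2 ^ l|) (fun l _ => hw l)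
    (Finset.mem_range.mpr (Nat.lt_succ_of_le hl))) (by positivity)

theorem evalAt_slowPart_sub (p : ℕ) (G : ℕ → ℝ → ℝ) (h y ξ : ℝ) :
    evalAt p ξ (slowPart p G h y) - G 0 (y + h / 2 * (ξ + 1)) =
      slowWeight p G h 0 y * (radau p).eval ξ +
        (∑ l ∈ Finset.Icc 1 p, slowWeight p G h l y * (radauPoly p l).eval ξ) -
        taylorRem G (2 * p + 1) y (h / 2 * (ξ + 1)) := by
  have h1 : ∑ m ∈ Finset.range (2 * p + 2),
      h ^ m * G m y * (profile p m - taylorMonomial m).eval ξ =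
      ∑ l ∈ Finset.range (p + 1), slowWeight p G h l y * (radauPoly p l).eval ξ := by
    simp only [slowWeight, Finset.sum_mul]
    rw [Finset.sum_comm]
    refine Finset.sum_congr rfl fun m hm => ?_
    rw [Finset.mem_range] at hm
    rw [profile_sub_taylorMonomial p m (by omega), eval_finsetSum, Finset.mul_sum]
    refine Finset.sum_congr rfl fun l _ => ?_
    rw [eval_mul, eval_C]; ring
  rw [evalAt_apply, eval_toPoly_slowPart_sub, h1, Finset.range_eq_Ico,
    Finset.sum_eq_sum_Ico_succ_bot (Nat.succ_pos p)]
  rfl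

/-- At `-1` all proper integrals of the Radau polynomial vanish, and the neighbour's outflow is the
exact value up to a Taylor remainder. So the jump reads off the weight of the Radau polynomial
itself. -/
theorem jump_slowPart (p : ℕ) (G : ℕ → ℝ → ℝ) (h y : ℝ) :
    (-1) ^ (p + 1) / 2 * (evalAt p (-1) (slowPart p G h y) -
      evalAt p 1 (slowPart p G h (y - h))) = slowWeight p G h 0 y +
        (-1) ^ (p + 1) / 2 * taylorRem G (2 * p + 1) (y - h) h := by
  have h1 := evalAt_slowPart_sub p G h y (-1)
  have h2 : ∑ l ∈ Finset.Icc 1 p, slowWeight p G h l y * (radauPoly p l).eval (-1) = 0 := by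
    refine Finset.sum_eq_zero fun l hl => ?_
    obtain ⟨i, rfl⟩ := Nat.exists_eq_succ_of_ne_zero (Nat.one_le_iff_ne_zero.mp
      (Finset.mem_Icc.mp hl).1)
    rw [eval_neg_one_radauPoly_succ, mul_zero]
  have h3 : taylorRem G (2 * p + 1) y (h / 2 * (-1 + 1)) = 0 := by
    simp [taylorRem, Finset.sum_range_succ' _ (2 * p + 1)]
  rw [h2, h3, eval_neg_one_radau, neg_add_cancel, mul_zero, add_zero] at h1
  rw [evalAt_one_slowPart, sub_add_cancel]
  have h4 : (-1 : ℝ) ^ (p + 1) * (-1) ^ (p + 1) = 1 := by rw [← mul_pow]; simp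
  linear_combination (-1) ^ (p + 1) / 2 * h1 + slowWeight p G h 0 y * h4

theorem exists_slow_error_bound (p : ℕ) :
    ∃ A : ℝ, 0 ≤ A ∧ ∀ {G : ℕ → ℝ → ℝ} {S h : ℝ}, IsDerivFamily G →
      (∀ x, |G (2 * p + 2) x| ≤ S) → 0 ≤ h → ∀ y, ∀ ξ ∈ Set.Icc (-1 : ℝ) 1,
        |evalAt p ξ (slowPart p G h y) - G 0 (y + h / 2 * (ξ + 1)) -
          (evalAt p 1 (slowPart p G h y) - G 0 (y + h)) -
          (-1) ^ (p + 1) / 2 * (evalAt p (-1) (slowPart p G h y) -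
            evalAt p 1 (slowPart p G h (y - h))) * (radau p).eval ξ -
          ∑ l ∈ Finset.Icc 1 p, slowWeight p G h l y * (radauPoly p l).eval ξ| ≤
            A * S * h ^ (2 * p + 2) := by
  obtain ⟨B, hB0, hB⟩ := exists_abs_eval_le (radau p)
  refine ⟨2 + B, by positivity, fun {G S h} hG hS hh y ξ hξ => ?_⟩
  have hS0 : 0 ≤ S := (abs_nonneg _).trans (hS 0)
  rw [evalAt_slowPart_sub, jump_slowPart, evalAt_one_slowPart]
  have h1 := hG.abs_taylorRem_le (2 * p + 1) hS y (h / 2 * (ξ + 1))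
  have h2 := hG.abs_taylorRem_le (2 * p + 1) hS y h
  have h3 := hG.abs_taylorRem_le (2 * p + 1) hS (y - h) h
  rw [abs_of_nonneg hh] at h2 h3
  have h4 : |taylorRem G (2 * p + 1) y (h / 2 * (ξ + 1))| ≤ S * h ^ (2 * p + 2) :=
    h1.trans (mul_le_mul_of_nonneg_left
      (pow_le_pow_left₀ (abs_nonneg _) (abs_half_mul_add_one_le hh hξ) _) hS0)
  have h5 : |(-1) ^ (p + 1) / 2 * taylorRem G (2 * p + 1) (y - h) h * (radau p).eval ξ| ≤
      S * h ^ (2 * p + 2) * B := by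
    rw [abs_mul]
    refine mul_le_mul ?_ (hB ξ hξ) (abs_nonneg _) (by positivity)
    rw [abs_mul, abs_div, abs_pow, abs_neg, abs_one, one_pow, abs_two]
    have := abs_nonneg (taylorRem G (2 * p + 1) (y - h) h)
    have h6 : 2 * p + 1 + 1 = 2 * p + 2 := rfl
    rw [h6] at h3
    linarith
  set r₁ := taylorRem G (2 * p + 1) y (h / 2 * (ξ + 1))
  set r₂ := taylorRem G (2 * p + 1) y h
  set r₃ := taylorRem G (2 * p + 1) (y - h) h
  calc _ = |(-r₁ + r₂) - (-1) ^ (p + 1) / 2 * r₃ * (radau p).eval ξ| := by congr 1; ring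
    _ ≤ |-r₁ + r₂| + _ := abs_sub _ _
    _ ≤ |-r₁| + |r₂| + _ := by gcongr; exact abs_add_le _ _
    _ ≤ S * h ^ (2 * p + 2) + S * h ^ (2 * p + 2) + S * h ^ (2 * p + 2) * B := by
        rw [abs_neg]; exact add_le_add (add_le_add h4 h2) h5
    _ = _ := by ring

/-! ### Superconvergence -/

/-- The superconvergent form is linear and is checked on each part: on the core by smallness of the
scheme operator, on the transient by decay, on the slow part by its explicit expansion, which alone
supplies the integrals of the Radau polynomial. -/
theorem exists_superconvergence_bound {p : ℕ} {σ M : ℝ} {z : ℕ → ℕ → ℝ → Fin (p + 1) → ℝ}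
    {c : ℕ → ℕ → ℝ} (hz : IsTransient p σ z c M) {a L S T : ℝ} (ha : 0 < a) (hL : 0 < L)
    (hS : 0 ≤ S) (hT : 0 < T) :
    ∃ K : ℝ, 0 ≤ K ∧ ∀ (x₀ : ℝ) {N : ℕ}, 0 < N → L / N ≤ 1 →
      ∀ {G : ℕ → ℝ → ℝ} {v : ℕ → ℕ → ℝ → ℝ}, SmoothData p L (L / N) S G v →
      ∀ (U : ZMod N → ℝ → Fin (p + 1) → ℝ) (ρ : ZMod N → Fin (p + 1) → ℝ),
        HasSchemeDeriv p (a / (L / N)) U (fun _ _ => 0) →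
        (∀ j, U j 0 = slowPart p G (L / N) (node x₀ L N j) +
          (fun k : Fin (p + 1) => v k 0 (node x₀ L N j)) + ρ j) →
        (∀ j, ‖ρ j‖ ≤ S * (L / N) ^ (2 * p + 3)) →
        ∀ j t, 0 ≤ t → t ≤ T → ∀ y, y = node x₀ L N j - a * t →
          (∀ ξ ∈ Set.Icc (-1 : ℝ) 1,
            |evalAt p ξ (U j t) - G 0 (y + L / N / 2 * (ξ + 1)) -
              (evalAt p 1 (U j t) - G 0 (y + L / N) +
                (-1) ^ (p + 1) / 2 * (evalAt p (-1) (U j t) - evalAt p 1 (U (j - 1) t)) *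
                  (radau p).eval ξ +
                ∑ l ∈ Finset.Icc 1 p, slowWeight p G (L / N) l y * (radauPoly p l).eval ξ)| ≤
              K * ((L / N) ^ (2 * p + 2) +
                (L / N) ^ (p + 1) * Real.exp (-(σ * a * t / (L / N))))) ∧
          |evalAt p 1 (U j t) - G 0 (y + L / N)| ≤
              K * ((L / N) ^ (2 * p + 1) +
                (L / N) ^ (p + 1) * Real.exp (-(σ * a * t / (L / N)))) := by
  obtain ⟨Ke, hKe0, hKe⟩ := exists_core_bound hz ha hL hS hT
  obtain ⟨As, hAs0, hAs⟩ := exists_strong_form_bound p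
  obtain ⟨Bo, hBo0, hBo⟩ := exists_norm_schemeOp_le p
  obtain ⟨Au, hAu0, hAu⟩ := exists_slow_error_bound p
  obtain ⟨Me, hMe0, hMe⟩ := exists_linearMap_bound (evalAt p 1)
  have hM := hz.nonneg
  set Cz : ℝ := (p + 1 : ℕ) * ((p + 1 : ℕ) * (S * M)) with hCz
  have hCz0 : 0 ≤ Cz := by positivity
  refine ⟨As * Ke + As * Bo * Cz + Au * S + Me * Ke + Me * Cz + S, by positivity,
    fun x₀ {N} hN hh1 {G v} hd U ρ hU hU0 hρ j t ht htT y hy => ?_⟩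
  have hNr : (0 : ℝ) < N := by exact_mod_cast hN
  have hE := hasSchemeDeriv_remainder hz hL hN hd a x₀ hU
  have hhpos : 0 < L / N := by positivity
  have hcore := hKe x₀ hN hh1 hd _ ρ hE (fun j => by
    rw [mul_zero, zero_div, sub_zero, hU0, transSum_initial hz]
    module) hρ
  have hjs := periodic_node_sub_one (periodic_slowPart p hd.periodic (L / N)) x₀ hN j (-(a * t))
  rw [← sub_eq_add_neg, ← sub_eq_add_neg, sub_right_comm, ← hy] at hjs
  have hτ : 0 ≤ a * t / (L / N) := by positivity
  have hZb := fun i => hd.norm_transSum_le hz hhpos.le hh1 hτ (node x₀ L N i)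
  rw [← hCz, show -(σ * (a * t / (L / N))) = -(σ * a * t / (L / N)) by ring] at hZb
  set h := L / N with hh
  set X := h ^ (p + 1) * Real.exp (-(σ * a * t / h)) with hX
  have hX0 : 0 ≤ X := by positivity
  set I : ZMod N → Fin (p + 1) → ℝ := fun i => slowPart p G h (node x₀ L N i - a * t) with hI
  set Z : ZMod N → Fin (p + 1) → ℝ := fun i =>
    transSum p (fun k m => z k m (a * t / h)) v h (node x₀ L N i) with hZ
  set E : ZMod N → Fin (p + 1) → ℝ := fun i => U i t - I i - Z i with hEdef
  have hUsum : ∀ i, U i t = E i + I i + Z i := fun i => by simp only [hEdef]; abel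
  obtain ⟨hE1, hE2⟩ := hcore j t ht htT
  have hIj : I j = slowPart p G h y := by rw [hI, hy]
  have hIj' : I (j - 1) = slowPart p G h (y - h) := hjs
  have hslow := hAu hd.family (hd.bound (2 * p + 2) (by omega)) hhpos.le y
  have hrem := hd.family.abs_taylorRem_le (2 * p + 1) (hd.bound (2 * p + 2) (by omega)) y h
  rw [abs_of_pos hhpos] at hrem
  have hP0 : 0 ≤ h ^ (2 * p + 2) := by positivity
  have hP1 : 0 ≤ h ^ (2 * p + 1) := by positivity
  have hP21 : h ^ (2 * p + 2) ≤ h ^ (2 * p + 1) :=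
    pow_le_pow_of_le_one hhpos.le hh1 (by omega)
  have e1 := mul_nonneg hAs0 hKe0
  have e2 := mul_nonneg (mul_nonneg hAs0 hBo0) hCz0
  have e3 := mul_nonneg hAu0 hS
  have e4 := mul_nonneg hMe0 hKe0
  have e5 := mul_nonneg hMe0 hCz0
  constructor
  · intro ξ hξ
    have h1 := (hAs E j ξ hξ).trans (mul_le_mul_of_nonneg_left hE2 hAs0)
    have h2 := (hAs Z j ξ hξ).trans (mul_le_mul_of_nonneg_left (hBo Z _ hZb j) hAs0)
    have h3 := hslow ξ hξ
    rw [← hIj, ← hIj'] at h3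
    simp only [hUsum, map_add]
    set R := (radau p).eval ξ
    set Rs := ∑ l ∈ Finset.Icc 1 p, slowWeight p G h l y * (radauPoly p l).eval ξ
    set A₁ := evalAt p ξ (E j) - evalAt p 1 (E j) -
        (-1) ^ (p + 1) / 2 * (evalAt p (-1) (E j) - evalAt p 1 (E (j - 1))) * R
    set A₂ := evalAt p ξ (Z j) - evalAt p 1 (Z j) -
        (-1) ^ (p + 1) / 2 * (evalAt p (-1) (Z j) - evalAt p 1 (Z (j - 1))) * R
    set A₃ := evalAt p ξ (I j) - G 0 (y + h / 2 * (ξ + 1)) - (evalAt p 1 (I j) - G 0 (y + h)) -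
        (-1) ^ (p + 1) / 2 * (evalAt p (-1) (I j) - evalAt p 1 (I (j - 1))) * R - Rs
    calc _ = |A₁ + A₂ + A₃| := by congr 1; ring
      _ ≤ |A₁| + |A₂| + |A₃| := abs_add_three _ _ _
      _ ≤ As * (Ke * h ^ (2 * p + 2)) + As * (Bo * (Cz * X)) + Au * S * h ^ (2 * p + 2) :=
          add_le_add (add_le_add h1 h2) h3
      _ ≤ _ := by
          have f1 := mul_nonneg e1 hX0
          have f2 := mul_nonneg e2 hP0
          have f3 := mul_nonneg e3 hX0
          have f4 : 0 ≤ (Me * Ke + Me * Cz + S) * (h ^ (2 * p + 2) + X) := by positivity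
          linarith
  · have h1 := (hMe (E j)).trans (mul_le_mul_of_nonneg_left hE1 hMe0)
    have h2 := (hMe (Z j)).trans (mul_le_mul_of_nonneg_left (hZb j) hMe0)
    rw [Real.norm_eq_abs] at h1 h2
    have h3 : evalAt p 1 (I j) - G 0 (y + h) = -taylorRem G (2 * p + 1) y h := by
      rw [hIj, evalAt_one_slowPart]; ring
    simp only [hUsum, map_add]
    calc _ = |evalAt p 1 (E j) + evalAt p 1 (Z j) + (evalAt p 1 (I j) - G 0 (y + h))| := by
          congr 1; ring
      _ ≤ _ := abs_add_three _ _ _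
      _ ≤ Me * (Ke * h ^ (2 * p + 1)) + Me * (Cz * X) + S * h ^ (2 * p + 1) := by
          refine add_le_add (add_le_add h1 h2) ?_
          rw [h3, abs_neg]
          exact hrem.trans (mul_le_mul_of_nonneg_left hP21 hS)
      _ ≤ _ := by
          have f1 := mul_nonneg e4 hX0
          have f2 := mul_nonneg e5 hP1
          have f3 := mul_nonneg hS hX0
          have f4 : 0 ≤ (As * Ke + As * Bo * Cz + Au * S) * (h ^ (2 * p + 1) + X) := by positivity
          linarith

theorem numSol_eq_toPoly (p : ℕ) {N : ℕ} (c : ZMod N → ℕ → ℝ → ℝ) (j : ZMod N) (t : ℝ) :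
    numSol p c j t = toPoly p (fun k => c j k t) :=
  cellPoly_eq_toPoly p _

theorem jump_eq_evalAt (p : ℕ) {N : ℕ} (c : ZMod N → ℕ → ℝ → ℝ) (j : ZMod N) (t : ℝ) :
    jump p c j t = evalAt p (-1) (fun k => c j k t) - evalAt p 1 (fun k => c (j - 1) k t) := by
  rw [jump, numSol_eq_toPoly, numSol_eq_toPoly]; rfl

theorem IsSmoothPeriodicSolution.dgError_eq {a L : ℝ} {u : ℝ → ℝ → ℝ}
    (hu : IsSmoothPeriodicSolution a L u) (p : ℕ) (x₀ : ℝ) {N : ℕ} (c : ZMod N → ℕ → ℝ → ℝ)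
    (j : ZMod N) (ξ : ℝ) {t : ℝ} (ht : 0 ≤ t) :
    dgError p x₀ L u c j ξ t = evalAt p ξ (fun k => c j k t) -
      u (node x₀ L N j - a * t + L / N / 2 * (ξ + 1)) 0 := by
  rw [dgError, numSol_eq_toPoly, evalAt_apply]
  congr 1
  simp only [toCell]
  rw [hu.eq_transport _ ht, node]
  congr 1
  ring

end

end DGAdvection

/-! ### The main theorem -/

open DGAdvection in
theorem theorem2 (p : ℕ) :
    ∃ σ : ℝ, 0 < σ ∧
      ∀ (a L x₀ : ℝ), 0 < a → 0 < L →
      ∀ u : ℝ → ℝ → ℝ, IsSmoothPeriodicSolution a L u →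
      ∀ proj : ℕ → (ℝ → ℝ) → Polynomial ℝ, IsStableProjection p proj →
      ∀ c : (N : ℕ) → ZMod N → ℕ → ℝ → ℝ,
        (∀ N : ℕ, 0 < N → IsDGSolution p a (L / N) (c N)) →
        (∀ N : ℕ, 0 < N → ∀ j : ZMod N,
          numSol p (c N) j 0 = proj N (toCell x₀ L N j (fun x => u x 0))) →
        (∀ k ≤ p, ∃ (K : ℝ) (N₁ : ℕ), ∀ N : ℕ, 0 < N → N₁ ≤ N → ∀ j : ZMod N,
          |∫ ξ in (-1 : ℝ)..1, dgError p x₀ L u (c N) j ξ 0 * (legendre k).eval ξ|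
            ≤ K * (L / N) ^ (2 * p + 1 - k)) →
      ∃ α : (N : ℕ) → ZMod N → ℕ → ℝ → ℝ,
        ∀ T : ℝ, 0 < T → ∃ (K : ℝ) (N₀ : ℕ), ∀ N : ℕ, 0 < N → N₀ ≤ N →
          ∀ (j : ZMod N) (t : ℝ), 0 ≤ t → t ≤ T →
            (∀ k : ℕ, p + 2 ≤ k → k ≤ 2 * p + 1 → |α N j k t| ≤ K * (L / N) ^ k) ∧
            (∀ ξ ∈ Set.Icc (-1 : ℝ) 1,
              |dgError p x₀ L u (c N) j ξ t -
                  (dgError p x₀ L u (c N) j 1 t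
                    + (-1) ^ (p + 1) / 2 * jump p (c N) j t * (radau p).eval ξ
                    + ∑ k ∈ Finset.Icc 1 p, α N j (p + 1 + k) t * radauInt p k ξ)|
                ≤ K * ((L / N) ^ (2 * p + 2)
                    + (L / N) ^ (p + 1) * Real.exp (-(σ * a * t / (L / N))))) ∧
            |dgError p x₀ L u (c N) j 1 t|
                ≤ K * ((L / N) ^ (2 * p + 1)
                    + (L / N) ^ (p + 1) * Real.exp (-(σ * a * t / (L / N)))) ∧
            (1 ≤ p → ∀ ξ ∈ Set.Icc (-1 : ℝ) 1, (radau p).eval ξ = 0 →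
              |dgError p x₀ L u (c N) j ξ t|
                ≤ K * ((L / N) ^ (p + 2)
                    + (L / N) ^ (p + 1) * Real.exp (-(σ * a * t / (L / N))))) := by
  -- The rate belongs to the one-cell problem in the fast time and so depends on `p` only.
  obtain ⟨σ, z, cz, M, hz⟩ := exists_isTransient p
  refine ⟨σ, hz.rate_pos, fun a L x₀ ha hL u hu proj hproj c hc hinit hmom => ?_⟩
  set g : ℝ → ℝ := fun x => u x 0 with hg
  set G : ℕ → ℝ → ℝ := fun i => iteratedDeriv i g with hG
  have hG0 : G 0 = g := iteratedDeriv_zero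
  have herr : ∀ (N : ℕ) (j : ZMod N) (ξ t : ℝ), 0 ≤ t → dgError p x₀ L u (c N) j ξ t =
      evalAt p ξ (fun k => c N j k t) - G 0 (node x₀ L N j - a * t + L / N / 2 * (ξ + 1)) :=
    fun N j ξ t ht => by rw [hG0]; exact hu.dgError_eq p x₀ (c N) j ξ ht
  obtain ⟨S, N₀, hS, hdata⟩ := exists_smoothData hproj hu.contDiff_initial hL hu.periodic_initial
    x₀ (fun N j k => c N j k 0)
    (fun N hN j => by
      rw [← coefL_toPoly p (fun k : Fin (p + 1) => c N j k 0), ← numSol_eq_toPoly, hinit N hN j]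
      rfl)
    (fun k hk => by
      obtain ⟨K, N₁, hK⟩ := hmom k hk
      refine ⟨K, N₁, fun N hN hNN j => ?_⟩
      have := hK N hN hNN j
      simp only [herr N j _ 0 le_rfl, mul_zero, sub_zero, hG0] at this
      exact this)
  -- The coefficients come from the slow part alone, hence do not depend on `T`; `α_k` multiplies
  -- the integral of index `k - (p + 1)`.
  refine ⟨fun N j k t => slowWeight p G (L / N) (k - (p + 1)) (node x₀ L N j - a * t),
    fun T hT => ?_⟩
  obtain ⟨K, hK0, hK⟩ := exists_superconvergence_bound hz ha hL hS hT
  obtain ⟨Aw, hAw0, hAw⟩ := exists_abs_slowWeight_le p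
  choose B hB0 hB using fun k => exists_abs_eval_le (radauPoly p k)
  set Bs := ∑ k ∈ Finset.Icc 1 p, B k with hBs
  have hBs0 : 0 ≤ Bs := Finset.sum_nonneg fun k _ => hB0 k
  have hAS : 0 ≤ Aw * S := mul_nonneg hAw0 hS
  have hASB : 0 ≤ Aw * S * Bs := mul_nonneg hAS hBs0
  -- At a Radau point `K` enters twice, from the expansion and from the downwind value; `Aw * S`
  -- bounds the coefficients and `Aw * S * Bs` their sum with the integrals.
  refine ⟨2 * K + Aw * S + Aw * S * Bs, N₀, fun N hN hNN j t ht htT => ?_⟩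
  obtain ⟨hh1, v, ρ, hd, hdec, hρ⟩ := hdata N hN hNN
  have hNr : (0 : ℝ) < N := by exact_mod_cast hN
  have hh0 : 0 < L / N := by positivity
  obtain ⟨h1, h2⟩ := hK x₀ hN hh1 hd (fun j t k => c N j k t) ρ (hc N hN).hasSchemeDeriv hdec hρ
    j t ht htT _ rfl
  have hcoef : ∀ l ≤ p, |slowWeight p G (L / N) l (node x₀ L N j - a * t)| ≤
      Aw * S * (L / N) ^ (p + 1 + l) := fun l hl =>
    hAw (fun i hi => hd.bound i (by omega)) hh0.le hh1 l hl _
  have herr1 : dgError p x₀ L u (c N) j 1 t = evalAt p 1 (fun k => c N j k t) -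
      G 0 (node x₀ L N j - a * t + L / N) := by
    rw [herr N j 1 t ht]
    congr 3
    ring
  have hform : ∀ ξ ∈ Set.Icc (-1 : ℝ) 1, |dgError p x₀ L u (c N) j ξ t -
      (dgError p x₀ L u (c N) j 1 t + (-1) ^ (p + 1) / 2 * jump p (c N) j t * (radau p).eval ξ +
        ∑ k ∈ Finset.Icc 1 p, slowWeight p G (L / N) (p + 1 + k - (p + 1))
          (node x₀ L N j - a * t) * radauInt p k ξ)| ≤
      K * ((L / N) ^ (2 * p + 2) + (L / N) ^ (p + 1) * Real.exp (-(σ * a * t / (L / N)))) := by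
    intro ξ hξ
    simp only [Nat.add_sub_cancel_left, radauInt_eq_eval, jump_eq_evalAt]
    rw [herr1, herr N j ξ t ht]
    exact h1 ξ hξ
  rw [← herr1] at h2
  set h := L / N with hh
  set X := h ^ (p + 1) * Real.exp (-(σ * a * t / h)) with hX
  have hX0 : 0 ≤ X := by positivity
  have hle : ∀ {Y : ℝ}, 0 ≤ Y → K * (Y + X) ≤ (2 * K + Aw * S + Aw * S * Bs) * (Y + X) :=
    fun hY => mul_le_mul_of_nonneg_right (by linarith) (add_nonneg hY hX0)
  refine ⟨fun k hk1 hk2 => ?_, fun ξ hξ => (hform ξ hξ).trans (hle (by positivity)),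
    h2.trans (hle (by positivity)), fun hp ξ hξ hR => ?_⟩
  · have h3 := hcoef (k - (p + 1)) (by omega)
    rw [show p + 1 + (k - (p + 1)) = k by omega] at h3
    exact h3.trans (mul_le_mul_of_nonneg_right (by linarith) (by positivity))
  -- At a Radau point the jump term drops out and the sum has order `h ^ (p+2)`. The downwind error
  -- is no larger since `2p + 1 ≥ p + 2`, which is where `1 ≤ p` enters.
  · have hP : 0 ≤ h ^ (p + 2) := by positivity
    have h3 := hform ξ hξ
    rw [hR, mul_zero, add_zero] at h3
    have h4 : |∑ k ∈ Finset.Icc 1 p, slowWeight p G h (p + 1 + k - (p + 1))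
        (node x₀ L N j - a * t) * radauInt p k ξ| ≤ Aw * S * Bs * h ^ (p + 2) := by
      rw [hBs, Finset.mul_sum, Finset.sum_mul]
      refine (Finset.abs_sum_le_sum_abs _ _).trans (Finset.sum_le_sum fun k hk => ?_)
      rw [Finset.mem_Icc] at hk
      rw [Nat.add_sub_cancel_left, radauInt_eq_eval, abs_mul]
      calc _ ≤ Aw * S * h ^ (p + 1 + k) * B k :=
            mul_le_mul (hcoef k hk.2) (hB k ξ hξ) (abs_nonneg _) (by positivity)
        _ ≤ Aw * S * h ^ (p + 2) * B k := by
            refine mul_le_mul_of_nonneg_right (mul_le_mul_of_nonneg_left ?_ hAS) (hB0 k)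
            exact pow_le_pow_of_le_one hh0.le hh1 (by omega)
        _ = _ := by ring
    have h5 : K * (h ^ (2 * p + 2) + X) ≤ K * (h ^ (p + 2) + X) :=
      mul_le_mul_of_nonneg_left
        (add_le_add_left (pow_le_pow_of_le_one hh0.le hh1 (by omega)) X) hK0
    have h6 : K * (h ^ (2 * p + 1) + X) ≤ K * (h ^ (p + 2) + X) :=
      mul_le_mul_of_nonneg_left
        (add_le_add_left (pow_le_pow_of_le_one hh0.le hh1 (by omega)) X) hK0
    set e₁ := dgError p x₀ L u (c N) j 1 t
    set Rs := ∑ k ∈ Finset.Icc 1 p, slowWeight p G h (p + 1 + k - (p + 1))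
        (node x₀ L N j - a * t) * radauInt p k ξ
    set e := dgError p x₀ L u (c N) j ξ t
    calc |e| = |(e - (e₁ + Rs)) + e₁ + Rs| := by congr 1; ring
      _ ≤ _ := abs_add_three _ _ _
      _ ≤ K * (h ^ (p + 2) + X) + K * (h ^ (p + 2) + X) + Aw * S * Bs * h ^ (p + 2) :=
          add_le_add (add_le_add (h3.trans h5) (h2.trans h6)) h4
      _ ≤ _ := by
          have f1 := mul_nonneg hASB hX0
          have f2 : 0 ≤ Aw * S * (h ^ (p + 2) + X) := by positivity
          linarith
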